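/- Call a strictly increasing function $S:[0,\infty)\to[0,\infty)$ \emph{widely admissible} if (i) $S$ extends to an entire function $\tilde S:\mathbb{C}\to\mathbb{C}$ with $\tilde S^{(n)}(0)\ge 0$ for all $n\in\mathbb{N}_0$, and (ii) there is an $\varepsilon>0$ with \[\limsup_{x\to\infty}\frac{\log^2 S((1+\varepsilon)x)}{S(x)}=0 .\] Let $\hat f(\xi)=\int_{\mathbb{R}}f(x)e^{-2\pi i x\xi}\,dx$ and let \[\mathcal{H}=\Big\{f\in L^2(\mathbb{R}):\int_{\mathbb{R}}(1+x^2)|f(x)|^2\,dx+\int_{\mathbb{R}}(1+\xi^2)|\hat f(\xi)|^2\,d\xi<\infty\Big\}\] be the Fourier symmetric Sobolev space of complex-valued functions; each $f\in\mathcal{H}$ is identified with its continuous representative. Let $S,S^{-1}:[0,\infty)\to[0,\infty)$ be a pair of mutually inverse functions in the following sense: either $S$ is widely admissible and $S^{-1}(y)=\inf\{x\ge 0: S(x)\ge y\}$, or $S^{-1}$ is widely admissible and $S(x)=\inf\{y\ge 0: S^{-1}(y)\ge x\}$. Let $0<s<\infty$, and let $\Lambda=(\lambda_j)_{j\in\mathbb{Z}}$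 and $M=(\mu_j)_{j\in\mathbb{Z}}$ be strictly increasing sequences of real numbers with $\lambda_j\to\pm\infty$ and $\mu_j\to\pm\infty$ as $j\to\pm\infty$. Suppose that \[\limsup_{|j|\to\infty}\, \big(S^{-1}(\max\{|\lambda_j|,|\lambda_{j+1}|\})\big)^{1/s}(\lambda_{j+1}-\lambda_j)<\tfrac12 \quad\text{and}\quad \limsup_{|j|\to\infty}\, S\big(\max\{|\mu_j|,|\mu_{j+1}|\}^{s}\big)(\mu_{j+1}-\mu_j)<\tfrac12 .\] Then the complex vector space of all $f\in\mathcal{H}$ with $f(\lambda_j)=0$ and $\hat f(\mu_j)=0$ for all $j\in\mathbb{Z}$ is finite-dimensional. -/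

import Mathlib

open MeasureTheory Filter Topology
open scoped NNReal FourierTransform

/-- A (strictly) increasing function `S : [0,∞) → [0,∞)` is *widely admissible* if it extends to an
entire function all of whose derivatives at `0` are non-negative reals, and if for some `ε > 0`
`limsup_{x → ∞} log² S((1+ε)x) / S(x) = 0` (an upper limit in the extended reals). -/
structure WidelyAdmissible (S : ℝ≥0 → ℝ≥0) : Prop where
  strictMono : StrictMono S
  extension : ∃ F : ℂ → ℂ, Differentiable ℂ F ∧
    (∀ x : ℝ≥0, F ((x : ℝ) : ℂ) = ((S x : ℝ) : ℂ)) ∧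
    ∀ n : ℕ, 0 ≤ (iteratedDeriv n F 0).re ∧ (iteratedDeriv n F 0).im = 0
  growth : ∃ ε : ℝ≥0, 0 < ε ∧
    limsup (fun x : ℝ≥0 =>
      ((Real.log (S ((1 + ε) * x)) ^ 2 / (S x : ℝ) : ℝ) : EReal)) atTop = 0

/-- The generalized inverse `S⁻¹(y) = inf {x ≥ 0 : S(x) ≥ y}`. -/
noncomputable def genInv (S : ℝ≥0 → ℝ≥0) (y : ℝ≥0) : ℝ≥0 := sInf {x : ℝ≥0 | y ≤ S x}

/-- A strictly increasing real sequence indexed by `ℤ` that tends to `±∞` at `±∞`. -/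
structure IsOrderedSeq (a : ℤ → ℝ) : Prop where
  strictMono : StrictMono a
  tendsto_atTop : Tendsto a atTop atTop
  tendsto_atBot : Tendsto a atBot atBot

lemma integrable_of_weighted_sq {f : ℝ → ℂ} (hf : Continuous f)
    (h : Integrable (fun x : ℝ => (1 + x ^ 2) * ‖f x‖ ^ 2)) : Integrable f := by
  refine (integrable_inv_one_add_sq.add h).mono' hf.aestronglyMeasurable
    (Eventually.of_forall fun x => ?_)
  have hx : 0 < 1 + x ^ 2 := by positivity
  have h1 : (1 + x ^ 2)⁻¹ * (1 + x ^ 2) = 1 := inv_mul_cancel₀ hx.ne'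
  have h2 : 0 < (1 + x ^ 2)⁻¹ := inv_pos.mpr hx
  simp only [Pi.add_apply]
  nlinarith [mul_nonneg h2.le (sq_nonneg (1 - (1 + x ^ 2) * ‖f x‖)), norm_nonneg (f x),
    mul_nonneg hx.le (sq_nonneg ‖f x‖)]

lemma weighted_sq_add {f g : ℝ → ℂ} (hf : Continuous f) (hg : Continuous g)
    (h1 : Integrable (fun x : ℝ => (1 + x ^ 2) * ‖f x‖ ^ 2))
    (h2 : Integrable (fun x : ℝ => (1 + x ^ 2) * ‖g x‖ ^ 2)) :
    Integrable (fun x : ℝ => (1 + x ^ 2) * ‖(f + g) x‖ ^ 2) := by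
  refine ((h1.const_mul 2).add (h2.const_mul 2)).mono'
    (by simp only [Pi.add_apply]; fun_prop) (Eventually.of_forall fun x => ?_)
  have hx : 0 < 1 + x ^ 2 := by positivity
  have h3 : ‖(f + g) x‖ ≤ ‖f x‖ + ‖g x‖ := norm_add_le _ _
  have h4 : ‖(f + g) x‖ ^ 2 ≤ 2 * ‖f x‖ ^ 2 + 2 * ‖g x‖ ^ 2 := by
    nlinarith [norm_nonneg ((f + g) x), sq_nonneg (‖f x‖ - ‖g x‖)]
  rw [Real.norm_of_nonneg (by positivity)]
  simp only [Pi.add_apply] at h4 ⊢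
  nlinarith [mul_le_mul_of_nonneg_left h4 hx.le]

lemma fourier_continuous_of_integrable {f : ℝ → ℂ} (hf : Integrable f) : Continuous (𝓕 f) :=
  VectorFourier.fourierIntegral_continuous Real.continuous_fourierChar
    (by exact continuous_inner) hf

/-- The Fourier symmetric Sobolev space
`𝓗 = {f ∈ L² : ∫ (1+x²)|f(x)|² dx + ∫ (1+ξ²)|f̂(ξ)|² dξ < ∞}`,
`f̂(ξ) = ∫ f(x) exp(-2πixξ) dx`. Finiteness of the first integral puts `f` in `L¹ ∩ L²`, finiteness
of the second puts `f̂` in `L¹`, so each class has exactly one continuous representative; the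
elements of the space are these representatives, so that point values make sense. -/
noncomputable def fourierSobolev : Submodule ℂ (ℝ → ℂ) where
  carrier := {f | Continuous f ∧ Integrable (fun x : ℝ => (1 + x ^ 2) * ‖f x‖ ^ 2) ∧
    Integrable (fun ξ : ℝ => (1 + ξ ^ 2) * ‖𝓕 f ξ‖ ^ 2)}
  zero_mem' := by
    have h0 : 𝓕 (0 : ℝ → ℂ) = 0 := by ext ξ; simp [Real.fourier_eq]
    refine ⟨continuous_zero, by simp, by simp [h0]⟩
  add_mem' := by
    rintro f g ⟨hf, hf1, hf2⟩ ⟨hg, hg1, hg2⟩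
    have If := integrable_of_weighted_sq hf hf1
    have Ig := integrable_of_weighted_sq hg hg1
    have hadd : 𝓕 (f + g) = 𝓕 f + 𝓕 g :=
      (VectorFourier.fourierIntegral_add Real.continuous_fourierChar
        (by exact continuous_inner) If Ig)
    refine ⟨hf.add hg, weighted_sq_add hf hg hf1 hg1, ?_⟩
    rw [hadd]
    exact weighted_sq_add (fourier_continuous_of_integrable If)
      (fourier_continuous_of_integrable Ig) hf2 hg2
  smul_mem' := by
    rintro c f ⟨hf, hf1, hf2⟩
    have hs : 𝓕 (c • f) = c • 𝓕 f :=
      VectorFourier.fourierIntegral_const_smul _ _ _ f c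
    refine ⟨hf.const_smul c, ?_, ?_⟩
    · refine (hf1.const_mul (‖c‖ ^ 2)).congr (Eventually.of_forall fun x => ?_)
      simp only [Pi.smul_apply, norm_smul]; ring
    · rw [hs]
      refine (hf2.const_mul (‖c‖ ^ 2)).congr (Eventually.of_forall fun x => ?_)
      simp only [Pi.smul_apply, norm_smul]; ring

/-- The functions in `𝓗` that vanish on the pair `(Λ, M)`: `f = 0` on `Λ` and `f̂ = 0` on `M`. -/
noncomputable def vanishingSpace (L M : Set ℝ) : Submodule ℂ (ℝ → ℂ) where
  carrier := {f | f ∈ fourierSobolev ∧ (∀ x ∈ L, f x = 0) ∧ ∀ ξ ∈ M, 𝓕 f ξ = 0}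
  zero_mem' := by
    have h0 : 𝓕 (0 : ℝ → ℂ) = 0 := by ext ξ; simp [Real.fourier_eq]
    exact ⟨fourierSobolev.zero_mem, by simp, by simp [h0]⟩
  add_mem' := by
    rintro f g ⟨hf, hf1, hf2⟩ ⟨hg, hg1, hg2⟩
    have hadd : 𝓕 (f + g) = 𝓕 f + 𝓕 g :=
      (VectorFourier.fourierIntegral_add Real.continuous_fourierChar
        (by exact continuous_inner) (integrable_of_weighted_sq hf.1 hf.2.1)
        (integrable_of_weighted_sq hg.1 hg.2.1))
    refine ⟨fourierSobolev.add_mem hf hg, fun x hx => by simp [hf1 x hx, hg1 x hx], ?_⟩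
    intro ξ hξ
    simp [hadd, hf2 ξ hξ, hg2 ξ hξ]
  smul_mem' := by
    rintro c f ⟨hf, hf1, hf2⟩
    have hs : 𝓕 (c • f) = c • 𝓕 f :=
      VectorFourier.fourierIntegral_const_smul _ _ _ f c
    refine ⟨fourierSobolev.smul_mem c hf, fun x hx => by simp [hf1 x hx], ?_⟩
    intro ξ hξ
    simp [hs, hf2 ξ hξ]

/-!
For `f` in the vanishing space write `E = ∫ |f|²`, `X = ∫ x² |f|²` and `D = ∫ ξ² |𝓕 f|²`. The space
is finite-dimensional as soon as `X ≤ C E` and `D ≤ C E` on it: sampling on a fine finite grid is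
then injective (`finiteDimensional_of_moments`), since a function with bounded moments that vanishes
on the grid is small on the grid by Wirtinger's inequality and small outside it by Chebyshev's.

Let `A` be the weight in the gap condition on `Λ` and `B` the one in the gap condition on `M`; they
are inverse to each other. Wirtinger's inequality between consecutive zeros, with its optimal
constant, says that a function whose Fourier transform vanishes on `M` satisfies
`∫_{|ξ| ≥ R} (B 𝓕 f)² ≤ a² X` for some `a < 1` (`weighted_wirtinger`). The same inequality on the
other side, applied to the product of `f` with a cutoff to an annulus `|x| ≈ l`, which still vanishes
on `Λ`, says that this product has mean square frequency at least `(A(l) / a)²`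
(`local_frequency_bound`). If multiplication by the cutoff does not move frequencies too much, a
frequency of size `A(l) / a` carries weight `B` at least about `l / a`. Summing over a geometric
sequence of annuli therefore bounds the part of `X` outside a large ball by a proper fraction of `X`,
up to a multiple of `E`, and the fraction is absorbed (`moment_le_of_outer_le`).

A widely admissible function is a power series `T` with non-negative coefficients, and there are two
regimes.

* If `T` is not a polynomial, then `B(ξ)` exceeds every power of `ξ / A(x)` for `ξ ≥ A(x)`, up to the
  factor `x / 2` (`exists_superpolynomial_growth`). A dyadic decomposition is precise enough: only
  frequencies strictly beyond `A(l)` matter, and these are weighted by an arbitrarily small constant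
  (`tsum_dyadic_pieces_le`, `finiteDimensional_of_superpolynomial`).
* If `T` is a polynomial, then the weights can be replaced by inverse powers `c ξ ^ r` and
  `(x / c) ^ (1 / r)`, at the cost of constants close to `1`, and by exchanging the two sides through
  the Fourier transform one may assume `r ≥ 1`. Now no constant factor may be lost. Bernoulli's
  inequality passes from second moments to moments of order `2 r` (`rpow_moment_lower_bound`); the
  ratio of the annuli is taken close to `1`; and the commutator of the weight with the cutoffs is of
  lower order, while the convolutions with the transforms of the cutoffs satisfy Bessel's inequality
  (`tsum_lintegral_conv_sq_le`, `tsum_weighted_pieces_le`, `finiteDimensional_of_power`).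

Integrals of non-negative functions are Lebesgue integrals with values in `[0, ∞]`, so that moments
may be written down before they are known to be finite.
-/

open scoped ENNReal ContDiff

/-! ### Plancherel and Wirtinger -/

lemma eLpNorm_two_sq (F : ℝ → ℂ) : eLpNorm F 2 volume ^ 2 = ∫⁻ x, ‖F x‖ₑ ^ 2 := by
  rw [eLpNorm_eq_lintegral_rpow_enorm_toReal (by norm_num) (by norm_num), ← ENNReal.rpow_natCast,
    ← ENNReal.rpow_mul]
  norm_num

lemma memLp_two_of_lintegral_lt_top {h : ℝ → ℂ} (hh : AEStronglyMeasurable h)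
    (h2 : ∫⁻ x, ‖h x‖ₑ ^ 2 < ⊤) : MemLp h 2 := by
  refine ⟨hh, ?_⟩
  have : eLpNorm h 2 volume ^ 2 < ⊤ := by rwa [eLpNorm_two_sq]
  exact (ENNReal.pow_lt_top_iff.1 this).resolve_right (by norm_num)

/-- The `L²` Fourier transform of an integrable function is given by the Fourier integral, because
both define the same tempered distribution. Hence Plancherel's theorem on `L¹ ∩ L²`. -/
theorem lintegral_enorm_sq_fourier {f : ℝ → ℂ} (hf : Integrable f) (hf2 : MemLp f 2) :
    ∫⁻ ξ, ‖𝓕 f ξ‖ₑ ^ 2 = ∫⁻ x, ‖f x‖ₑ ^ 2 := by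
  set g : Lp ℂ 2 (volume : Measure ℝ) := hf2.toLp f with hg
  have hgf : (g : ℝ → ℂ) =ᵐ[volume] f := hf2.coeFn_toLp
  have hcont : Continuous (𝓕 f) := fourier_continuous_of_integrable hf
  have key : ((𝓕 g : Lp ℂ 2 (volume : Measure ℝ)) : ℝ → ℂ) =ᵐ[volume] 𝓕 f := by
    refine ae_eq_of_integral_contDiff_smul_eq ?_ hcont.locallyIntegrable ?_
    · exact (Lp.memLp _).locallyIntegrable (by norm_num)
    intro ψ hψ hψc
    have hψ' : ContDiff ℝ (⊤ : ℕ∞) (fun x => (ψ x : ℂ)) := Complex.ofRealCLM.contDiff.comp hψ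
    have hψc' : HasCompactSupport (fun x => (ψ x : ℂ)) :=
      hψc.comp_left (g := fun t : ℝ => (t : ℂ)) (by simp)
    set Ψ : SchwartzMap ℝ ℂ := hψc'.toSchwartzMap hψ' with hΨ
    have h1 := congrArg (fun T => T Ψ) (Lp.fourier_toTemperedDistribution_eq g)
    simp only [TemperedDistribution.fourier_apply, Lp.toTemperedDistribution_apply] at h1
    have h2 : ∫ x, ψ x • ((𝓕 g : Lp ℂ 2 (volume : Measure ℝ)) : ℝ → ℂ) x =
        ∫ x, Ψ x • ((𝓕 g : Lp ℂ 2 (volume : Measure ℝ)) : ℝ → ℂ) x := by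
      simp [hΨ]
    have h3 : ∫ x, ψ x • 𝓕 f x = ∫ x, 𝓕 f x • Ψ x := by
      simp [hΨ, mul_comm]
    have h5 : ∫ ξ, 𝓕 f ξ • Ψ ξ = ∫ x, f x • 𝓕 (Ψ : ℝ → ℂ) x := by
      have := VectorFourier.integral_fourierIntegral_smul_eq_flip (L := innerₗ ℝ) (μ := volume)
        (ν := volume) (f := f) (g := (Ψ : ℝ → ℂ)) Real.continuous_fourierChar
        (by exact continuous_inner) hf Ψ.integrable
      rw [flip_innerₗ] at this
      exact this
    rw [h2, ← h1, h3, h5]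
    refine integral_congr_ae ?_
    filter_upwards [hgf] with x hx
    rw [hx, smul_eq_mul, smul_eq_mul, mul_comm, SchwartzMap.fourier_coe]
  have e1 : eLpNorm (𝓕 f) 2 volume = eLpNorm f 2 volume := by
    rw [← eLpNorm_congr_ae key, ← eLpNorm_congr_ae hgf, ← Lp.enorm_def, ← Lp.enorm_def,
      ← ofReal_norm, ← ofReal_norm, Lp.norm_fourier_eq]
  rw [← eLpNorm_two_sq, ← eLpNorm_two_sq, e1]

lemma integral_norm_sq_fourier {f : ℝ → ℂ} (hf : Integrable f) (hf2 : MemLp f 2) :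
    Integrable (fun ξ => ‖𝓕 f ξ‖ ^ 2) ∧ ∫ ξ, ‖𝓕 f ξ‖ ^ 2 = ∫ x, ‖f x‖ ^ 2 := by
  have h := lintegral_enorm_sq_fourier hf hf2
  have hm : AEStronglyMeasurable (𝓕 f) := (fourier_continuous_of_integrable hf).aestronglyMeasurable
  have hF : MemLp (𝓕 f) 2 := memLp_two_of_lintegral_lt_top hm (by
    rw [h, ← eLpNorm_two_sq]
    exact ENNReal.pow_lt_top hf2.2)
  refine ⟨hF.integrable_norm_pow (by norm_num), ?_⟩
  have e : ∀ F : ℝ → ℂ, AEStronglyMeasurable F →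
      ∫ x, ‖F x‖ ^ 2 = (∫⁻ x, ‖F x‖ₑ ^ 2).toReal := by
    intro F hF
    rw [integral_eq_lintegral_of_nonneg_ae (f := fun x => ‖F x‖ ^ 2)
      (Eventually.of_forall fun x => sq_nonneg _) (hF.norm.pow 2)]
    congr 1
    refine lintegral_congr fun x => ?_
    rw [ENNReal.ofReal_pow (norm_nonneg _), ofReal_norm]
  rw [e _ hm, e _ hf.1, h]

/-- Wirtinger's inequality on an interval, with boundary terms. It follows by integrating
`0 ≤ ‖g' - m g‖²`, where `m` is the logarithmic derivative of a cosine that is positive on the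
interval, so that `m' + m² = -κ²`. -/
theorem wirtinger_interval {g g' : ℝ → ℂ} (hg : ∀ x, HasDerivAt g (g' x) x) (hg' : Continuous g')
    {p q κ : ℝ} (hpq : p ≤ q) (hκ : 0 ≤ κ) (hκl : κ * (q - p) < Real.pi) :
    κ ^ 2 * ∫ x in p..q, ‖g x‖ ^ 2 ≤ (∫ x in p..q, ‖g' x‖ ^ 2) +
      κ * Real.tan (κ * (q - p) / 2) * (‖g p‖ ^ 2 + ‖g q‖ ^ 2) := by
  set c := (p + q) / 2 with hc
  set m : ℝ → ℝ := fun x => -κ * Real.tan (κ * (x - c)) with hm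
  have hgc : Continuous g := continuous_iff_continuousAt.2 fun x => (hg x).continuousAt
  have hcos : ∀ x ∈ Set.uIcc p q, Real.cos (κ * (x - c)) ≠ 0 := by
    intro x hx
    rw [Set.uIcc_of_le hpq] at hx
    refine (Real.cos_pos_of_mem_Ioo ⟨?_, ?_⟩).ne'
    · nlinarith [mul_le_mul_of_nonneg_left hx.1 hκ]
    · nlinarith [mul_le_mul_of_nonneg_left hx.2 hκ]
  have hmd : ∀ x ∈ Set.uIcc p q, HasDerivAt m (-κ ^ 2 - m x ^ 2) x := by
    intro x hx
    have h1 : HasDerivAt (fun x => κ * (x - c)) κ x := by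
      simpa using ((hasDerivAt_id x).sub_const c).const_mul κ
    have h2 := ((Real.hasDerivAt_tan (hcos x hx)).comp x h1).const_mul (-κ)
    refine h2.congr_deriv ?_
    have h3 := hcos x hx
    simp only [hm, Real.tan_eq_sin_div_cos]
    have h4 := Real.sin_sq_add_cos_sq (κ * (x - c))
    field_simp
    linear_combination κ ^ 2 * h4
  have hG : ∀ x ∈ Set.uIcc p q, HasDerivAt (fun x => m x * ‖g x‖ ^ 2)
      ((-κ ^ 2 - m x ^ 2) * ‖g x‖ ^ 2 + m x * (2 * inner ℝ (g x) (g' x))) x :=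
    fun x hx => (hmd x hx).mul (hg x).norm_sq
  have hmc : ContinuousOn m (Set.uIcc p q) :=
    fun x hx => (hmd x hx).continuousAt.continuousWithinAt
  have hint : ContinuousOn (fun x => (-κ ^ 2 - m x ^ 2) * ‖g x‖ ^ 2 +
      m x * (2 * inner ℝ (g x) (g' x))) (Set.uIcc p q) := by
    have h1 : Continuous fun x => inner ℝ (g x) (g' x) := hgc.inner hg'
    fun_prop
  have hI := intervalIntegral.integral_eq_sub_of_hasDerivAt hG hint.intervalIntegrable
  have i1 : IntervalIntegrable (fun x => ‖g x‖ ^ 2) volume p q :=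
    (hgc.norm.pow 2).intervalIntegrable _ _
  have i2 : IntervalIntegrable (fun x => ‖g' x‖ ^ 2) volume p q :=
    (hg'.norm.pow 2).intervalIntegrable _ _
  have hle : ∫ x in p..q, (κ ^ 2 * ‖g x‖ ^ 2 + ((-κ ^ 2 - m x ^ 2) * ‖g x‖ ^ 2 +
      m x * (2 * inner ℝ (g x) (g' x)))) ≤ ∫ x in p..q, ‖g' x‖ ^ 2 := by
    refine intervalIntegral.integral_mono_on hpq ((i1.const_mul _).add hint.intervalIntegrable) i2 ?_
    intro x _
    have h := norm_sub_sq_real (g' x) (m x • g x)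
    rw [inner_smul_right, norm_smul, real_inner_comm] at h
    have h0 : 0 ≤ ‖g' x - m x • g x‖ ^ 2 := by positivity
    have h5 : (‖m x‖ * ‖g x‖) ^ 2 = m x ^ 2 * ‖g x‖ ^ 2 := by
      rw [mul_pow, Real.norm_eq_abs, sq_abs]
    nlinarith
  rw [intervalIntegral.integral_add (i1.const_mul _) hint.intervalIntegrable, hI,
    intervalIntegral.integral_const_mul] at hle
  have hq : m q = -κ * Real.tan (κ * (q - p) / 2) := by
    simp only [hm, hc]; congr 2; ring
  have hp : m p = κ * Real.tan (κ * (q - p) / 2) := by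
    simp only [hm, hc]
    rw [show κ * (p - (p + q) / 2) = -(κ * (q - p) / 2) by ring, Real.tan_neg]; ring
  rw [hq, hp] at hle
  linarith

lemma norm_fourier_le_integral (φ : ℝ → ℂ) (x : ℝ) : ‖𝓕 φ x‖ ≤ ∫ v, ‖φ v‖ :=
  VectorFourier.norm_fourierIntegral_le_integral_norm _ _ _ _ _

lemma tendsto_fourier_indicator_Icc {φ : ℝ → ℂ} (hφ : Integrable φ) (x : ℝ) :
    Tendsto (fun n : ℕ => 𝓕 ((Set.Icc (-n : ℝ) n).indicator φ) x) atTop (𝓝 (𝓕 φ x)) := by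
  simp only [Real.fourier_eq]
  refine tendsto_integral_of_dominated_convergence (fun v => ‖φ v‖) ?_ hφ.norm ?_ ?_
  · intro n
    exact ((Real.fourierIntegral_convergent_iff x).2
      (hφ.indicator measurableSet_Icc)).aestronglyMeasurable
  · intro n
    refine Eventually.of_forall fun v => ?_
    rw [Circle.norm_smul]
    exact norm_indicator_le_norm_self _ _
  · refine Eventually.of_forall fun v => ?_
    refine tendsto_const_nhds.congr' ?_
    obtain ⟨N, hN⟩ := exists_nat_ge |v|
    filter_upwards [eventually_ge_atTop N] with n hn
    have : v ∈ Set.Icc (-n : ℝ) n := abs_le.1 (hN.trans (by exact_mod_cast hn))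
    rw [Set.indicator_of_mem this]

/-- Wirtinger's inequality summed over intervals between consecutive zeros of a Fourier transform
`𝓕 φ`, whose weak derivative is square integrable. The truncations of `φ` have smooth Fourier
transforms, which almost vanish at the end points of the intervals. -/
theorem sum_wirtinger {φ : ℝ → ℂ} (hφ : Integrable φ) {K : ℝ} (hK0 : 0 ≤ K)
    (hK : ∫⁻ ξ : ℝ, (‖ξ‖ₑ * ‖φ ξ‖ₑ) ^ 2 ≤ ENNReal.ofReal K) {lam : ℤ → ℝ} (hlam : StrictMono lam)
    (J : Finset ℤ) (hz : ∀ j ∈ J, 𝓕 φ (lam j) = 0 ∧ 𝓕 φ (lam (j + 1)) = 0)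
    (κ : ℤ → ℝ) (hκ : ∀ j ∈ J, 0 ≤ κ j)
    (hκl : ∀ j ∈ J, κ j * (lam (j + 1) - lam j) < Real.pi) :
    ∑ j ∈ J, κ j ^ 2 * ∫ x in lam j..lam (j + 1), ‖𝓕 φ x‖ ^ 2 ≤ (2 * Real.pi) ^ 2 * K := by
  set Φ : ℕ → ℝ → ℂ := fun n => (Set.Icc (-n : ℝ) n).indicator φ with hΦ
  set Ψ : ℕ → ℝ → ℂ := fun n ξ => (-2 * Real.pi * Complex.I * ξ) • Φ n ξ with hΨ
  have hle : ∀ j, lam j ≤ lam (j + 1) := fun j => (hlam (lt_add_one j)).le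
  have hΦi : ∀ n, Integrable (Φ n) := fun n => hφ.indicator measurableSet_Icc
  have hxΦ : ∀ n, Integrable (fun ξ : ℝ => ξ • Φ n ξ) := by
    intro n
    refine ((hφ.norm).const_mul (n : ℝ)).mono'
      (continuous_id.aestronglyMeasurable.smul (hΦi n).aestronglyMeasurable)
      (Eventually.of_forall fun ξ => ?_)
    rw [norm_smul]
    by_cases h : ξ ∈ Set.Icc (-n : ℝ) n
    · simp only [hΦ, Set.indicator_of_mem h]
      exact mul_le_mul_of_nonneg_right (abs_le.2 h) (norm_nonneg _)
    · simp only [hΦ, Set.indicator_of_notMem h, norm_zero, mul_zero]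
      positivity
  have hΨe : ∀ n, Ψ n = fun ξ : ℝ => (-2 * Real.pi * Complex.I : ℂ) • (ξ • Φ n ξ) := by
    intro n; ext ξ; simp [hΨ, mul_assoc]
  have hΨi : ∀ n, Integrable (Ψ n) := fun n => by
    rw [hΨe]; exact (hxΦ n).smul (-2 * Real.pi * Complex.I : ℂ)
  have hΨn : ∀ n ξ, ‖Ψ n ξ‖ₑ ^ 2 ≤ ENNReal.ofReal (2 * Real.pi) ^ 2 * (‖ξ‖ₑ * ‖φ ξ‖ₑ) ^ 2 := by
    intro n ξ
    rw [← mul_pow]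
    gcongr
    simp only [hΨ, hΦ]
    rw [enorm_smul]
    have h1 : ‖(-2 * Real.pi * Complex.I * ξ : ℂ)‖ₑ = ENNReal.ofReal (2 * Real.pi) * ‖ξ‖ₑ := by
      rw [← ofReal_norm, ← ofReal_norm, ← ENNReal.ofReal_mul (by positivity)]
      simp [abs_of_pos Real.pi_pos]
    rw [h1, mul_assoc]
    gcongr
    exact enorm_indicator_le_enorm_self _ _
  have hΨl : ∀ n, ∫⁻ ξ, ‖Ψ n ξ‖ₑ ^ 2 ≤ ENNReal.ofReal ((2 * Real.pi) ^ 2 * K) := by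
    intro n
    calc ∫⁻ ξ, ‖Ψ n ξ‖ₑ ^ 2
        ≤ ∫⁻ ξ : ℝ, ENNReal.ofReal (2 * Real.pi) ^ 2 * (‖ξ‖ₑ * ‖φ ξ‖ₑ) ^ 2 :=
          lintegral_mono (hΨn n)
      _ = ENNReal.ofReal (2 * Real.pi) ^ 2 * ∫⁻ ξ : ℝ, (‖ξ‖ₑ * ‖φ ξ‖ₑ) ^ 2 :=
          lintegral_const_mul' _ _ (by finiteness)
      _ ≤ ENNReal.ofReal (2 * Real.pi) ^ 2 * ENNReal.ofReal K := by gcongr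
      _ = _ := by
          rw [← ENNReal.ofReal_pow (by positivity), ← ENNReal.ofReal_mul (by positivity)]
  have hΨ2 : ∀ n, MemLp (Ψ n) 2 := fun n => memLp_two_of_lintegral_lt_top
    (hΨi n).aestronglyMeasurable ((hΨl n).trans_lt ENNReal.ofReal_lt_top)
  have hΨK : ∀ n, ∫ ξ, ‖𝓕 (Ψ n) ξ‖ ^ 2 ≤ (2 * Real.pi) ^ 2 * K := by
    intro n
    rw [(integral_norm_sq_fourier (hΨi n) (hΨ2 n)).2,
      integral_eq_lintegral_of_nonneg_ae (f := fun x => ‖Ψ n x‖ ^ 2)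
      (Eventually.of_forall fun x => sq_nonneg _) ((hΨi n).aestronglyMeasurable.norm.pow 2)]
    refine ENNReal.toReal_le_of_le_ofReal (by positivity) (le_trans (le_of_eq ?_) (hΨl n))
    refine lintegral_congr fun x => ?_
    rw [ENNReal.ofReal_pow (norm_nonneg _), ofReal_norm]
  have hderiv : ∀ n x, HasDerivAt (𝓕 (Φ n)) (𝓕 (Ψ n) x) x :=
    fun n x => Real.hasDerivAt_fourier (hΦi n) (hxΦ n) x
  set b : ℤ → ℝ := fun j => κ j * Real.tan (κ j * (lam (j + 1) - lam j) / 2) with hb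
  have hfin : ∀ n, ∑ j ∈ J, κ j ^ 2 * ∫ x in lam j..lam (j + 1), ‖𝓕 (Φ n) x‖ ^ 2 ≤
      (2 * Real.pi) ^ 2 * K +
        ∑ j ∈ J, b j * (‖𝓕 (Φ n) (lam j)‖ ^ 2 + ‖𝓕 (Φ n) (lam (j + 1))‖ ^ 2) := by
    intro n
    have hc : Continuous (𝓕 (Ψ n)) := fourier_continuous_of_integrable (hΨi n)
    have hi := (integral_norm_sq_fourier (hΨi n) (hΨ2 n)).1
    calc _ ≤ ∑ j ∈ J, ((∫ x in lam j..lam (j + 1), ‖𝓕 (Ψ n) x‖ ^ 2) +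
          b j * (‖𝓕 (Φ n) (lam j)‖ ^ 2 + ‖𝓕 (Φ n) (lam (j + 1))‖ ^ 2)) :=
          Finset.sum_le_sum fun j hj => wirtinger_interval (hderiv n) hc (hle j) (hκ j hj) (hκl j hj)
      _ ≤ _ := by
        rw [Finset.sum_add_distrib]
        gcongr
        refine le_trans ?_ (hΨK n)
        simp only [intervalIntegral.integral_of_le (hle _)]
        rw [← integral_biUnion_finset J (fun _ _ => measurableSet_Ioc)]
        · exact setIntegral_le_integral hi (Eventually.of_forall fun x => sq_nonneg _)
        · exact hlam.monotone.pairwise_disjoint_on_Ioc_succ.set_pairwise _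
        · exact fun j _ => hi.integrableOn
  have hl1 : Tendsto (fun n => ∑ j ∈ J, κ j ^ 2 * ∫ x in lam j..lam (j + 1), ‖𝓕 (Φ n) x‖ ^ 2) atTop
      (𝓝 (∑ j ∈ J, κ j ^ 2 * ∫ x in lam j..lam (j + 1), ‖𝓕 φ x‖ ^ 2)) := by
    refine tendsto_finsetSum _ fun j _ => Tendsto.const_mul _ ?_
    refine intervalIntegral.tendsto_integral_filter_of_dominated_convergence
      (fun _ => (∫ v, ‖φ v‖) ^ 2) ?_ ?_ (by simp) ?_
    · exact Eventually.of_forall fun n =>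
        ((fourier_continuous_of_integrable (hΦi n)).norm.pow 2).aestronglyMeasurable
    · refine Eventually.of_forall fun n => Eventually.of_forall fun x _ => ?_
      rw [norm_pow, norm_norm]
      gcongr
      refine (norm_fourier_le_integral _ _).trans
        (integral_mono (hΦi n).norm hφ.norm fun v => norm_indicator_le_norm_self _ _)
    · exact Eventually.of_forall fun x _ => ((tendsto_fourier_indicator_Icc hφ x).norm.pow 2)
  have hl2 : Tendsto (fun n => (2 * Real.pi) ^ 2 * K +
        ∑ j ∈ J, b j * (‖𝓕 (Φ n) (lam j)‖ ^ 2 + ‖𝓕 (Φ n) (lam (j + 1))‖ ^ 2)) atTop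
      (𝓝 ((2 * Real.pi) ^ 2 * K + ∑ j ∈ J, b j * (‖𝓕 φ (lam j)‖ ^ 2 + ‖𝓕 φ (lam (j + 1))‖ ^ 2))) := by
    refine Tendsto.const_add _ (tendsto_finsetSum _ fun j _ => Tendsto.const_mul _ ?_)
    exact ((tendsto_fourier_indicator_Icc hφ _).norm.pow 2).add
      ((tendsto_fourier_indicator_Icc hφ _).norm.pow 2)
  have := le_of_tendsto_of_tendsto' hl1 hl2 hfin
  have hb0 : ∑ j ∈ J, b j * (‖𝓕 φ (lam j)‖ ^ 2 + ‖𝓕 φ (lam (j + 1))‖ ^ 2) = 0 :=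
    Finset.sum_eq_zero fun j hj => by simp [hz j hj]
  rwa [hb0, add_zero] at this

lemma IsOrderedSeq.exists_mem_Ioc {lam : ℤ → ℝ} (h : IsOrderedSeq lam) (x : ℝ) :
    ∃ j, x ∈ Set.Ioc (lam j) (lam (j + 1)) := by
  obtain ⟨b, hb⟩ := (h.tendsto_atTop.eventually_ge_atTop x).exists
  obtain ⟨c, hc⟩ := (h.tendsto_atBot.eventually_lt_atBot x).exists
  obtain ⟨j, hj, hj'⟩ := Int.exists_greatest_of_bdd (P := fun j => lam j < x)
    ⟨b, fun z hz => (h.strictMono.lt_iff_lt.1 (hz.trans_le hb)).le⟩ ⟨c, hc⟩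
  refine ⟨j, hj, ?_⟩
  by_contra hlt
  have := hj' (j + 1) (not_le.1 hlt)
  omega

/-- If the gaps of `lam` near `x` are smaller than `a / (2 W(|x|))`, then a Fourier transform `𝓕 φ`
vanishing on `lam` has local frequency at least `W(|x|) / a` away from the origin. -/
theorem weighted_wirtinger {lam : ℤ → ℝ} (hlam : IsOrderedSeq lam) {W : ℝ≥0 → ℝ} (hWm : Monotone W)
    (hW0 : ∀ x, 0 ≤ W x) {a b : ℝ} (ha : 0 < a) (hba : 2 * b < a)
    (hev : ∀ᶠ j : ℤ in cofinite, W (max ‖lam j‖₊ ‖lam (j + 1)‖₊) * (lam (j + 1) - lam j) ≤ b) :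
    ∃ R : ℝ, 0 < R ∧ ∀ φ : ℝ → ℂ, Integrable φ → (∀ j, 𝓕 φ (lam j) = 0) →
      ∫⁻ x in {x : ℝ | R ≤ |x|}, (‖W ‖x‖₊‖ₑ * ‖𝓕 φ x‖ₑ) ^ 2 ≤
        ENNReal.ofReal (a ^ 2) * ∫⁻ ξ : ℝ, (‖ξ‖ₑ * ‖φ ξ‖ₑ) ^ 2 := by
  set good : Set ℤ := {j | W (max ‖lam j‖₊ ‖lam (j + 1)‖₊) * (lam (j + 1) - lam j) ≤ b} with hgood
  have hbad : goodᶜ.Finite := hev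
  -- beyond `R` only intervals satisfying the gap condition occur
  set R : ℝ := 1 + ∑ j ∈ hbad.toFinset, (|lam j| + |lam (j + 1)|) with hR
  have hle : ∀ j, lam j ≤ lam (j + 1) := fun j => (hlam.strictMono (lt_add_one j)).le
  have habs : ∀ j x, x ∈ Set.Ioc (lam j) (lam (j + 1)) → |x| ≤ max |lam j| |lam (j + 1)| :=
    fun j x hx => abs_le_max_abs_abs hx.1.le hx.2
  have hgoodR : ∀ x, R ≤ |x| → ∀ j, x ∈ Set.Ioc (lam j) (lam (j + 1)) → j ∈ good := by
    intro x hx j hj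
    by_contra hjg
    have h1 : |lam j| + |lam (j + 1)| ≤ ∑ j ∈ hbad.toFinset, (|lam j| + |lam (j + 1)|) :=
      Finset.single_le_sum (f := fun j => |lam j| + |lam (j + 1)|) (fun i _ => by positivity)
        (hbad.mem_toFinset.2 hjg)
    have h2 := habs j x hj
    have h3 : max |lam j| |lam (j + 1)| ≤ |lam j| + |lam (j + 1)| :=
      max_le (by linarith [abs_nonneg (lam (j + 1))]) (by linarith [abs_nonneg (lam j)])
    linarith
  refine ⟨R, by positivity, fun φ hφ hz => ?_⟩
  set g := 𝓕 φ with hg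
  have hgc : Continuous g := fourier_continuous_of_integrable hφ
  rcases eq_or_ne (∫⁻ ξ : ℝ, (‖ξ‖ₑ * ‖φ ξ‖ₑ) ^ 2) ⊤ with htop | htop
  · rw [htop, ENNReal.mul_top (by simp [ha.ne'])]
    exact le_top
  set K := (∫⁻ ξ : ℝ, (‖ξ‖ₑ * ‖φ ξ‖ₑ) ^ 2).toReal with hK
  have hKe : ∫⁻ ξ : ℝ, (‖ξ‖ₑ * ‖φ ξ‖ₑ) ^ 2 = ENNReal.ofReal K := (ENNReal.ofReal_toReal htop).symm
  set w : ℤ → ℝ := fun j => W (max ‖lam j‖₊ ‖lam (j + 1)‖₊) with hw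
  have hsub : {x : ℝ | R ≤ |x|} ⊆ ⋃ j : good, Set.Ioc (lam j) (lam (j + 1)) := by
    intro x hx
    obtain ⟨j, hj⟩ := hlam.exists_mem_Ioc x
    exact Set.mem_iUnion.2 ⟨⟨j, hgoodR x hx j hj⟩, hj⟩
  have hpiece : ∀ j : ℤ, ∫⁻ x in Set.Ioc (lam j) (lam (j + 1)), (‖W ‖x‖₊‖ₑ * ‖g x‖ₑ) ^ 2 ≤
      ENNReal.ofReal (w j ^ 2 * ∫ x in lam j..lam (j + 1), ‖g x‖ ^ 2) := by
    intro j
    have hi : IntegrableOn (fun x => ‖g x‖ ^ 2) (Set.Ioc (lam j) (lam (j + 1))) :=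
      ((hgc.norm.pow 2).integrableOn_Icc).mono_set Set.Ioc_subset_Icc_self
    rw [intervalIntegral.integral_of_le (hle j), ← integral_const_mul,
      ofReal_integral_eq_lintegral_ofReal (hi.const_mul _)
        (Eventually.of_forall fun x => by positivity)]
    refine setLIntegral_mono' measurableSet_Ioc fun x hx => ?_
    rw [← mul_pow, ENNReal.ofReal_pow (mul_nonneg (hW0 _) (norm_nonneg _)),
      ENNReal.ofReal_mul (hW0 _), ofReal_norm, Real.enorm_of_nonneg (hW0 _)]
    gcongr
    exact hWm (NNReal.coe_le_coe.1 (by simpa using habs j x hx))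
  rw [hKe, ← ENNReal.ofReal_mul (by positivity)]
  calc ∫⁻ x in {x : ℝ | R ≤ |x|}, (‖W ‖x‖₊‖ₑ * ‖g x‖ₑ) ^ 2
      ≤ ∫⁻ x in ⋃ j : good, Set.Ioc (lam j) (lam (j + 1)), (‖W ‖x‖₊‖ₑ * ‖g x‖ₑ) ^ 2 :=
        lintegral_mono_set hsub
    _ ≤ ∑' j : good, ∫⁻ x in Set.Ioc (lam j) (lam (j + 1)), (‖W ‖x‖₊‖ₑ * ‖g x‖ₑ) ^ 2 :=
        lintegral_iUnion_le _ _
    _ ≤ ENNReal.ofReal (a ^ 2 * K) := by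
        rw [ENNReal.tsum_eq_iSup_sum]
        refine iSup_le fun J => ?_
        refine (Finset.sum_le_sum (s := J) fun (j : good) _ => hpiece (j : ℤ)).trans ?_
        rw [← ENNReal.ofReal_sum_of_nonneg]
        swap
        · intro j _
          exact mul_nonneg (sq_nonneg _)
            (intervalIntegral.integral_nonneg (hle _) fun x _ => sq_nonneg _)
        refine ENNReal.ofReal_le_ofReal ?_
        have hgap : ∀ j ∈ J.map (Function.Embedding.subtype _),
            2 * Real.pi / a * w j * (lam (j + 1) - lam j) < Real.pi := by
          intro j hj
          obtain ⟨i, _, rfl⟩ := Finset.mem_map.1 hj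
          have h1 : w i * (lam (i + 1) - lam i) ≤ b := i.2
          calc 2 * Real.pi / a * w i * (lam (i + 1) - lam i)
              = Real.pi * (2 * (w i * (lam (i + 1) - lam i)) / a) := by ring
            _ ≤ Real.pi * (2 * b / a) := by gcongr
            _ < Real.pi * 1 := by
              gcongr
              rwa [div_lt_one ha]
            _ = Real.pi := mul_one _
        -- on each interval the frequency may be chosen proportional to the largest weight there
        have := sum_wirtinger hφ ENNReal.toReal_nonneg hKe.le hlam.strictMono
          (J.map (Function.Embedding.subtype _)) (fun j _ => ⟨hz j, hz (j + 1)⟩)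
          (fun j => 2 * Real.pi / a * w j)
          (fun j _ => mul_nonneg (by positivity) (hW0 _)) hgap
        rw [Finset.sum_map] at this
        simp only [Function.Embedding.subtype_apply, mul_pow (2 * Real.pi / a),
          mul_assoc ((2 * Real.pi / a) ^ 2)] at this
        rw [← Finset.mul_sum, ← hK] at this
        have hpi : (0 : ℝ) < (2 * Real.pi / a) ^ 2 := by positivity
        refine le_of_mul_le_mul_left (this.trans (le_of_eq ?_)) hpi
        field_simp

/-! ### The Fourier symmetric Sobolev space -/

lemma lintegral_weighted_lt_top {f : ℝ → ℂ}
    (h : Integrable (fun x : ℝ => (1 + x ^ 2) * ‖f x‖ ^ 2)) :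
    ∫⁻ x, ‖f x‖ₑ ^ 2 < ⊤ ∧ ∫⁻ x : ℝ, (‖x‖ₑ * ‖f x‖ₑ) ^ 2 < ⊤ := by
  have h1 : ∫⁻ x : ℝ, ‖(1 + x ^ 2) * ‖f x‖ ^ 2‖ₑ < ⊤ := h.2
  constructor
  · refine lt_of_le_of_lt (lintegral_mono fun x => ?_) h1
    rw [← ofReal_norm, ← ENNReal.ofReal_pow (norm_nonneg _), Real.enorm_of_nonneg (by positivity)]
    exact ENNReal.ofReal_le_ofReal (by nlinarith [mul_nonneg (sq_nonneg x) (sq_nonneg ‖f x‖)])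
  · refine lt_of_le_of_lt (lintegral_mono fun x => ?_) h1
    rw [← ofReal_norm, ← ofReal_norm, ← ENNReal.ofReal_mul (norm_nonneg _),
      ← ENNReal.ofReal_pow (by positivity), Real.enorm_of_nonneg (by positivity)]
    refine ENNReal.ofReal_le_ofReal ?_
    rw [mul_pow, Real.norm_eq_abs, sq_abs]
    nlinarith [sq_nonneg ‖f x‖]

section fourierSobolev

variable {f : ℝ → ℂ} (hf : f ∈ fourierSobolev)
include hf

lemma sobolev_continuous : Continuous f := hf.1

lemma sobolev_integrable : Integrable f := integrable_of_weighted_sq hf.1 hf.2.1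

lemma sobolev_continuous_fourier : Continuous (𝓕 f) :=
  fourier_continuous_of_integrable (sobolev_integrable hf)

lemma sobolev_integrable_fourier : Integrable (𝓕 f) :=
  integrable_of_weighted_sq (sobolev_continuous_fourier hf) hf.2.2

lemma sobolev_norm_lt_top : ∫⁻ x, ‖f x‖ₑ ^ 2 < ⊤ := (lintegral_weighted_lt_top hf.2.1).1

lemma sobolev_memLp : MemLp f 2 :=
  memLp_two_of_lintegral_lt_top hf.1.aestronglyMeasurable (sobolev_norm_lt_top hf)

lemma sobolev_plancherel : ∫⁻ ξ, ‖𝓕 f ξ‖ₑ ^ 2 = ∫⁻ x, ‖f x‖ₑ ^ 2 :=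
  lintegral_enorm_sq_fourier (sobolev_integrable hf) (sobolev_memLp hf)

/-- Fourier inversion: `f` is the Fourier transform of the reflection of `𝓕 f`. -/
lemma sobolev_inversion : 𝓕 (fun ξ => 𝓕 f (-ξ)) = f := by
  rw [← (sobolev_continuous hf).fourierInv_fourier_eq (sobolev_integrable hf)
    (sobolev_integrable_fourier hf)]
  conv_rhs => rw [Real.fourierInv_eq_fourier_comp_neg]
  rw [(sobolev_continuous hf).fourierInv_fourier_eq (sobolev_integrable hf)
    (sobolev_integrable_fourier hf)]

omit hf in
lemma lintegral_freq_reflect (g : ℝ → ℂ) :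
    ∫⁻ ξ : ℝ, (‖ξ‖ₑ * ‖g (-ξ)‖ₑ) ^ 2 = ∫⁻ ξ : ℝ, (‖ξ‖ₑ * ‖g ξ‖ₑ) ^ 2 := by
  rw [← lintegral_neg_eq_self (μ := volume) (f := fun ξ : ℝ => (‖ξ‖ₑ * ‖g ξ‖ₑ) ^ 2)]
  simp

end fourierSobolev

/-- On a space of functions whose position and frequency moments are controlled by the norm,
sampling on a fine finite grid is injective. -/
theorem finiteDimensional_of_moments {V : Submodule ℂ (ℝ → ℂ)} (hV : V ≤ fourierSobolev) {C : ℝ}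
    (hC : 0 < C)
    (hX : ∀ f ∈ V, ∫⁻ x : ℝ, (‖x‖ₑ * ‖f x‖ₑ) ^ 2 ≤ ENNReal.ofReal C * ∫⁻ x, ‖f x‖ₑ ^ 2)
    (hD : ∀ f ∈ V, ∫⁻ ξ : ℝ, (‖ξ‖ₑ * ‖𝓕 f ξ‖ₑ) ^ 2 ≤ ENNReal.ofReal C * ∫⁻ x, ‖f x‖ₑ ^ 2) :
    FiniteDimensional ℂ V := by
  -- The grid `h (i - n)`, `i ≤ 2 n`, is fine enough for Wirtinger's inequality to leave at most a
  -- quarter of the norm on `[-n h, n h]`, and wide enough to leave at most a quarter outside.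
  obtain ⟨h, hh, hhC⟩ : ∃ h : ℝ, 0 < h ∧ 16 * h ^ 2 * C ≤ 1 / 4 := by
    refine ⟨1 / (8 * (1 + C)), by positivity, ?_⟩
    rw [div_pow, one_pow]
    field_simp
    nlinarith [sq_nonneg C]
  obtain ⟨n, hn⟩ := exists_nat_gt ((1 + 4 * C) / h)
  have hnh : 1 + 4 * C < n * h := by rwa [div_lt_iff₀ hh] at hn
  let ev : V →ₗ[ℂ] (Fin (2 * n + 1) → ℂ) :=
    LinearMap.pi fun i => (LinearMap.proj (h * ((i : ℕ) - n) : ℝ)).comp V.subtype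
  refine FiniteDimensional.of_injective ev ?_
  rw [injective_iff_map_eq_zero]
  rintro ⟨f, hfV⟩ hf0
  have hf := hV hfV
  have hz : ∀ i : ℕ, i ≤ 2 * n → f (h * (i - n)) = 0 := by
    intro i hi
    have := congrFun hf0 ⟨i, by omega⟩
    simpa [ev] using this
  set E := ∫⁻ x, ‖f x‖ₑ ^ 2 with hE
  have hEt : E ≠ ⊤ := (sobolev_norm_lt_top hf).ne
  have hEr : E = ENNReal.ofReal E.toReal := (ENNReal.ofReal_toReal hEt).symm
  have hmono : StrictMono fun j : ℤ => h * ((j : ℝ) - n) := fun i j hij => by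
    have : (i : ℝ) - n < j - n := by simpa using hij
    exact mul_lt_mul_of_pos_left this hh
  have hinner : ∫⁻ x in Set.Ioc (-(n * h)) (n * h), ‖f x‖ₑ ^ 2 ≤ ENNReal.ofReal (1 / 4) * E := by
    have hw := sum_wirtinger (φ := fun ξ => 𝓕 f (-ξ)) (K := C * E.toReal)
      (sobolev_integrable_fourier hf).comp_neg (by positivity) (by
        rw [lintegral_freq_reflect, ENNReal.ofReal_mul hC.le, ← hEr]
        exact hD f hfV) hmono ((Finset.range (2 * n)).map Nat.castEmbedding) (by
        intro j hj
        rw [sobolev_inversion hf]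
        obtain ⟨i, hi, rfl⟩ := Finset.mem_map.1 hj
        have := Finset.mem_range.1 hi
        exact ⟨by simpa using hz i this.le, by simpa using hz (i + 1) this⟩)
      (fun _ => Real.pi / (2 * h)) (fun j _ => by positivity) (by
        intro j _
        push_cast
        rw [show Real.pi / (2 * h) * (h * (j + 1 - n) - h * (j - n)) = Real.pi / 2 by
          field_simp; ring]
        linarith [Real.pi_pos])
    have hadj := intervalIntegral.sum_integral_adjacent_intervals (μ := volume)
      (f := fun x => ‖f x‖ ^ 2) (a := fun k : ℕ => h * ((k : ℝ) - n)) (n := 2 * n)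
      fun k _ => (hf.1.norm.pow 2).intervalIntegrable _ _
    rw [sobolev_inversion hf, ← Finset.mul_sum, Finset.sum_map] at hw
    simp only [Nat.castEmbedding_apply, Int.cast_natCast, Int.cast_add, Int.cast_one] at hw
    push_cast at hadj
    rw [hadj, show h * (0 - n) = -(n * h) by ring, show h * (2 * n - n) = n * h by ring] at hw
    have hw2 : ∫ x in (-(n * h))..(n * h), ‖f x‖ ^ 2 ≤ 1 / 4 * E.toReal := by
      have hpi : (0 : ℝ) < (Real.pi / (2 * h)) ^ 2 := by positivity
      refine le_of_mul_le_mul_left (hw.trans ?_) hpi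
      have : 16 * h ^ 2 * C * E.toReal ≤ 1 / 4 * E.toReal := by gcongr
      calc (2 * Real.pi) ^ 2 * (C * E.toReal)
          = (Real.pi / (2 * h)) ^ 2 * (16 * h ^ 2 * C * E.toReal) := by field_simp; ring
        _ ≤ _ := by gcongr
    rw [hEr, ← ENNReal.ofReal_mul (by norm_num)]
    refine le_trans (le_of_eq ?_) (ENNReal.ofReal_le_ofReal hw2)
    have hi : IntegrableOn (fun x => ‖f x‖ ^ 2) (Set.Ioc (-(n * h)) (n * h)) :=
      ((hf.1.norm.pow 2).integrableOn_Icc).mono_set Set.Ioc_subset_Icc_self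
    rw [intervalIntegral.integral_of_le (by nlinarith),
      ofReal_integral_eq_lintegral_ofReal hi (Eventually.of_forall fun x => by positivity)]
    refine lintegral_congr fun x => ?_
    rw [ENNReal.ofReal_pow (norm_nonneg _), ofReal_norm]
  have houter : ∫⁻ x in (Set.Ioc (-(n * h)) (n * h))ᶜ, ‖f x‖ₑ ^ 2 ≤ ENNReal.ofReal (1 / 4) * E := by
    have h1 : ∀ x ∈ (Set.Ioc (-(n * h)) (n * h))ᶜ,
        ENNReal.ofReal (4 * C) * ‖f x‖ₑ ^ 2 ≤ (‖x‖ₑ * ‖f x‖ₑ) ^ 2 := by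
      intro x hx
      rw [mul_pow]
      gcongr
      rw [← ofReal_norm, ← ENNReal.ofReal_pow (norm_nonneg _)]
      refine ENNReal.ofReal_le_ofReal ?_
      have : n * h ≤ |x| := by
        by_contra hlt
        have := abs_lt.1 (not_le.1 hlt)
        exact hx ⟨this.1, this.2.le⟩
      rw [Real.norm_eq_abs]
      nlinarith
    have h2 : ENNReal.ofReal (4 * C) * ∫⁻ x in (Set.Ioc (-(n * h)) (n * h))ᶜ, ‖f x‖ₑ ^ 2 ≤
        ENNReal.ofReal C * E := by
      rw [← lintegral_const_mul' _ _ (by finiteness)]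
      refine (setLIntegral_mono' measurableSet_Ioc.compl h1).trans ?_
      exact (setLIntegral_le_lintegral _ _).trans (hX f hfV)
    have h3 : ENNReal.ofReal (4 * C) ≠ 0 := by simp [hC]
    rw [← ENNReal.mul_le_mul_iff_right h3 ENNReal.ofReal_ne_top]
    refine h2.trans (le_of_eq ?_)
    rw [← mul_assoc, ← ENNReal.ofReal_mul (by positivity)]
    congr 2
    ring
  have hsum : E ≤ ENNReal.ofReal (1 / 2) * E := by
    calc E = _ := (lintegral_add_compl _ measurableSet_Ioc).symm
      _ ≤ ENNReal.ofReal (1 / 4) * E + ENNReal.ofReal (1 / 4) * E := add_le_add hinner houter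
      _ = ENNReal.ofReal (1 / 2) * E := by
        rw [← add_mul, ← ENNReal.ofReal_add (by norm_num) (by norm_num)]
        norm_num
  have hE0 : E = 0 := by
    rw [hEr, ← ENNReal.ofReal_mul (by norm_num)] at hsum
    have := (ENNReal.ofReal_le_ofReal_iff (by positivity)).1 hsum
    have h0 : E.toReal = 0 := le_antisymm (by linarith) ENNReal.toReal_nonneg
    rw [hEr, h0, ENNReal.ofReal_zero]
  rw [hE, lintegral_eq_zero_iff (hf.1.enorm.measurable.pow_const 2)] at hE0
  have hfae : f =ᵐ[volume] fun _ => 0 := by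
    filter_upwards [hE0] with x hx
    simpa using hx
  have : f = fun _ => 0 := (hf.1.ae_eq_iff_eq volume continuous_const).1 hfae
  exact Subtype.ext this

/-! ### Convolutions in frequency -/

lemma sq_lintegral_mul_le {a b : ℝ → ℝ≥0∞} (ha : Measurable a) (hb : Measurable b) :
    (∫⁻ x, a x * b x) ^ 2 ≤ (∫⁻ x, a x ^ 2) * ∫⁻ x, b x ^ 2 := by
  have h := ENNReal.lintegral_mul_le_Lp_mul_Lq volume Real.HolderConjugate.two_two
    ha.aemeasurable hb.aemeasurable
  simp only [ENNReal.rpow_two, Pi.mul_apply] at h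
  calc _ ≤ ((∫⁻ x, a x ^ 2) ^ (1 / 2 : ℝ) * (∫⁻ x, b x ^ 2) ^ (1 / 2 : ℝ)) ^ 2 := by gcongr
    _ = _ := by
      rw [mul_pow, ← ENNReal.rpow_natCast, ← ENNReal.rpow_natCast, ← ENNReal.rpow_mul,
        ← ENNReal.rpow_mul]
      norm_num

/-- Young's inequality for the convolution of an `L¹` function with an `L²` function. -/
theorem lintegral_sq_conv_le {K F : ℝ → ℝ≥0∞} (hK : Measurable K) (hF : Measurable F) :
    ∫⁻ ξ, (∫⁻ η, K (ξ - η) * F η) ^ 2 ≤ (∫⁻ t, K t) ^ 2 * ∫⁻ η, F η ^ 2 := by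
  have hs : ∀ x : ℝ≥0∞, (x ^ (1 / 2 : ℝ)) ^ 2 = x := by
    intro x
    rw [← ENNReal.rpow_natCast, ← ENNReal.rpow_mul]
    norm_num
  have hpt : ∀ ξ, (∫⁻ η, K (ξ - η) * F η) ^ 2 ≤ (∫⁻ t, K t) * ∫⁻ η, K (ξ - η) * F η ^ 2 := by
    intro ξ
    have hKξ : Measurable fun η => K (ξ - η) := hK.comp (measurable_const.sub measurable_id)
    have h := sq_lintegral_mul_le (hKξ.pow_const (1 / 2 : ℝ))
      ((hKξ.pow_const (1 / 2 : ℝ)).mul hF)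
    simp only [Pi.mul_apply, mul_pow, hs, ← mul_assoc, ← sq] at h
    rwa [lintegral_sub_left_eq_self K ξ] at h
  calc ∫⁻ ξ, (∫⁻ η, K (ξ - η) * F η) ^ 2
      ≤ ∫⁻ ξ, (∫⁻ t, K t) * ∫⁻ η, K (ξ - η) * F η ^ 2 := lintegral_mono hpt
    _ = (∫⁻ t, K t) * ∫⁻ ξ, ∫⁻ η, K (ξ - η) * F η ^ 2 := by
        refine lintegral_const_mul _ (Measurable.lintegral_prod_right' (f := fun p : ℝ × ℝ =>
          K (p.1 - p.2) * F p.2 ^ 2) ?_)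
        fun_prop
    _ = (∫⁻ t, K t) * ∫⁻ η, ∫⁻ ξ, K (ξ - η) * F η ^ 2 := by
        rw [lintegral_lintegral_swap]
        exact Measurable.aemeasurable (by unfold Function.uncurry; fun_prop)
    _ = (∫⁻ t, K t) * ∫⁻ η, (∫⁻ t, K t) * F η ^ 2 := by
        congr 1
        refine lintegral_congr fun η => ?_
        rw [lintegral_mul_const (r := F η ^ 2) (f := fun ξ => K (ξ - η)) (by fun_prop),
          lintegral_sub_right_eq_self K η]
    _ = _ := by rw [lintegral_const_mul _ (hF.pow_const 2)]; ring

/-- The Fourier transform of a product `u · 𝓕⁻¹ h` is the convolution of `𝓕 u` with `h`. -/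
theorem fourier_mul_fourier_neg_eq_conv {u h : ℝ → ℂ} (hu : Integrable u) (hh : Integrable h)
    (ξ : ℝ) :
    𝓕 (fun x => u x * 𝓕 (fun η => h (-η)) x) ξ = ∫ η, 𝓕 u (ξ - η) * h η := by
  set G : ℝ → ℂ := fun x => Real.fourierChar (-(x * ξ)) • u x with hG
  have hGi : Integrable G := by
    have := (Real.fourierIntegral_convergent_iff (μ := volume) (f := u) ξ).2 hu
    refine this.congr (Eventually.of_forall fun x => ?_)
    simp [hG, mul_comm]
  have hGf : ∀ y, 𝓕 G y = 𝓕 u (ξ + y) := by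
    intro y
    rw [Real.fourier_real_eq, Real.fourier_real_eq]
    refine integral_congr_ae (Eventually.of_forall fun x => ?_)
    simp only [hG]
    rw [smul_smul, ← AddChar.map_add_eq_mul]
    congr 2
    ring
  have h1 := VectorFourier.integral_fourierIntegral_smul_eq_flip (L := innerₗ ℝ) (μ := volume)
        (ν := volume) (f := fun η => h (-η)) (g := G) Real.continuous_fourierChar
        (by exact continuous_inner) hh.comp_neg hGi
  rw [flip_innerₗ] at h1
  change ∫ x, 𝓕 (fun η => h (-η)) x • G x = ∫ x, h (-x) • 𝓕 G x at h1
  rw [Real.fourier_real_eq]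
  calc ∫ x, Real.fourierChar (-(x * ξ)) • (u x * 𝓕 (fun η => h (-η)) x)
        = ∫ x, 𝓕 (fun η => h (-η)) x • G x := by
        refine integral_congr_ae (Eventually.of_forall fun x => ?_)
        simp only [hG, Circle.smul_def, smul_eq_mul]
        ring
    _ = ∫ x, h (-x) • 𝓕 G x := h1
    _ = ∫ x, h x • 𝓕 G (-x) := by
        rw [← integral_neg_eq_self]
        simp
    _ = _ := by
        simp only [hGf, smul_eq_mul]
        refine integral_congr_ae (Eventually.of_forall fun x => ?_)
        simp only [← sub_eq_add_neg, mul_comm]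

lemma fourier_mul_eq_conv {u f : ℝ → ℂ} (hu : Integrable u) (hf : f ∈ fourierSobolev) (ξ : ℝ) :
    𝓕 (fun x => u x * f x) ξ = ∫ η, 𝓕 u (ξ - η) * 𝓕 f η := by
  have h := fourier_mul_fourier_neg_eq_conv hu (sobolev_integrable_fourier hf) ξ
  rwa [sobolev_inversion hf] at h

/-- The pointwise bound for `(u f)^` by the convolution of the absolute values. -/
lemma enorm_fourier_mul_le {u f : ℝ → ℂ} (hu : Integrable u) (hf : f ∈ fourierSobolev) (ξ : ℝ) :
    ‖𝓕 (fun x => u x * f x) ξ‖ₑ ≤ ∫⁻ η, ‖𝓕 u (ξ - η)‖ₑ * ‖𝓕 f η‖ₑ := by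
  rw [fourier_mul_eq_conv hu hf]
  refine (enorm_integral_le_lintegral_enorm _).trans (le_of_eq ?_)
  simp only [enorm_mul]

/-- The `i`-th absolute moment `∫ |t|ⁱ |𝓕 u(t)| dt` of the Fourier transform of `u`, possibly
infinite. -/
noncomputable def fourierMoment (u : ℝ → ℂ) (i : ℕ) : ℝ≥0∞ := ∫⁻ t : ℝ, ‖t‖ₑ ^ i * ‖𝓕 u t‖ₑ

lemma fourier_comp_div (u : ℝ → ℂ) {L : ℝ} (hL : 0 < L) (t : ℝ) :
    𝓕 (fun x => u (x / L)) t = L * 𝓕 u (L * t) := by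
  rw [Real.fourier_real_eq, Real.fourier_real_eq]
  have := Measure.integral_comp_div (fun y => Real.fourierChar (-(y * (L * t))) • u y) L
  rw [abs_of_pos hL, Complex.real_smul] at this
  rw [← this]
  refine integral_congr_ae (Eventually.of_forall fun x => ?_)
  have hx : x / L * (L * t) = x * t := by field_simp
  simp only [hx]

lemma fourierMoment_comp_div {u : ℝ → ℂ} (hu : Integrable u) {L : ℝ} (hL : 0 < L) (i : ℕ) :
    fourierMoment (fun x => u (x / L)) i = ENNReal.ofReal (L ^ i)⁻¹ * fourierMoment u i := by
  unfold fourierMoment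
  have hc : Continuous (𝓕 u) := fourier_continuous_of_integrable hu
  have hscale : ∀ F : ℝ → ℝ≥0∞, Measurable F →
      ∫⁻ t, F t = ∫⁻ t : ℝ, ENNReal.ofReal L * F (L * t) := by
    intro F hF
    conv_lhs => rw [← Real.smul_map_volume_mul_left hL.ne']
    rw [lintegral_smul_measure, lintegral_map hF (measurable_const_mul L), abs_of_pos hL,
      lintegral_const_mul' _ _ ENNReal.ofReal_ne_top, smul_eq_mul]
  rw [← lintegral_const_mul' _ _ ENNReal.ofReal_ne_top,
    hscale (fun t => ENNReal.ofReal (L ^ i)⁻¹ * (‖t‖ₑ ^ i * ‖𝓕 u t‖ₑ))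
      (by have := hc.enorm.measurable; fun_prop)]
  refine lintegral_congr fun t => ?_
  rw [fourier_comp_div u hL, enorm_mul, enorm_mul]
  have h1 : ‖(L : ℂ)‖ₑ = ENNReal.ofReal L := by
    rw [← ofReal_norm]; simp [abs_of_pos hL]
  have h2 : ‖L‖ₑ = ENNReal.ofReal L := Real.enorm_of_nonneg hL.le
  have h3 : ENNReal.ofReal (L ^ i)⁻¹ * ENNReal.ofReal L ^ i = 1 := by
    rw [← ENNReal.ofReal_pow hL.le, ← ENNReal.ofReal_mul (by positivity),
      inv_mul_cancel₀ (by positivity), ENNReal.ofReal_one]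
  rw [h1, h2]
  calc ‖t‖ₑ ^ i * (ENNReal.ofReal L * ‖𝓕 u (L * t)‖ₑ)
      = (ENNReal.ofReal (L ^ i)⁻¹ * ENNReal.ofReal L ^ i) *
          (‖t‖ₑ ^ i * (ENNReal.ofReal L * ‖𝓕 u (L * t)‖ₑ)) := by rw [h3, one_mul]
    _ = _ := by simp only [mul_pow]; ring

lemma fourierMoment_lt_top {u : ℝ → ℂ} (hu : ContDiff ℝ (⊤ : ℕ∞) u) (huc : HasCompactSupport u)
    (i : ℕ) : fourierMoment u i < ⊤ := by
  have h := ((𝓕 (huc.toSchwartzMap hu)).integrable_pow_mul volume i).2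
  refine lt_of_le_of_lt (le_of_eq ?_) h
  refine lintegral_congr fun t => ?_
  rw [SchwartzMap.fourier_coe, enorm_mul, enorm_pow, enorm_norm, enorm_norm]
  rfl

lemma ennreal_add_sq_le (a b : ℝ≥0∞) {δ : ℝ} (hδ : 0 < δ) :
    (a + b) ^ 2 ≤ ENNReal.ofReal (1 + δ) * a ^ 2 + ENNReal.ofReal (1 + δ⁻¹) * b ^ 2 := by
  have h1 : (0 : ℝ) < 1 + δ := by positivity
  have h2 : (0 : ℝ) < 1 + δ⁻¹ := by positivity
  rcases eq_or_ne a ⊤ with rfl | ha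
  · simp [ENNReal.mul_top, h1]
  rcases eq_or_ne b ⊤ with rfl | hb
  · simp [ENNReal.mul_top, h2]
  rw [← ENNReal.ofReal_toReal ha, ← ENNReal.ofReal_toReal hb]
  have hx : 0 ≤ a.toReal := ENNReal.toReal_nonneg
  have hy : 0 ≤ b.toReal := ENNReal.toReal_nonneg
  rw [← ENNReal.ofReal_add hx hy, ← ENNReal.ofReal_pow (by positivity),
    ← ENNReal.ofReal_pow hx, ← ENNReal.ofReal_pow hy, ← ENNReal.ofReal_mul h1.le,
    ← ENNReal.ofReal_mul h2.le, ← ENNReal.ofReal_add (by positivity) (by positivity)]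
  refine ENNReal.ofReal_le_ofReal ?_
  have h3 : 0 ≤ δ⁻¹ * (δ * a.toReal - b.toReal) ^ 2 := by positivity
  have h4 : δ⁻¹ * (δ * a.toReal - b.toReal) ^ 2 =
      δ * a.toReal ^ 2 - 2 * a.toReal * b.toReal + δ⁻¹ * b.toReal ^ 2 := by
    field_simp
    ring
  nlinarith

lemma ennreal_add_sq_le_two (a b : ℝ≥0∞) : (a + b) ^ 2 ≤ 2 * a ^ 2 + 2 * b ^ 2 := by
  have h := ennreal_add_sq_le a b one_pos
  norm_num at h
  exact h

lemma measurable_conv {K F : ℝ → ℝ≥0∞} (hK : Measurable K) (hF : Measurable F) :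
    Measurable fun ξ => ∫⁻ η, K (ξ - η) * F η :=
  Measurable.lintegral_prod_right' (f := fun p : ℝ × ℝ => K (p.1 - p.2) * F p.2) (by fun_prop)

lemma lintegral_sq_le_of_le_conv_add {G K₁ F₁ K₂ F₂ : ℝ → ℝ≥0∞} (hK₁ : Measurable K₁)
    (hF₁ : Measurable F₁) (hK₂ : Measurable K₂) (hF₂ : Measurable F₂)
    (hG : ∀ ξ, G ξ ≤ (∫⁻ η, K₁ (ξ - η) * F₁ η) + ∫⁻ η, K₂ (ξ - η) * F₂ η) :
    ∫⁻ ξ, G ξ ^ 2 ≤ 2 * ((∫⁻ t, K₁ t) ^ 2 * ∫⁻ η, F₁ η ^ 2) +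
      2 * ((∫⁻ t, K₂ t) ^ 2 * ∫⁻ η, F₂ η ^ 2) := by
  calc _ ≤ ∫⁻ ξ, (2 * (∫⁻ η, K₁ (ξ - η) * F₁ η) ^ 2 + 2 * (∫⁻ η, K₂ (ξ - η) * F₂ η) ^ 2) :=
        lintegral_mono fun ξ => (pow_le_pow_left' (hG ξ) 2).trans (ennreal_add_sq_le_two _ _)
    _ = _ := by
        rw [lintegral_add_left (((measurable_conv hK₁ hF₁).pow_const 2).const_mul 2),
          lintegral_const_mul' _ _ (by finiteness), lintegral_const_mul' _ _ (by finiteness)]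
    _ ≤ _ := by
        gcongr
        · exact lintegral_sq_conv_le hK₁ hF₁
        · exact lintegral_sq_conv_le hK₂ hF₂

lemma enorm_le_enorm_sub_add (ξ η : ℝ) : ‖ξ‖ₑ ≤ ‖ξ - η‖ₑ + ‖η‖ₑ := by
  simpa using enorm_add_le (ξ - η) η

/-- Multiplication by a smooth compactly supported function preserves the space. -/
theorem smul_mem_fourierSobolev {u f : ℝ → ℂ} (hu : ContDiff ℝ (⊤ : ℕ∞) u)
    (huc : HasCompactSupport u) (hf : f ∈ fourierSobolev) :
    (fun x => u x * f x) ∈ fourierSobolev := by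
  have hui : Integrable u := hu.continuous.integrable_of_hasCompactSupport huc
  have hcu : Continuous (𝓕 u) := fourier_continuous_of_integrable hui
  have hcf := sobolev_continuous_fourier hf
  have hgc : Continuous fun x => u x * f x := hu.continuous.mul hf.1
  have hg : Integrable fun x => u x * f x :=
    hgc.integrable_of_hasCompactSupport huc.mul_right
  have hgF : Continuous (𝓕 fun x => u x * f x) := fourier_continuous_of_integrable hg
  refine ⟨hgc, ?_, ?_⟩
  · refine Continuous.integrable_of_hasCompactSupport (by fun_prop) ?_
    refine (huc.mul_right (f' := f)).mono fun x hx => ?_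
    have : (1 + x ^ 2) * ‖u x * f x‖ ^ 2 ≠ 0 := hx
    simp only [ne_eq, mul_eq_zero, pow_eq_zero_iff two_ne_zero, norm_eq_zero, not_or] at this
    simpa using this.2
  · have hk1 : Measurable fun t : ℝ => ‖t‖ₑ * ‖𝓕 u t‖ₑ := by
      have := hcu.enorm.measurable
      fun_prop
    have hN1 : Measurable fun t : ℝ => ‖t‖ₑ * ‖𝓕 f t‖ₑ := by
      have := hcf.enorm.measurable
      fun_prop
    have hfin0 := (lintegral_weighted_lt_top hf.2.2).1
    have hfin1 := (lintegral_weighted_lt_top hf.2.2).2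
    have hM0 : ∫⁻ t, ‖𝓕 u t‖ₑ < ⊤ := by
      simpa [fourierMoment] using fourierMoment_lt_top hu huc 0
    have hM1 : ∫⁻ t : ℝ, ‖t‖ₑ * ‖𝓕 u t‖ₑ < ⊤ := by
      simpa [fourierMoment] using fourierMoment_lt_top hu huc 1
    have hE : ∫⁻ ξ, ‖𝓕 (fun x => u x * f x) ξ‖ₑ ^ 2 < ⊤ := by
      calc _ ≤ ∫⁻ ξ, (∫⁻ η, ‖𝓕 u (ξ - η)‖ₑ * ‖𝓕 f η‖ₑ) ^ 2 :=
            lintegral_mono fun ξ => by gcongr; exact enorm_fourier_mul_le hui hf ξ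
        _ ≤ _ := lintegral_sq_conv_le hcu.enorm.measurable hcf.enorm.measurable
        _ < ⊤ := by finiteness
    have hD : ∫⁻ ξ : ℝ, (‖ξ‖ₑ * ‖𝓕 (fun x => u x * f x) ξ‖ₑ) ^ 2 < ⊤ := by
      have hpt : ∀ ξ : ℝ, ‖ξ‖ₑ * ‖𝓕 (fun x => u x * f x) ξ‖ₑ ≤
          (∫⁻ η, (‖ξ - η‖ₑ * ‖𝓕 u (ξ - η)‖ₑ) * ‖𝓕 f η‖ₑ) +
            ∫⁻ η, ‖𝓕 u (ξ - η)‖ₑ * (‖η‖ₑ * ‖𝓕 f η‖ₑ) := by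
        intro ξ
        rw [← lintegral_add_left (by
          have := hcf.enorm.measurable
          exact (hk1.comp (measurable_const.sub measurable_id)).mul this)]
        calc ‖ξ‖ₑ * ‖𝓕 (fun x => u x * f x) ξ‖ₑ
            ≤ ‖ξ‖ₑ * ∫⁻ η, ‖𝓕 u (ξ - η)‖ₑ * ‖𝓕 f η‖ₑ := by
              gcongr; exact enorm_fourier_mul_le hui hf ξ
          _ = ∫⁻ η, ‖ξ‖ₑ * (‖𝓕 u (ξ - η)‖ₑ * ‖𝓕 f η‖ₑ) :=
              (lintegral_const_mul' _ _ enorm_ne_top).symm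
          _ ≤ _ := by
              refine lintegral_mono fun η => ?_
              calc _ ≤ (‖ξ - η‖ₑ + ‖η‖ₑ) * (‖𝓕 u (ξ - η)‖ₑ * ‖𝓕 f η‖ₑ) := by
                    gcongr; exact enorm_le_enorm_sub_add ξ η
                _ = _ := by ring
      refine (lintegral_sq_le_of_le_conv_add hk1 hcf.enorm.measurable hcu.enorm.measurable hN1
        hpt).trans_lt ?_
      finiteness
    have e0 : Integrable fun ξ => ‖𝓕 (fun x => u x * f x) ξ‖ ^ 2 := by
      refine ⟨by fun_prop, ?_⟩
      refine lt_of_le_of_lt (le_of_eq (lintegral_congr fun ξ => ?_)) hE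
      rw [enorm_pow, enorm_norm]
    have e1 : Integrable fun ξ : ℝ => ξ ^ 2 * ‖𝓕 (fun x => u x * f x) ξ‖ ^ 2 := by
      refine ⟨by fun_prop, ?_⟩
      refine lt_of_le_of_lt (le_of_eq (lintegral_congr fun ξ => ?_)) hD
      rw [enorm_mul, enorm_pow, enorm_pow, enorm_norm, mul_pow]
    refine (e0.add e1).congr (Eventually.of_forall fun ξ => ?_)
    simp only [Pi.add_apply]
    ring

/-! ### A geometric partition of unity -/

/-- For `γ > 1`, a smooth even angle rising from `0` on `|y| ≤ 1` to `π / 2` on `γ ≤ |y|`. -/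
noncomputable def stepAngle (γ y : ℝ) : ℝ :=
  Real.pi / 2 * Real.smoothTransition ((y ^ 2 - 1) / (γ ^ 2 - 1))

/-- The squared sine of the step angle, a smooth step. -/
noncomputable def outerStep (γ y : ℝ) : ℝ := Real.sin (stepAngle γ y) ^ 2

/-- A smooth bump supported in `1 ≤ |y| ≤ γ²`, whose square is the difference of the outer steps
at the scales `1` and `γ`. -/
noncomputable def annulusBump (γ y : ℝ) : ℝ :=
  Real.sin (stepAngle γ y) * Real.cos (stepAngle γ (y / γ))

section annulusBump

variable {γ : ℝ} (hγ : 1 < γ)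
include hγ

lemma outerStep_eq_zero {y : ℝ} (hy : |y| ≤ 1) : outerStep γ y = 0 := by
  have h : (y ^ 2 - 1) / (γ ^ 2 - 1) ≤ 0 :=
    div_nonpos_of_nonpos_of_nonneg (by nlinarith [sq_abs y, abs_nonneg y]) (by nlinarith)
  simp [outerStep, stepAngle, Real.smoothTransition.zero_of_nonpos h]

lemma stepAngle_eq {y : ℝ} (hy : γ ≤ |y|) : stepAngle γ y = Real.pi / 2 := by
  have h : 1 ≤ (y ^ 2 - 1) / (γ ^ 2 - 1) := by
    rw [one_le_div (by nlinarith)]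
    nlinarith [sq_abs y]
  simp [stepAngle, Real.smoothTransition.one_of_one_le h]

lemma outerStep_eq_one {y : ℝ} (hy : γ ≤ |y|) : outerStep γ y = 1 := by
  simp [outerStep, stepAngle_eq hγ hy]

lemma annulusBump_sq (y : ℝ) : annulusBump γ y ^ 2 = outerStep γ y - outerStep γ (y / γ) := by
  have h1 : annulusBump γ y ^ 2 = outerStep γ y * (1 - outerStep γ (y / γ)) := by
    simp only [annulusBump, outerStep, mul_pow, Real.cos_sq']
  rw [h1]
  rcases le_or_gt |y| γ with h | h
  · have : outerStep γ (y / γ) = 0 := outerStep_eq_zero hγ (by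
      rw [abs_div, abs_of_pos (by linarith : (0 : ℝ) < γ)]
      exact (div_le_one (by linarith)).2 h)
    rw [this]; ring
  · rw [outerStep_eq_one hγ h.le]; ring

lemma annulusBump_eq_zero_of_le {y : ℝ} (hy : |y| ≤ 1) : annulusBump γ y = 0 := by
  have h := outerStep_eq_zero hγ hy
  simp only [outerStep, pow_eq_zero_iff two_ne_zero] at h
  simp [annulusBump, h]

lemma annulusBump_eq_zero_of_ge {y : ℝ} (hy : γ ^ 2 ≤ |y|) : annulusBump γ y = 0 := by
  have h0 : (0 : ℝ) < γ := by linarith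
  have : γ ≤ |y / γ| := by
    rw [abs_div, abs_of_pos h0, le_div_iff₀ h0]
    nlinarith
  simp [annulusBump, stepAngle_eq hγ this]

omit hγ in
lemma contDiff_stepAngle : ContDiff ℝ (⊤ : ℕ∞) (stepAngle γ) := by
  unfold stepAngle
  refine contDiff_const.mul (Real.smoothTransition.contDiff.comp ?_)
  exact ((contDiff_id.pow 2).sub contDiff_const).div_const _

omit hγ in
lemma contDiff_annulusBump : ContDiff ℝ (⊤ : ℕ∞) fun y => (annulusBump γ y : ℂ) := by
  exact Complex.ofRealCLM.contDiff.comp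
    (contDiff_stepAngle.sin.mul ((contDiff_stepAngle.comp (contDiff_id.div_const _)).cos))

/-- The telescoping sum of the squared bumps at the scales `L γ^n`. -/
theorem tsum_annulusBump_sq {L : ℝ} (hL : 0 < L) (x : ℝ) :
    ∑' n : ℕ, ENNReal.ofReal (annulusBump γ (x / (L * γ ^ n)) ^ 2) =
      ENNReal.ofReal (outerStep γ (x / L)) := by
  have h0 : (0 : ℝ) < γ := by linarith
  have hs : HasSum (fun n : ℕ => annulusBump γ (x / (L * γ ^ n)) ^ 2) (outerStep γ (x / L)) := by
    rw [hasSum_iff_tendsto_nat_of_nonneg fun n => sq_nonneg _]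
    have hsum : ∀ n, ∑ i ∈ Finset.range n, annulusBump γ (x / (L * γ ^ i)) ^ 2 =
        outerStep γ (x / L) - outerStep γ (x / (L * γ ^ n)) := by
      intro n
      have hterm : ∀ i : ℕ, annulusBump γ (x / (L * γ ^ i)) ^ 2 =
          outerStep γ (x / (L * γ ^ i)) - outerStep γ (x / (L * γ ^ (i + 1))) := by
        intro i
        rw [annulusBump_sq hγ, div_div, mul_assoc, ← pow_succ]
      simp only [hterm]
      rw [Finset.sum_range_sub' (fun i => outerStep γ (x / (L * γ ^ i)))]
      simp
    simp only [hsum]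
    refine tendsto_const_nhds.congr' ?_
    have hinf := tendsto_pow_atTop_atTop_of_one_lt hγ
    filter_upwards [hinf.eventually_ge_atTop (|x| / L)] with n hn
    rw [outerStep_eq_zero hγ (y := x / (L * γ ^ n)), sub_zero]
    rw [abs_div, abs_of_pos (show 0 < L * γ ^ n by positivity), div_le_one (by positivity)]
    rwa [div_le_iff₀' hL] at hn
  rw [← hs.tsum_eq, ENNReal.ofReal_tsum_of_nonneg (fun n => sq_nonneg _) hs.summable]

end annulusBump

/-! ### Localization in space -/

/-- The smooth cutoff to the annulus `L ≤ |x| ≤ γ² L`, with complex values so that it multiplies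
complex functions. -/
noncomputable def annulusCutoff (γ L : ℝ) (x : ℝ) : ℂ := (annulusBump γ (x / L) : ℂ)

section annulusCutoff

variable {γ L : ℝ}

lemma contDiff_annulusCutoff : ContDiff ℝ (⊤ : ℕ∞) (annulusCutoff γ L) :=
  contDiff_annulusBump.comp (contDiff_id.div_const L)

lemma annulusCutoff_eq_zero_of_le (hγ : 1 < γ) (hL : 0 < L) {x : ℝ} (hx : |x| ≤ L) :
    annulusCutoff γ L x = 0 := by
  rw [annulusCutoff, annulusBump_eq_zero_of_le hγ, Complex.ofReal_zero]
  rwa [abs_div, abs_of_pos hL, div_le_one hL]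

lemma annulusCutoff_eq_zero_of_ge (hγ : 1 < γ) (hL : 0 < L) {x : ℝ} (hx : γ ^ 2 * L ≤ |x|) :
    annulusCutoff γ L x = 0 := by
  rw [annulusCutoff, annulusBump_eq_zero_of_ge hγ, Complex.ofReal_zero]
  rwa [abs_div, abs_of_pos hL, le_div_iff₀ hL]

lemma hasCompactSupport_annulusCutoff (hγ : 1 < γ) (hL : 0 < L) :
    HasCompactSupport (annulusCutoff γ L) := by
  refine HasCompactSupport.intro (isCompact_Icc (a := -(γ ^ 2 * L)) (b := γ ^ 2 * L)) fun y hy => ?_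
  refine annulusCutoff_eq_zero_of_ge hγ hL ?_
  by_contra h
  exact hy (abs_le.1 (not_le.1 h).le)

lemma enorm_annulusCutoff_sq (x : ℝ) :
    ‖annulusCutoff γ L x‖ₑ ^ 2 = ENNReal.ofReal (annulusBump γ (x / L) ^ 2) := by
  rw [← ofReal_norm, ← ENNReal.ofReal_pow (norm_nonneg _), annulusCutoff, Complex.norm_real,
    Real.norm_eq_abs, sq_abs]

lemma integrable_annulusCutoff (hγ : 1 < γ) (hL : 0 < L) : Integrable (annulusCutoff γ L) :=
  contDiff_annulusCutoff.continuous.integrable_of_hasCompactSupport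
    (hasCompactSupport_annulusCutoff hγ hL)

lemma annulusCutoff_mul_mem (hγ : 1 < γ) (hL : 0 < L) {f : ℝ → ℂ} (hf : f ∈ fourierSobolev) :
    (fun x => annulusCutoff γ L x * f x) ∈ fourierSobolev :=
  smul_mem_fourierSobolev contDiff_annulusCutoff (hasCompactSupport_annulusCutoff hγ hL) hf

lemma fourierMoment_annulusCutoff (hγ : 1 < γ) (hL : 0 < L) (i : ℕ) :
    fourierMoment (annulusCutoff γ L) i =
      ENNReal.ofReal (L ^ i)⁻¹ * fourierMoment (annulusCutoff γ 1) i := by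
  have h1 : annulusCutoff γ L = fun x => annulusCutoff γ 1 (x / L) := by
    ext x; simp [annulusCutoff]
  rw [h1, fourierMoment_comp_div (integrable_annulusCutoff hγ one_pos) hL]

lemma fourierMoment_annulusCutoff_lt_top (hγ : 1 < γ) (hL : 0 < L) (i : ℕ) :
    fourierMoment (annulusCutoff γ L) i < ⊤ :=
  fourierMoment_lt_top contDiff_annulusCutoff (hasCompactSupport_annulusCutoff hγ hL) i

end annulusCutoff

/-- The local form of the weighted Wirtinger inequality: a cutoff does not destroy the zeros. -/
lemma local_frequency_bound {lam : ℤ → ℝ} {W : ℝ≥0 → ℝ} (hWm : Monotone W) (hW0 : ∀ x, 0 ≤ W x)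
    {a R : ℝ}
    (hR : ∀ φ : ℝ → ℂ, Integrable φ → (∀ j, 𝓕 φ (lam j) = 0) →
      ∫⁻ x in {x : ℝ | R ≤ |x|}, (‖W ‖x‖₊‖ₑ * ‖𝓕 φ x‖ₑ) ^ 2 ≤
        ENNReal.ofReal (a ^ 2) * ∫⁻ ξ : ℝ, (‖ξ‖ₑ * ‖φ ξ‖ₑ) ^ 2)
    {γ : ℝ} (hγ : 1 < γ) {L : ℝ≥0} (hL : 0 < L) (hRL : R ≤ L) {f : ℝ → ℂ}
    (hf : f ∈ fourierSobolev) (hz : ∀ j, f (lam j) = 0) :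
    ENNReal.ofReal (W L ^ 2) * ∫⁻ x, ‖annulusCutoff γ L x * f x‖ₑ ^ 2 ≤ ENNReal.ofReal (a ^ 2) *
      ∫⁻ ξ : ℝ, (‖ξ‖ₑ * ‖𝓕 (fun x => annulusCutoff γ L x * f x) ξ‖ₑ) ^ 2 := by
  have hL' : (0 : ℝ) < L := hL
  set g : ℝ → ℂ := fun x => annulusCutoff γ L x * f x with hg
  have hgm : g ∈ fourierSobolev := annulusCutoff_mul_mem hγ hL' hf
  have h := hR (fun ξ => 𝓕 g (-ξ)) (sobolev_integrable_fourier hgm).comp_neg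
    (by rw [sobolev_inversion hgm]; intro j; simp [hg, hz])
  rw [sobolev_inversion hgm, lintegral_freq_reflect] at h
  refine le_trans ?_ h
  rw [← lintegral_const_mul' _ _ ENNReal.ofReal_ne_top, ← lintegral_indicator
    (measurableSet_le measurable_const continuous_abs.measurable)]
  refine lintegral_mono fun x => ?_
  rcases le_or_gt |x| L with hx | hx
  · have : g x = 0 := by simp [hg, annulusCutoff_eq_zero_of_le hγ hL' hx]
    change ENNReal.ofReal (W L ^ 2) * ‖g x‖ₑ ^ 2 ≤ _
    simp [this]
  · rw [Set.indicator_of_mem (by exact hRL.trans hx.le), mul_pow, ENNReal.ofReal_pow (hW0 _),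
      Real.enorm_of_nonneg (hW0 _)]
    gcongr
    refine hWm (NNReal.coe_le_coe.1 ?_)
    simpa using hx.le

/-- The second moment of `f` outside a ball is controlled by its pieces in geometric annuli. -/
lemma lintegral_outer_le_tsum {γ : ℝ} (hγ : 1 < γ) {L : ℝ} (hL : 0 < L) {f : ℝ → ℂ}
    (hf : Continuous f) :
    ∫⁻ x in {x : ℝ | γ * L ≤ |x|}, (‖x‖ₑ * ‖f x‖ₑ) ^ 2 ≤ ENNReal.ofReal (γ ^ 4) *
      ∑' n : ℕ, ENNReal.ofReal ((L * γ ^ n) ^ 2) *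
        ∫⁻ x, ‖annulusCutoff γ (L * γ ^ n) x * f x‖ₑ ^ 2 := by
  have h0 : (0 : ℝ) < γ := by linarith
  have hfm : Measurable fun x => ‖f x‖ₑ := hf.enorm.measurable
  have hcm : ∀ n : ℕ, Measurable fun x => ‖annulusCutoff γ (L * γ ^ n) x * f x‖ₑ := fun n =>
    (contDiff_annulusCutoff.continuous.mul hf).enorm.measurable
  have hpiece : ∀ (n : ℕ) (x : ℝ), ‖annulusCutoff γ (L * γ ^ n) x‖ₑ ^ 2 * (‖x‖ₑ * ‖f x‖ₑ) ^ 2 ≤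
      ENNReal.ofReal (γ ^ 4) * (ENNReal.ofReal ((L * γ ^ n) ^ 2) *
        ‖annulusCutoff γ (L * γ ^ n) x * f x‖ₑ ^ 2) := by
    intro n x
    have hLn : (0 : ℝ) < L * γ ^ n := by positivity
    rcases le_or_gt (γ ^ 2 * (L * γ ^ n)) |x| with hx | hx
    · simp [annulusCutoff_eq_zero_of_ge hγ hLn hx]
    · rw [← mul_assoc, ← ENNReal.ofReal_mul (by positivity), enorm_mul,
        mul_pow ‖annulusCutoff γ (L * γ ^ n) x‖ₑ, mul_pow ‖x‖ₑ]
      have : ‖x‖ₑ ^ 2 ≤ ENNReal.ofReal (γ ^ 4 * (L * γ ^ n) ^ 2) := by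
        rw [← ofReal_norm, ← ENNReal.ofReal_pow (norm_nonneg _)]
        refine ENNReal.ofReal_le_ofReal ?_
        rw [Real.norm_eq_abs, show γ ^ 4 * (L * γ ^ n) ^ 2 = (γ ^ 2 * (L * γ ^ n)) ^ 2 by ring]
        gcongr
      calc _ = ‖x‖ₑ ^ 2 * (‖annulusCutoff γ (L * γ ^ n) x‖ₑ ^ 2 * ‖f x‖ₑ ^ 2) := by ring
        _ ≤ _ := by gcongr
  calc ∫⁻ x in {x : ℝ | γ * L ≤ |x|}, (‖x‖ₑ * ‖f x‖ₑ) ^ 2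
      ≤ ∫⁻ x : ℝ, ENNReal.ofReal (outerStep γ (x / L)) * (‖x‖ₑ * ‖f x‖ₑ) ^ 2 := by
        rw [← lintegral_indicator (measurableSet_le measurable_const continuous_abs.measurable)]
        refine lintegral_mono fun x => ?_
        by_cases hx : γ * L ≤ |x|
        · rw [Set.indicator_of_mem (by exact hx), outerStep_eq_one hγ, ENNReal.ofReal_one, one_mul]
          rwa [abs_div, abs_of_pos hL, le_div_iff₀ hL]
        · rw [Set.indicator_of_notMem (by exact hx)]
          exact zero_le
    _ = ∫⁻ x : ℝ, ∑' n : ℕ, ‖annulusCutoff γ (L * γ ^ n) x‖ₑ ^ 2 * (‖x‖ₑ * ‖f x‖ₑ) ^ 2 := by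
        refine lintegral_congr fun x => ?_
        rw [← tsum_annulusBump_sq hγ hL, ENNReal.tsum_mul_right]
        simp only [enorm_annulusCutoff_sq]
    _ = ∑' n : ℕ, ∫⁻ x : ℝ, ‖annulusCutoff γ (L * γ ^ n) x‖ₑ ^ 2 * (‖x‖ₑ * ‖f x‖ₑ) ^ 2 := by
        refine lintegral_tsum fun n => Measurable.aemeasurable ?_
        have : Measurable fun x => ‖annulusCutoff γ (L * γ ^ n) x‖ₑ :=
          contDiff_annulusCutoff.continuous.enorm.measurable
        fun_prop
    _ ≤ ∑' n : ℕ, ENNReal.ofReal (γ ^ 4) * (ENNReal.ofReal ((L * γ ^ n) ^ 2) *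
        ∫⁻ x, ‖annulusCutoff γ (L * γ ^ n) x * f x‖ₑ ^ 2) := by
        refine ENNReal.tsum_le_tsum fun n => ?_
        rw [← lintegral_const_mul' _ _ ENNReal.ofReal_ne_top,
          ← lintegral_const_mul' _ _ ENNReal.ofReal_ne_top]
        exact lintegral_mono (hpiece n)
    _ = _ := ENNReal.tsum_mul_left

/-- If the second moment far out is at most a proper fraction of the whole second moment, up to the
norm, then it is controlled by the norm. -/
lemma moment_le_of_outer_le {f : ℝ → ℂ} {ρ R C : ℝ} (hρ0 : 0 ≤ ρ) (hρ : ρ < 1)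
    (hC : 0 ≤ C) (hX : ∫⁻ x : ℝ, (‖x‖ₑ * ‖f x‖ₑ) ^ 2 < ⊤) (hE : ∫⁻ x, ‖f x‖ₑ ^ 2 < ⊤)
    (h : ∫⁻ x in {x : ℝ | R ≤ |x|}, (‖x‖ₑ * ‖f x‖ₑ) ^ 2 ≤
      ENNReal.ofReal ρ * (∫⁻ x : ℝ, (‖x‖ₑ * ‖f x‖ₑ) ^ 2) + ENNReal.ofReal C * ∫⁻ x, ‖f x‖ₑ ^ 2) :
    ∫⁻ x : ℝ, (‖x‖ₑ * ‖f x‖ₑ) ^ 2 ≤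
      ENNReal.ofReal ((R ^ 2 + C) / (1 - ρ)) * ∫⁻ x, ‖f x‖ₑ ^ 2 := by
  set X := ∫⁻ x : ℝ, (‖x‖ₑ * ‖f x‖ₑ) ^ 2 with hXd
  set E := ∫⁻ x, ‖f x‖ₑ ^ 2 with hEd
  have hmeas : MeasurableSet {x : ℝ | R ≤ |x|} :=
    measurableSet_le measurable_const continuous_abs.measurable
  have hin : ∫⁻ x in {x : ℝ | R ≤ |x|}ᶜ, (‖x‖ₑ * ‖f x‖ₑ) ^ 2 ≤ ENNReal.ofReal (R ^ 2) * E := by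
    rw [hEd, ← lintegral_const_mul' _ _ ENNReal.ofReal_ne_top]
    refine le_trans (setLIntegral_mono' hmeas.compl fun x hx => ?_) (setLIntegral_le_lintegral _ _)
    rw [mul_pow]
    gcongr
    rw [← ofReal_norm, ← ENNReal.ofReal_pow (norm_nonneg _)]
    refine ENNReal.ofReal_le_ofReal ?_
    have : |x| < R := not_le.1 hx
    rw [Real.norm_eq_abs]
    gcongr
  have htot : X ≤ ENNReal.ofReal ρ * X + ENNReal.ofReal C * E + ENNReal.ofReal (R ^ 2) * E := by
    calc X = _ := (lintegral_add_compl _ hmeas).symm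
      _ ≤ _ := add_le_add h hin
  have hXr : X = ENNReal.ofReal X.toReal := (ENNReal.ofReal_toReal hX.ne).symm
  have hEr : E = ENNReal.ofReal E.toReal := (ENNReal.ofReal_toReal hE.ne).symm
  have hx0 : 0 ≤ X.toReal := ENNReal.toReal_nonneg
  have he0 : 0 ≤ E.toReal := ENNReal.toReal_nonneg
  have h1 : (0 : ℝ) < 1 - ρ := by linarith
  rw [hXr, hEr, ← ENNReal.ofReal_mul hρ0, ← ENNReal.ofReal_mul hC,
    ← ENNReal.ofReal_mul (by positivity), ← ENNReal.ofReal_add (by positivity) (by positivity),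
    ← ENNReal.ofReal_add (by positivity) (by positivity),
    ENNReal.ofReal_le_ofReal_iff (by positivity)] at htot
  rw [hXr, hEr, ← ENNReal.ofReal_mul (by positivity)]
  refine ENNReal.ofReal_le_ofReal ?_
  rw [div_mul_eq_mul_div, le_div_iff₀ h1]
  linarith

/-! ### Weights growing faster than every power -/

lemma tsum_geometric_truncated_le {L Y : ℝ} (hL : 0 < L) :
    ∑' n : ℕ, (if L * 2 ^ n ≤ Y then ENNReal.ofReal (L * 2 ^ n) else 0) ≤
      ENNReal.ofReal (2 * Y) := by
  rw [ENNReal.tsum_eq_iSup_nat]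
  refine iSup_le fun m => ?_
  have h : ∑ n ∈ Finset.range m, (if L * 2 ^ n ≤ Y then ENNReal.ofReal (L * 2 ^ n) else 0) ≤
      ENNReal.ofReal (L * 2 ^ m) ∧
    ∑ n ∈ Finset.range m, (if L * 2 ^ n ≤ Y then ENNReal.ofReal (L * 2 ^ n) else 0) ≤
      ENNReal.ofReal (2 * Y) := by
    induction m with
    | zero => simp
    | succ m ih =>
      rw [Finset.sum_range_succ]
      by_cases hm : L * 2 ^ m ≤ Y
      · rw [if_pos hm]
        have h2 : ENNReal.ofReal (L * 2 ^ m) + ENNReal.ofReal (L * 2 ^ m) =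
            ENNReal.ofReal (L * 2 ^ (m + 1)) := by
          rw [← ENNReal.ofReal_add (by positivity) (by positivity)]
          congr 1; ring
        have h3 := (add_le_add_left ih.1 (ENNReal.ofReal (L * 2 ^ m))).trans_eq h2
        refine ⟨h3, h3.trans (ENNReal.ofReal_le_ofReal ?_)⟩
        rw [pow_succ]; linarith
      · rw [if_neg hm, add_zero]
        refine ⟨ih.1.trans (ENNReal.ofReal_le_ofReal ?_), ih.2⟩
        gcongr
        · norm_num
        · omega
  exact h.2

/-- A function whose mean frequency is at least `α / ρ⁴` has a fixed proportion of its frequency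
moment beyond `α / ρ²`. -/
lemma high_frequency_lower_bound {g : ℝ → ℂ} (hg : g ∈ fourierSobolev) {α ρ : ℝ} (hα : 0 < α)
    (hρ0 : 0 < ρ) (hρ1 : ρ < 1)
    (h : ENNReal.ofReal (α ^ 2) * ∫⁻ x, ‖g x‖ₑ ^ 2 ≤
      ENNReal.ofReal ((ρ ^ 4) ^ 2) * ∫⁻ ξ : ℝ, (‖ξ‖ₑ * ‖𝓕 g ξ‖ₑ) ^ 2) :
    ENNReal.ofReal ((1 - ρ ^ 4) * α ^ 2) * ∫⁻ x, ‖g x‖ₑ ^ 2 ≤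
      ∫⁻ ξ in {ξ : ℝ | α / ρ ^ 2 < |ξ|}, (‖ξ‖ₑ * ‖𝓕 g ξ‖ₑ) ^ 2 := by
  set E := ∫⁻ x, ‖g x‖ₑ ^ 2 with hEd
  set s : Set ℝ := {ξ : ℝ | α / ρ ^ 2 < |ξ|} with hs
  set D := ∫⁻ ξ in s, (‖ξ‖ₑ * ‖𝓕 g ξ‖ₑ) ^ 2 with hDd
  have hmeas : MeasurableSet s := measurableSet_lt measurable_const continuous_abs.measurable
  have hlow : ∫⁻ ξ in sᶜ, (‖ξ‖ₑ * ‖𝓕 g ξ‖ₑ) ^ 2 ≤ ENNReal.ofReal ((α / ρ ^ 2) ^ 2) * E := by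
    rw [hEd, ← sobolev_plancherel hg, ← lintegral_const_mul' _ _ ENNReal.ofReal_ne_top]
    refine le_trans (setLIntegral_mono' hmeas.compl fun x hx => ?_) (setLIntegral_le_lintegral _ _)
    rw [mul_pow]
    gcongr
    rw [← ofReal_norm, ← ENNReal.ofReal_pow (norm_nonneg _)]
    refine ENNReal.ofReal_le_ofReal ?_
    have : |x| ≤ α / ρ ^ 2 := not_lt.1 hx
    rw [Real.norm_eq_abs]
    gcongr
  have htot := lintegral_add_compl (μ := volume) (fun ξ : ℝ => (‖ξ‖ₑ * ‖𝓕 g ξ‖ₑ) ^ 2) hmeas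
  rw [← htot] at h
  have hE : E ≠ ⊤ := (sobolev_norm_lt_top hg).ne
  rcases eq_or_ne D ⊤ with hD | hD
  · rw [hD]; exact le_top
  have hEr : E = ENNReal.ofReal E.toReal := (ENNReal.ofReal_toReal hE).symm
  have hDr : D = ENNReal.ofReal D.toReal := (ENNReal.ofReal_toReal hD).symm
  have he0 : 0 ≤ E.toReal := ENNReal.toReal_nonneg
  have hd0 : 0 ≤ D.toReal := ENNReal.toReal_nonneg
  have hρ4 : ρ ^ 4 < 1 := pow_lt_one₀ hρ0.le hρ1 (by norm_num)
  have h2 : ENNReal.ofReal (α ^ 2) * E ≤ ENNReal.ofReal ((ρ ^ 4) ^ 2) *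
      (D + ENNReal.ofReal ((α / ρ ^ 2) ^ 2) * E) := h.trans (by gcongr)
  rw [hEr, hDr, ← ENNReal.ofReal_mul (by positivity), ← ENNReal.ofReal_mul (by positivity),
    ← ENNReal.ofReal_add hd0 (by positivity), ← ENNReal.ofReal_mul (by positivity),
    ENNReal.ofReal_le_ofReal_iff (by positivity)] at h2
  rw [hEr, hDr, ← ENNReal.ofReal_mul (mul_nonneg (by linarith) (sq_nonneg _))]
  refine ENNReal.ofReal_le_ofReal ?_
  have h3 : (ρ ^ 4) ^ 2 * (D.toReal + (α / ρ ^ 2) ^ 2 * E.toReal) =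
      (ρ ^ 4) ^ 2 * D.toReal + ρ ^ 4 * α ^ 2 * E.toReal := by field_simp
  have h4 : (ρ ^ 4) ^ 2 * D.toReal ≤ 1 * D.toReal := by
    gcongr
    exact pow_le_one₀ (by positivity) hρ4.le
  rw [h3] at h2
  linarith

/-- The high frequencies of `u f` come from the high frequencies of `f`, up to the tails of the
Fourier transform of `u`. -/
lemma high_frequency_upper_bound {u f : ℝ → ℂ} (hu : Integrable u) (hf : f ∈ fourierSobolev)
    {α ρ : ℝ} (hα : 1 ≤ α) (hρ0 : 0 < ρ) (hρ1 : ρ < 1) :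
    ∫⁻ ξ in {ξ : ℝ | α / ρ ^ 2 < |ξ|}, (‖ξ‖ₑ * ‖𝓕 (fun x => u x * f x) ξ‖ₑ) ^ 2 ≤
      2 * ((fourierMoment u 0 + fourierMoment u 1) ^ 2 *
        ∫⁻ η in {η : ℝ | α / ρ < |η|}, (‖η‖ₑ * ‖𝓕 f η‖ₑ) ^ 2) +
      2 * (fourierMoment u 2 ^ 2 *
        (ENNReal.ofReal (((1 - ρ) ^ 2 * α)⁻¹ ^ 2) * ∫⁻ x, ‖f x‖ₑ ^ 2)) := by
  set s : Set ℝ := {ξ : ℝ | α / ρ ^ 2 < |ξ|} with hs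
  set s' : Set ℝ := {η : ℝ | α / ρ < |η|} with hs'
  have hmeas : MeasurableSet s := measurableSet_lt measurable_const continuous_abs.measurable
  have hmeas' : MeasurableSet s' := measurableSet_lt measurable_const continuous_abs.measurable
  have hcu : Measurable fun t => ‖𝓕 u t‖ₑ := (fourier_continuous_of_integrable hu).enorm.measurable
  have hcf : Measurable fun t => ‖𝓕 f t‖ₑ := (sobolev_continuous_fourier hf).enorm.measurable
  have h1ρ : 0 < 1 - ρ := by linarith
  set c : ℝ := ((1 - ρ) ^ 2 * α)⁻¹ with hc
  have hc0 : 0 ≤ c := by positivity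
  have hK1 : Measurable fun t : ℝ => (1 + ‖t‖ₑ) * ‖𝓕 u t‖ₑ := by fun_prop
  have hK2 : Measurable fun t : ℝ => ‖t‖ₑ ^ 2 * ‖𝓕 u t‖ₑ := by fun_prop
  have hF1 : Measurable (s'.indicator fun η : ℝ => ‖η‖ₑ * ‖𝓕 f η‖ₑ) :=
    Measurable.indicator (by fun_prop) hmeas'
  have hF2 : Measurable fun η : ℝ => ENNReal.ofReal c * ‖𝓕 f η‖ₑ := by fun_prop
  have hpt : ∀ ξ, s.indicator (fun ξ => ‖ξ‖ₑ * ‖𝓕 (fun x => u x * f x) ξ‖ₑ) ξ ≤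
      (∫⁻ η, ((1 + ‖ξ - η‖ₑ) * ‖𝓕 u (ξ - η)‖ₑ) * s'.indicator (fun η : ℝ => ‖η‖ₑ * ‖𝓕 f η‖ₑ) η) +
        ∫⁻ η, (‖ξ - η‖ₑ ^ 2 * ‖𝓕 u (ξ - η)‖ₑ) * (ENNReal.ofReal c * ‖𝓕 f η‖ₑ) := by
    intro ξ
    by_cases hξ : ξ ∈ s
    swap
    · rw [Set.indicator_of_notMem hξ]; exact zero_le
    have hm : Measurable fun η => ((1 + ‖ξ - η‖ₑ) * ‖𝓕 u (ξ - η)‖ₑ) *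
        s'.indicator (fun η : ℝ => ‖η‖ₑ * ‖𝓕 f η‖ₑ) η :=
      (hK1.comp (measurable_const.sub measurable_id)).mul hF1
    rw [Set.indicator_of_mem hξ, ← lintegral_add_left hm]
    refine (mul_le_mul_right (enorm_fourier_mul_le hu hf ξ) ‖ξ‖ₑ).trans ?_
    rw [← lintegral_const_mul' _ _ enorm_ne_top]
    refine lintegral_mono fun η => ?_
    have hξ' : α / ρ ^ 2 < |ξ| := hξ
    by_cases hη : η ∈ s'
    · -- high to high: `|ξ| ≤ |ξ - η| + |η| ≤ (1 + |ξ - η|) |η|`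
      rw [Set.indicator_of_mem hη]
      have hη' : α / ρ < |η| := hη
      have h1 : 1 ≤ ‖η‖ₑ := by
        rw [← ofReal_norm, ← ENNReal.ofReal_one]
        refine ENNReal.ofReal_le_ofReal ?_
        have : 1 ≤ α / ρ := by rw [le_div_iff₀ hρ0]; linarith
        rw [Real.norm_eq_abs]; linarith
      have h2 : ‖ξ‖ₑ ≤ (1 + ‖ξ - η‖ₑ) * ‖η‖ₑ := by
        calc ‖ξ‖ₑ ≤ ‖ξ - η‖ₑ + ‖η‖ₑ := enorm_le_enorm_sub_add ξ η
          _ ≤ ‖ξ - η‖ₑ * ‖η‖ₑ + ‖η‖ₑ := by gcongr; exact le_mul_of_one_le_right' h1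
          _ = _ := by ring
      calc ‖ξ‖ₑ * (‖𝓕 u (ξ - η)‖ₑ * ‖𝓕 f η‖ₑ)
          ≤ ((1 + ‖ξ - η‖ₑ) * ‖η‖ₑ) * (‖𝓕 u (ξ - η)‖ₑ * ‖𝓕 f η‖ₑ) := by gcongr
        _ = ((1 + ‖ξ - η‖ₑ) * ‖𝓕 u (ξ - η)‖ₑ) * (‖η‖ₑ * ‖𝓕 f η‖ₑ) := by ring
        _ ≤ _ := le_self_add
    · -- low to high: the jump `|ξ - η|` is at least `(1 - ρ) |ξ|`
      rw [Set.indicator_of_notMem hη, mul_zero]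
      have hη' : |η| ≤ α / ρ := not_lt.1 hη
      have h2 : |ξ| ≤ |ξ - η| ^ 2 * c := by
        have e1 : α / ρ = ρ * (α / ρ ^ 2) := by field_simp
        have e2 : |ξ| ≤ |ξ - η| + |η| := by simpa using abs_add_le (ξ - η) η
        have e3 : |η| ≤ ρ * |ξ| := by rw [e1] at hη'; nlinarith
        have e4 : (1 - ρ) * |ξ| ≤ |ξ - η| := by linarith
        have e5 : α ≤ α / ρ ^ 2 := by
          rw [le_div_iff₀ (by positivity)]
          nlinarith [pow_le_one₀ hρ0.le hρ1.le (n := 2)]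
        have e6 : 0 < (1 - ρ) ^ 2 * α := by positivity
        rw [hc, ← div_eq_mul_inv, le_div_iff₀ e6]
        calc |ξ| * ((1 - ρ) ^ 2 * α) ≤ |ξ| * ((1 - ρ) ^ 2 * |ξ|) := by
              gcongr; linarith
          _ = ((1 - ρ) * |ξ|) ^ 2 := by ring
          _ ≤ _ := by gcongr
      have h3 : ‖ξ‖ₑ ≤ ‖ξ - η‖ₑ ^ 2 * ENNReal.ofReal c := by
        rw [← ofReal_norm, ← ofReal_norm, ← ENNReal.ofReal_pow (norm_nonneg _),
          ← ENNReal.ofReal_mul (by positivity)]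
        exact ENNReal.ofReal_le_ofReal h2
      calc ‖ξ‖ₑ * (‖𝓕 u (ξ - η)‖ₑ * ‖𝓕 f η‖ₑ)
          ≤ (‖ξ - η‖ₑ ^ 2 * ENNReal.ofReal c) * (‖𝓕 u (ξ - η)‖ₑ * ‖𝓕 f η‖ₑ) := by gcongr
        _ = (‖ξ - η‖ₑ ^ 2 * ‖𝓕 u (ξ - η)‖ₑ) * (ENNReal.ofReal c * ‖𝓕 f η‖ₑ) := by ring
        _ ≤ _ := le_add_self
  have h := lintegral_sq_le_of_le_conv_add hK1 hF1 hK2 hF2 hpt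
  have e1 : ∫⁻ ξ, (s.indicator (fun ξ => ‖ξ‖ₑ * ‖𝓕 (fun x => u x * f x) ξ‖ₑ) ξ) ^ 2 =
      ∫⁻ ξ in s, (‖ξ‖ₑ * ‖𝓕 (fun x => u x * f x) ξ‖ₑ) ^ 2 := by
    rw [← lintegral_indicator hmeas]
    refine lintegral_congr fun ξ => ?_
    by_cases hξ : ξ ∈ s <;> simp [hξ]
  have e2 : ∫⁻ η, (s'.indicator (fun η : ℝ => ‖η‖ₑ * ‖𝓕 f η‖ₑ) η) ^ 2 =
      ∫⁻ η in s', (‖η‖ₑ * ‖𝓕 f η‖ₑ) ^ 2 := by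
    rw [← lintegral_indicator hmeas']
    refine lintegral_congr fun ξ => ?_
    by_cases hξ : ξ ∈ s' <;> simp [hξ]
  have e3 : ∫⁻ t : ℝ, (1 + ‖t‖ₑ) * ‖𝓕 u t‖ₑ = fourierMoment u 0 + fourierMoment u 1 := by
    rw [fourierMoment, fourierMoment, ← lintegral_add_left (by fun_prop)]
    refine lintegral_congr fun t => ?_
    ring
  have e4 : ∫⁻ η : ℝ, (ENNReal.ofReal c * ‖𝓕 f η‖ₑ) ^ 2 =
      ENNReal.ofReal (c ^ 2) * ∫⁻ x, ‖f x‖ₑ ^ 2 := by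
    rw [← sobolev_plancherel hf, ← lintegral_const_mul' _ _ ENNReal.ofReal_ne_top,
      ENNReal.ofReal_pow hc0]
    simp only [mul_pow]
  rwa [e1, e2, e3, e4] at h

/-- A dyadic sum of squared frequencies beyond the thresholds `A(L 2ⁿ)` is dominated by a weight `B`
that grows, from `A(x)` on, at least like a high power. -/
lemma tsum_dyadic_frequency_le {A B : ℝ≥0 → ℝ} (hAm : Monotone A) (hB0 : ∀ x, 0 ≤ B x) {M : ℕ}
    {L : ℝ≥0} (hL : 0 < L) (hAL : 1 ≤ A L)
    (hAB : ∀ x : ℝ≥0, L ≤ x → ∀ ξ : ℝ≥0, A x ≤ ξ → (x : ℝ) * (ξ / A x) ^ (M + 2) ≤ 2 * B ξ)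
    {ρ : ℝ} (hρ0 : 0 < ρ) (hρ1 : ρ < 1) (η : ℝ) :
    ∑' n : ℕ, {η : ℝ | A (L * 2 ^ n) / ρ < |η|}.indicator
      (fun η => ENNReal.ofReal (((L * 2 ^ n : ℝ≥0) / A (L * 2 ^ n)) ^ 2) * ‖η‖ₑ ^ 2) η ≤
      {η : ℝ | A L ≤ |η|}.indicator (fun η => ENNReal.ofReal (8 * ρ ^ M) * ‖B ‖η‖₊‖ₑ ^ 2) η := by
  have hmono : ∀ n : ℕ, L ≤ L * 2 ^ n := fun n => le_mul_of_one_le_right' (one_le_pow₀ one_le_two)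
  have hAn : ∀ n : ℕ, A L ≤ A (L * 2 ^ n) := fun n => hAm (hmono n)
  have hL' : (0 : ℝ) < L := hL
  by_cases hη : A L ≤ |η|
  swap
  · refine le_of_eq_of_le ?_ zero_le
    refine ENNReal.tsum_eq_zero.2 fun n => Set.indicator_of_notMem (fun h => hη ?_) _
    have h' : A (L * 2 ^ n) / ρ < |η| := h
    have h2 : A (L * 2 ^ n) ≤ A (L * 2 ^ n) / ρ := by
      rw [le_div_iff₀ hρ0]
      nlinarith [hAn n]
    linarith [hAn n]
  rw [Set.indicator_of_mem (by exact hη)]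
  set b := B ‖η‖₊ with hb
  have hb0 : 0 ≤ b := hB0 _
  -- each term is a small multiple of `L 2ⁿ`, and it vanishes unless `L 2ⁿ ≤ 2 b`
  have hterm : ∀ n : ℕ, {η : ℝ | A (L * 2 ^ n) / ρ < |η|}.indicator
      (fun η => ENNReal.ofReal (((L * 2 ^ n : ℝ≥0) / A (L * 2 ^ n)) ^ 2) * ‖η‖ₑ ^ 2) η ≤
      ENNReal.ofReal (2 * b * ρ ^ M) *
        (if (L : ℝ) * 2 ^ n ≤ 2 * b then ENNReal.ofReal (L * 2 ^ n) else 0) := by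
    intro n
    by_cases hn : A (L * 2 ^ n) / ρ < |η|
    swap
    · rw [Set.indicator_of_notMem (by exact hn)]; exact zero_le
    rw [Set.indicator_of_mem (by exact hn)]
    set α := A (L * 2 ^ n) with hα
    have hα1 : 1 ≤ α := hAL.trans (hAn n)
    have hα0 : 0 < α := by linarith
    set l : ℝ := (L : ℝ) * 2 ^ n with hl
    have hl0 : 0 < l := by positivity
    have hlc : ((L * 2 ^ n : ℝ≥0) : ℝ) = l := by push_cast; rfl
    rw [hlc]
    set v := |η| / α with hv
    have hv1 : 1 / ρ < v := by
      rw [hv, lt_div_iff₀ hα0]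
      calc 1 / ρ * α = α / ρ := by ring
        _ < _ := hn
    have hvρ : 1 < v * ρ := by rwa [div_lt_iff₀ hρ0] at hv1
    have hv0 : 0 < v := lt_trans (by positivity) hv1
    have hv1' : 1 ≤ v := by nlinarith
    have h1 : l * v ^ (M + 2) ≤ 2 * b := by
      have := hAB (L * 2 ^ n) (hmono n) ‖η‖₊ (by
        have : α ≤ α / ρ := by
          rw [le_div_iff₀ hρ0]
          nlinarith
        simpa using this.trans hn.le)
      rw [hlc] at this
      simpa using this
    have h2 : l ≤ 2 * b := le_trans (le_mul_of_one_le_right hl0.le (one_le_pow₀ hv1')) h1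
    rw [if_pos h2, ← ofReal_norm, ← ENNReal.ofReal_pow (norm_nonneg _), Real.norm_eq_abs,
      ← ENNReal.ofReal_mul (by positivity), ← ENNReal.ofReal_mul (by positivity)]
    refine ENNReal.ofReal_le_ofReal ?_
    have h3 : l * v ^ 2 ≤ 2 * b * ρ ^ M := by
      calc l * v ^ 2 ≤ l * v ^ 2 * (v * ρ) ^ M :=
            le_mul_of_one_le_right (by positivity) (one_le_pow₀ hvρ.le)
        _ = (l * v ^ (M + 2)) * ρ ^ M := by ring
        _ ≤ _ := by gcongr
    calc (l / α) ^ 2 * |η| ^ 2 = (l * v ^ 2) * l := by rw [hv]; ring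
      _ ≤ _ := by gcongr
  calc _ ≤ ∑' n : ℕ, ENNReal.ofReal (2 * b * ρ ^ M) *
        (if (L : ℝ) * 2 ^ n ≤ 2 * b then ENNReal.ofReal (L * 2 ^ n) else 0) :=
        ENNReal.tsum_le_tsum hterm
    _ ≤ ENNReal.ofReal (2 * b * ρ ^ M) * ENNReal.ofReal (2 * (2 * b)) := by
        rw [ENNReal.tsum_mul_left]
        gcongr
        exact tsum_geometric_truncated_le hL'
    _ = ENNReal.ofReal (8 * ρ ^ M) * ‖b‖ₑ ^ 2 := by
        rw [← ENNReal.ofReal_mul (by positivity), Real.enorm_of_nonneg hb0,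
          ← ENNReal.ofReal_pow hb0, ← ENNReal.ofReal_mul (by positivity)]
        congr 1; ring

/-- The dyadic pieces of `f` in space are controlled by the weighted frequency energy of `f`, with a
constant that decays geometrically in `M`, and by the norm of `f`. -/
lemma tsum_dyadic_pieces_le {A B : ℝ≥0 → ℝ} (hAm : Monotone A) (hB0 : ∀ x, 0 ≤ B x) {M : ℕ}
    {L : ℝ≥0} (hL : 1 ≤ L) (hAL : 1 ≤ A L)
    (hAB : ∀ x : ℝ≥0, L ≤ x → ∀ ξ : ℝ≥0, A x ≤ ξ → (x : ℝ) * (ξ / A x) ^ (M + 2) ≤ 2 * B ξ)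
    {ρ : ℝ} (hρ0 : 0 < ρ) (hρ1 : ρ < 1) {f : ℝ → ℂ} (hf : f ∈ fourierSobolev)
    (hloc : ∀ n : ℕ, ENNReal.ofReal (A (L * 2 ^ n) ^ 2) *
        ∫⁻ x, ‖annulusCutoff 2 (L * 2 ^ n) x * f x‖ₑ ^ 2 ≤ ENNReal.ofReal ((ρ ^ 4) ^ 2) *
      ∫⁻ ξ : ℝ, (‖ξ‖ₑ * ‖𝓕 (fun x => annulusCutoff 2 (L * 2 ^ n) x * f x) ξ‖ₑ) ^ 2) :
    ENNReal.ofReal (1 - ρ ^ 4) * ∑' n : ℕ, ENNReal.ofReal ((L * 2 ^ n) ^ 2) *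
        ∫⁻ x, ‖annulusCutoff 2 (L * 2 ^ n) x * f x‖ₑ ^ 2 ≤
      ENNReal.ofReal (16 * (fourierMoment (annulusCutoff 2 1) 0 +
        fourierMoment (annulusCutoff 2 1) 1).toReal ^ 2 * ρ ^ M) *
        (∫⁻ η in {η : ℝ | A L ≤ |η|}, (‖B ‖η‖₊‖ₑ * ‖𝓕 f η‖ₑ) ^ 2) +
      ENNReal.ofReal (4 * (fourierMoment (annulusCutoff 2 1) 2).toReal ^ 2 / (1 - ρ) ^ 4) *
        ∫⁻ x, ‖f x‖ₑ ^ 2 := by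
  set p := (fourierMoment (annulusCutoff 2 1) 0 + fourierMoment (annulusCutoff 2 1) 1).toReal with hp
  set q := (fourierMoment (annulusCutoff 2 1) 2).toReal with hq
  have hp' : fourierMoment (annulusCutoff 2 1) 0 + fourierMoment (annulusCutoff 2 1) 1 =
      ENNReal.ofReal p := by
    refine (ENNReal.ofReal_toReal ?_).symm
    have h0 := fourierMoment_annulusCutoff_lt_top one_lt_two one_pos 0
    have h1 := fourierMoment_annulusCutoff_lt_top one_lt_two one_pos 1
    finiteness
  have hq' : fourierMoment (annulusCutoff 2 1) 2 = ENNReal.ofReal q :=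
    (ENNReal.ofReal_toReal (fourierMoment_annulusCutoff_lt_top one_lt_two one_pos 2).ne).symm
  have hp0 : 0 ≤ p := ENNReal.toReal_nonneg
  have hq0 : 0 ≤ q := ENNReal.toReal_nonneg
  have hL0 : 0 < L := lt_of_lt_of_le one_pos hL
  have hL1 : (1 : ℝ) ≤ L := hL
  have h1ρ : 0 < 1 - ρ := by linarith
  have hρ4 : ρ ^ 4 < 1 := pow_lt_one₀ hρ0.le hρ1 (by norm_num)
  set E := ∫⁻ x, ‖f x‖ₑ ^ 2 with hE
  set α : ℕ → ℝ := fun n => A (L * 2 ^ n) with hα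
  set l : ℕ → ℝ := fun n => (L : ℝ) * 2 ^ n with hl
  have hmono : ∀ n : ℕ, L ≤ L * 2 ^ n := fun n => le_mul_of_one_le_right' (one_le_pow₀ one_le_two)
  have hα1 : ∀ n, 1 ≤ α n := fun n => hAL.trans (hAm (hmono n))
  have hl2 : ∀ n, 2 ^ n ≤ l n := fun n => le_mul_of_one_le_left (by positivity) hL1
  have hl1 : ∀ n, 1 ≤ l n := fun n => (one_le_pow₀ one_le_two).trans (hl2 n)
  set En : ℕ → ℝ≥0∞ := fun n => ∫⁻ x, ‖annulusCutoff 2 (l n) x * f x‖ₑ ^ 2 with hEn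
  set Hn : ℕ → ℝ≥0∞ := fun n => ∫⁻ η in {η : ℝ | α n / ρ < |η|}, (‖η‖ₑ * ‖𝓕 f η‖ₑ) ^ 2 with hHn
  have hpiece : ∀ n, ENNReal.ofReal (1 - ρ ^ 4) * (ENNReal.ofReal (l n ^ 2) * En n) ≤
      ENNReal.ofReal (2 * p ^ 2) * (ENNReal.ofReal ((l n / α n) ^ 2) * Hn n) +
      ENNReal.ofReal (2 * q ^ 2 / (1 - ρ) ^ 4) * (ENNReal.ofReal ((1 / 4) ^ n) * E) := by
    intro n
    have hln : 0 < l n := one_pos.trans_le (hl1 n)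
    have hαn : 0 < α n := one_pos.trans_le (hα1 n)
    have hlow := high_frequency_lower_bound (annulusCutoff_mul_mem one_lt_two hln hf) hαn hρ0 hρ1
      (hloc n)
    have hup := high_frequency_upper_bound (integrable_annulusCutoff one_lt_two hln) hf
      (hα1 n) hρ0 hρ1
    have hm01 : fourierMoment (annulusCutoff 2 (l n)) 0 + fourierMoment (annulusCutoff 2 (l n)) 1 ≤
        ENNReal.ofReal p := by
      rw [← hp', fourierMoment_annulusCutoff one_lt_two hln 0,
        fourierMoment_annulusCutoff one_lt_two hln 1]
      have : ∀ i, ENNReal.ofReal (l n ^ i)⁻¹ ≤ 1 := by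
        intro i
        rw [← ENNReal.ofReal_one]
        exact ENNReal.ofReal_le_ofReal (inv_le_one_of_one_le₀ (one_le_pow₀ (hl1 n)))
      gcongr
      · exact mul_le_of_le_one_left' (this 0)
      · exact mul_le_of_le_one_left' (this 1)
    have hm2 : fourierMoment (annulusCutoff 2 (l n)) 2 = ENNReal.ofReal (q / l n ^ 2) := by
      rw [fourierMoment_annulusCutoff one_lt_two hln 2, hq', ← ENNReal.ofReal_mul (by positivity)]
      congr 1
      ring
    have h := hlow.trans hup
    calc ENNReal.ofReal (1 - ρ ^ 4) * (ENNReal.ofReal (l n ^ 2) * En n)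
        = ENNReal.ofReal ((l n / α n) ^ 2) * (ENNReal.ofReal ((1 - ρ ^ 4) * α n ^ 2) * En n) := by
          rw [← mul_assoc, ← mul_assoc, ← ENNReal.ofReal_mul (by linarith),
            ← ENNReal.ofReal_mul (by positivity)]
          congr 2
          field_simp
      _ ≤ ENNReal.ofReal ((l n / α n) ^ 2) * (2 * (ENNReal.ofReal p ^ 2 * Hn n) +
          2 * (ENNReal.ofReal (q / l n ^ 2) ^ 2 *
            (ENNReal.ofReal (((1 - ρ) ^ 2 * α n)⁻¹ ^ 2) * E))) := by
          rw [← hm2]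
          gcongr
          refine h.trans ?_
          gcongr
      _ = ENNReal.ofReal (2 * p ^ 2) * (ENNReal.ofReal ((l n / α n) ^ 2) * Hn n) +
          ENNReal.ofReal (2 * (l n / α n) ^ 2 * (q / l n ^ 2) ^ 2 * ((1 - ρ) ^ 2 * α n)⁻¹ ^ 2) *
            E := by
          have h2 : (2 : ℝ≥0∞) = ENNReal.ofReal 2 := by simp
          rw [h2, ENNReal.ofReal_mul (by positivity), ENNReal.ofReal_mul (by positivity),
            ENNReal.ofReal_mul (by positivity), ENNReal.ofReal_mul (by positivity),
            ENNReal.ofReal_pow hp0, ENNReal.ofReal_pow (by positivity : 0 ≤ q / l n ^ 2)]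
          ring
      _ ≤ _ := by
          rw [← mul_assoc (ENNReal.ofReal (2 * q ^ 2 / (1 - ρ) ^ 4)),
            ← ENNReal.ofReal_mul (by positivity)]
          refine add_le_add le_rfl (mul_le_mul' (ENNReal.ofReal_le_ofReal ?_) le_rfl)
          have e1 : 2 * (l n / α n) ^ 2 * (q / l n ^ 2) ^ 2 * ((1 - ρ) ^ 2 * α n)⁻¹ ^ 2 =
              2 * q ^ 2 / (1 - ρ) ^ 4 * (1 / (l n ^ 2 * α n ^ 4)) := by
            field_simp
          rw [e1]
          gcongr
          rw [div_pow, one_pow]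
          gcongr
          calc (4 : ℝ) ^ n = (2 ^ n) ^ 2 * 1 := by
                rw [← pow_mul, mul_comm n 2, pow_mul]; norm_num
            _ ≤ _ := by
                gcongr
                · exact hl2 n
                · exact one_le_pow₀ (hα1 n)
  -- sum the high-frequency parts under the integral sign
  have hH : ∑' n, ENNReal.ofReal ((l n / α n) ^ 2) * Hn n ≤ ENNReal.ofReal (8 * ρ ^ M) *
      ∫⁻ η in {η : ℝ | A L ≤ |η|}, (‖B ‖η‖₊‖ₑ * ‖𝓕 f η‖ₑ) ^ 2 := by
    have hcf : Measurable fun t => ‖𝓕 f t‖ₑ := (sobolev_continuous_fourier hf).enorm.measurable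
    have hms : ∀ n, MeasurableSet {η : ℝ | α n / ρ < |η|} := fun n =>
      measurableSet_lt measurable_const continuous_abs.measurable
    have hmi : ∀ n, Measurable ({η : ℝ | α n / ρ < |η|}.indicator
        (fun η : ℝ => ENNReal.ofReal ((l n / α n) ^ 2) * ‖η‖ₑ ^ 2)) := fun n =>
      Measurable.indicator (by fun_prop) (hms n)
    calc ∑' n, ENNReal.ofReal ((l n / α n) ^ 2) * Hn n
        = ∑' n, ∫⁻ η, {η : ℝ | α n / ρ < |η|}.indicator
          (fun η : ℝ => ENNReal.ofReal ((l n / α n) ^ 2) * ‖η‖ₑ ^ 2) η * ‖𝓕 f η‖ₑ ^ 2 := by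
          congr with n
          simp only [hHn]
          rw [← lintegral_indicator (hms n), ← lintegral_const_mul' _ _ ENNReal.ofReal_ne_top]
          refine lintegral_congr fun η => ?_
          by_cases hη : η ∈ {η : ℝ | α n / ρ < |η|}
          · rw [Set.indicator_of_mem hη, Set.indicator_of_mem hη]; ring
          · rw [Set.indicator_of_notMem hη, Set.indicator_of_notMem hη]; simp
      _ = ∫⁻ η, (∑' n, {η : ℝ | α n / ρ < |η|}.indicator
          (fun η : ℝ => ENNReal.ofReal ((l n / α n) ^ 2) * ‖η‖ₑ ^ 2) η) * ‖𝓕 f η‖ₑ ^ 2 := by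
          simp only [← ENNReal.tsum_mul_right]
          exact (lintegral_tsum fun n => ((hmi n).mul (hcf.pow_const 2)).aemeasurable).symm
      _ ≤ ∫⁻ η, {η : ℝ | A L ≤ |η|}.indicator
          (fun η => ENNReal.ofReal (8 * ρ ^ M) * ‖B ‖η‖₊‖ₑ ^ 2) η * ‖𝓕 f η‖ₑ ^ 2 := by
          refine lintegral_mono fun η => ?_
          gcongr
          have := tsum_dyadic_frequency_le hAm hB0 hL0 hAL hAB hρ0 hρ1 η
          push_cast at this
          exact this
      _ = _ := by
          rw [← lintegral_const_mul' _ _ ENNReal.ofReal_ne_top, ← lintegral_indicator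
            (measurableSet_le measurable_const continuous_abs.measurable)]
          refine lintegral_congr fun η => ?_
          by_cases hη : η ∈ {η : ℝ | A L ≤ |η|}
          · rw [Set.indicator_of_mem hη, Set.indicator_of_mem hη]; ring
          · rw [Set.indicator_of_notMem hη, Set.indicator_of_notMem hη]; simp
  have hgeo : ∑' n : ℕ, ENNReal.ofReal ((1 / 4) ^ n) * E ≤ 2 * E := by
    rw [ENNReal.tsum_mul_right, ← ENNReal.ofReal_tsum_of_nonneg (fun n => by positivity)
      (summable_geometric_of_lt_one (by norm_num) (by norm_num)),
      tsum_geometric_of_lt_one (by norm_num) (by norm_num)]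
    gcongr
    rw [show (2 : ℝ≥0∞) = ENNReal.ofReal 2 by simp]
    exact ENNReal.ofReal_le_ofReal (by norm_num)
  calc _ = ∑' n, ENNReal.ofReal (1 - ρ ^ 4) * (ENNReal.ofReal (l n ^ 2) * En n) :=
        ENNReal.tsum_mul_left.symm
    _ ≤ _ := ENNReal.tsum_le_tsum hpiece
    _ = ENNReal.ofReal (2 * p ^ 2) * (∑' n, ENNReal.ofReal ((l n / α n) ^ 2) * Hn n) +
      ENNReal.ofReal (2 * q ^ 2 / (1 - ρ) ^ 4) * ∑' n : ℕ, ENNReal.ofReal ((1 / 4) ^ n) * E := by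
        rw [ENNReal.tsum_add, ENNReal.tsum_mul_left, ENNReal.tsum_mul_left]
    _ ≤ ENNReal.ofReal (2 * p ^ 2) * (ENNReal.ofReal (8 * ρ ^ M) *
        ∫⁻ η in {η : ℝ | A L ≤ |η|}, (‖B ‖η‖₊‖ₑ * ‖𝓕 f η‖ₑ) ^ 2) +
        ENNReal.ofReal (2 * q ^ 2 / (1 - ρ) ^ 4) * (2 * E) := by gcongr
    _ = _ := by
        rw [← mul_assoc, ← mul_assoc, ← ENNReal.ofReal_mul (by positivity),
          show (2 : ℝ≥0∞) = ENNReal.ofReal 2 by simp, ← ENNReal.ofReal_mul (by positivity)]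
        congr 3
        · ring
        · ring

/-- A weight that dominates `|ξ|` from `R` on controls the frequency moment. -/
lemma frequency_moment_le {F : ℝ → ℂ} {B : ℝ≥0 → ℝ} {R c : ℝ} (hR : 0 ≤ R) (hc : 0 ≤ c)
    (h : ∀ ξ : ℝ, R ≤ |ξ| → |ξ| ≤ c * B ‖ξ‖₊) :
    ∫⁻ ξ : ℝ, (‖ξ‖ₑ * ‖F ξ‖ₑ) ^ 2 ≤ ENNReal.ofReal (R ^ 2) * (∫⁻ ξ, ‖F ξ‖ₑ ^ 2) +
      ENNReal.ofReal (c ^ 2) * ∫⁻ ξ in {ξ : ℝ | R ≤ |ξ|}, (‖B ‖ξ‖₊‖ₑ * ‖F ξ‖ₑ) ^ 2 := by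
  have hms : MeasurableSet {ξ : ℝ | R ≤ |ξ|} :=
    measurableSet_le measurable_const continuous_abs.measurable
  rw [← lintegral_add_compl _ hms, add_comm]
  refine add_le_add ?_ ?_
  · refine le_trans ?_ (mul_le_mul_right (setLIntegral_le_lintegral {ξ : ℝ | R ≤ |ξ|}ᶜ _) _)
    rw [← lintegral_const_mul' _ _ ENNReal.ofReal_ne_top]
    refine setLIntegral_mono' hms.compl fun ξ hξ => ?_
    have hξ' : |ξ| < R := not_le.1 hξ
    rw [mul_pow, ENNReal.ofReal_pow hR, Real.enorm_eq_ofReal_abs]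
    gcongr
  · rw [← lintegral_const_mul' _ _ ENNReal.ofReal_ne_top]
    refine setLIntegral_mono' hms fun ξ hξ => ?_
    rw [ENNReal.ofReal_pow hc, ← mul_pow, ← mul_assoc, Real.enorm_eq_ofReal_abs ξ]
    gcongr
    refine (ENNReal.ofReal_le_ofReal ((h ξ hξ).trans
      (mul_le_mul_of_nonneg_left (le_abs_self _) hc))).trans ?_
    rw [ENNReal.ofReal_mul hc, Real.enorm_eq_ofReal_abs (B _)]

/-- The fourth power leaves room for the losses in the frequency localization. -/
lemma exists_two_mul_lt_pow_four {b : ℝ} (hb : b < 1 / 2) :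
    ∃ ρ : ℝ, 0 < ρ ∧ ρ < 1 ∧ 2 * b < ρ ^ 4 := by
  have hm : max (2 * b) 0 < 1 := max_lt (by linarith) one_pos
  have h0 := le_max_right (2 * b) 0
  refine ⟨1 + -(1 - max (2 * b) 0) / 8, by linarith, by linarith, ?_⟩
  refine lt_of_lt_of_le ?_ (one_add_mul_le_pow (by linarith) 4)
  push_cast
  linarith [le_max_left (2 * b) 0]

/-- Finite-dimensionality when the weight `B` on the frequency side grows, beyond `A(x)`, faster than
`x` times every power of the ratio `ξ / A(x)`. -/
theorem finiteDimensional_of_superpolynomial {A B : ℝ≥0 → ℝ} (hAm : Monotone A) (hBm : Monotone B)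
    (hA0 : ∀ x, 0 ≤ A x) (hB0 : ∀ x, 0 ≤ B x) (hAt : Tendsto A atTop atTop)
    (hAB : ∀ N : ℕ, ∃ X₀ : ℝ≥0, ∀ x, X₀ ≤ x → ∀ ξ : ℝ≥0, A x ≤ ξ →
      (x : ℝ) * (ξ / A x) ^ N ≤ 2 * B ξ)
    {lam mu : ℤ → ℝ} (hlam : IsOrderedSeq lam) (hmu : IsOrderedSeq mu) {b : ℝ} (hb : b < 1 / 2)
    (hlg : ∀ᶠ j : ℤ in cofinite, A (max ‖lam j‖₊ ‖lam (j + 1)‖₊) * (lam (j + 1) - lam j) ≤ b)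
    (hmg : ∀ᶠ j : ℤ in cofinite, B (max ‖mu j‖₊ ‖mu (j + 1)‖₊) * (mu (j + 1) - mu j) ≤ b) :
    FiniteDimensional ℂ (vanishingSpace (Set.range lam) (Set.range mu)) := by
  obtain ⟨ρ, hρ0, hρ1, hbρ⟩ := exists_two_mul_lt_pow_four hb
  have hρ4 : 0 < ρ ^ 4 := by positivity
  have hρ41 : ρ ^ 4 < 1 := pow_lt_one₀ hρ0.le hρ1 (by norm_num)
  obtain ⟨R₁, hR₁, hW₁⟩ := weighted_wirtinger hlam hAm hA0 hρ4 hbρ hlg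
  obtain ⟨R₂, hR₂, hW₂⟩ := weighted_wirtinger hmu hBm hB0 hρ4 hbρ hmg
  set p := (fourierMoment (annulusCutoff 2 1) 0 + fourierMoment (annulusCutoff 2 1) 1).toReal with hp
  set q := (fourierMoment (annulusCutoff 2 1) 2).toReal with hq
  -- the high frequencies, weighted by `ρ ^ M`, contribute at most half of the second moment
  obtain ⟨M, hM⟩ : ∃ M : ℕ, 16 * (16 * p ^ 2 * ρ ^ M) / (1 - ρ ^ 4) ≤ 1 / 2 := by
    have ht : Tendsto (fun M : ℕ => 16 * (16 * p ^ 2 * ρ ^ M) / (1 - ρ ^ 4)) atTop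
        (𝓝 (16 * (16 * p ^ 2 * 0) / (1 - ρ ^ 4))) :=
      (((tendsto_pow_atTop_nhds_zero_of_lt_one hρ0.le hρ1).const_mul _).const_mul _).div_const _
    simp only [mul_zero, zero_div] at ht
    exact (ht.eventually_le_const (by norm_num)).exists
  obtain ⟨X₀, hX₀⟩ := hAB (M + 2)
  obtain ⟨X₁, hX₁⟩ := hAB 1
  obtain ⟨L, hLA, hLX, hL1, hLR, hLX1⟩ : ∃ L : ℝ≥0, max 1 R₂ ≤ A L ∧ X₀ ≤ L ∧ 1 ≤ L ∧
      R₁.toNNReal ≤ L ∧ X₁ ≤ L :=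
    ((hAt.eventually_ge_atTop (max 1 R₂)).and ((eventually_ge_atTop X₀).and
      ((eventually_ge_atTop 1).and ((eventually_ge_atTop _).and (eventually_ge_atTop X₁))))).exists
  have hAL1 : 1 ≤ A L := (le_max_left _ _).trans hLA
  have hAL2 : R₂ ≤ A L := (le_max_right _ _).trans hLA
  have hL0 : 0 < L := one_pos.trans_le hL1
  have hL0' : (0 : ℝ) < L := hL0
  -- constants for the low frequencies, the second moment and the frequency moment
  set c := 4 * q ^ 2 / (1 - ρ) ^ 4 with hc
  have hc0 : 0 ≤ c := by
    have : 0 < 1 - ρ := by linarith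
    positivity
  set C₁ := 16 * c / (1 - ρ ^ 4) with hC₁
  have hC₁0 : 0 ≤ C₁ := div_nonneg (by positivity) (by linarith)
  set C₂ := ((2 * L : ℝ) ^ 2 + C₁) / (1 - 1 / 2) with hC₂
  have hC₂0 : 0 < C₂ := div_pos (by positivity) (by norm_num)
  set C₃ := A L ^ 2 + (2 * A L / L) ^ 2 * C₂ with hC₃
  have key : ∀ f ∈ vanishingSpace (Set.range lam) (Set.range mu),
      (∫⁻ x : ℝ, (‖x‖ₑ * ‖f x‖ₑ) ^ 2 ≤ ENNReal.ofReal C₂ * ∫⁻ x, ‖f x‖ₑ ^ 2) ∧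
      (∫⁻ ξ : ℝ, (‖ξ‖ₑ * ‖𝓕 f ξ‖ₑ) ^ 2 ≤ ENNReal.ofReal C₃ * ∫⁻ x, ‖f x‖ₑ ^ 2) := by
    rintro f ⟨hf, hfl, hfm⟩
    have hzl : ∀ j, f (lam j) = 0 := fun j => hfl _ ⟨j, rfl⟩
    have hzm : ∀ j, 𝓕 f (mu j) = 0 := fun j => hfm _ ⟨j, rfl⟩
    set E := ∫⁻ x, ‖f x‖ₑ ^ 2 with hE
    set X := ∫⁻ x : ℝ, (‖x‖ₑ * ‖f x‖ₑ) ^ 2 with hX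
    have hH : ∫⁻ η in {η : ℝ | A L ≤ |η|}, (‖B ‖η‖₊‖ₑ * ‖𝓕 f η‖ₑ) ^ 2 ≤ X := by
      refine (lintegral_mono_set fun η hη => ?_).trans ((hW₂ f (sobolev_integrable hf) hzm).trans ?_)
      · exact hAL2.trans hη
      · refine mul_le_of_le_one_left' ?_
        rw [← ENNReal.ofReal_one]
        exact ENNReal.ofReal_le_ofReal (pow_le_one₀ hρ4.le hρ41.le)
    have hmono : ∀ n : ℕ, L ≤ L * 2 ^ n := fun n =>
      le_mul_of_one_le_right' (one_le_pow₀ one_le_two)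
    have hsum := tsum_dyadic_pieces_le (M := M) hAm hB0 hL1 hAL1
      (fun x hx => hX₀ x (hLX.trans hx)) hρ0 hρ1 hf (fun n => by
        have h := local_frequency_bound hAm hA0 hW₁ one_lt_two (L := L * 2 ^ n) (by positivity)
          ((Real.le_coe_toNNReal R₁).trans (NNReal.coe_le_coe.2 (hLR.trans (hmono n)))) hf hzl
        push_cast at h
        exact h)
    have hout := lintegral_outer_le_tsum one_lt_two hL0' (sobolev_continuous hf)
    have houter : ∫⁻ x in {x : ℝ | 2 * (L : ℝ) ≤ |x|}, (‖x‖ₑ * ‖f x‖ₑ) ^ 2 ≤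
        ENNReal.ofReal (1 / 2) * X + ENNReal.ofReal C₁ * E := by
      set s := ∑' n : ℕ, ENNReal.ofReal ((L * 2 ^ n) ^ 2) *
        ∫⁻ x, ‖annulusCutoff 2 (L * 2 ^ n) x * f x‖ₑ ^ 2 with hs
      have h1 : 0 < 1 - ρ ^ 4 := by linarith
      calc _ ≤ ENNReal.ofReal (2 ^ 4) * s := hout
        _ = ENNReal.ofReal (16 / (1 - ρ ^ 4)) * (ENNReal.ofReal (1 - ρ ^ 4) * s) := by
            rw [← mul_assoc, ← ENNReal.ofReal_mul (by positivity), div_mul_cancel₀ _ h1.ne']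
            norm_num
        _ ≤ ENNReal.ofReal (16 / (1 - ρ ^ 4)) * (ENNReal.ofReal (16 * p ^ 2 * ρ ^ M) * X +
            ENNReal.ofReal c * E) := by
            refine mul_le_mul_right (hsum.trans ?_) _
            gcongr
        _ = ENNReal.ofReal (16 * (16 * p ^ 2 * ρ ^ M) / (1 - ρ ^ 4)) * X +
            ENNReal.ofReal C₁ * E := by
            rw [mul_add, ← mul_assoc, ← mul_assoc, ← ENNReal.ofReal_mul (by positivity),
              ← ENNReal.ofReal_mul (by positivity), hC₁]
            congr 3 <;> ring
        _ ≤ _ := by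
            gcongr
    have hXE := moment_le_of_outer_le (by norm_num) (by norm_num) hC₁0
      (lintegral_weighted_lt_top hf.2.1).2 (sobolev_norm_lt_top hf) houter
    refine ⟨hXE, ?_⟩
    refine (frequency_moment_le (B := B) (c := 2 * A L / L) (hA0 L) (by have := hA0 L; positivity)
      fun ξ hξ => ?_).trans ?_
    · have h := hX₁ L hLX1 ‖ξ‖₊ (by simpa using hξ)
      rw [pow_one, coe_nnnorm, Real.norm_eq_abs] at h
      have : |ξ| = (L * (|ξ| / A L)) * (A L / L) := by
        field_simp
      rw [this]
      calc _ ≤ 2 * B ‖ξ‖₊ * (A L / L) := by gcongr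
        _ = _ := by ring
    · rw [sobolev_plancherel hf, hC₃, ENNReal.ofReal_add (by positivity) (by positivity), add_mul]
      refine add_le_add le_rfl ?_
      rw [ENNReal.ofReal_mul (by positivity), mul_assoc]
      exact mul_le_mul_right (hH.trans hXE) _
  refine finiteDimensional_of_moments (C := max C₂ C₃) (fun f hf => hf.1) (lt_max_of_lt_left hC₂0)
    (fun f hf => (key f hf).1.trans ?_) (fun f hf => (key f hf).2.trans ?_)
  · gcongr; exact le_max_left _ _
  · gcongr; exact le_max_right _ _

/-! ### Power weights -/

lemma lintegral_lt_top_of_memLp_two {h : ℝ → ℂ} (hh : MemLp h 2) : ∫⁻ x, ‖h x‖ₑ ^ 2 < ⊤ := by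
  rw [← eLpNorm_two_sq]
  exact ENNReal.pow_lt_top hh.2

lemma continuous_fourier_of_hasCompactSupport {u : ℝ → ℂ} (hu : Continuous u)
    (huc : HasCompactSupport u) : Continuous (𝓕 u) ∧ MemLp (𝓕 u) 2 := by
  have hi := hu.integrable_of_hasCompactSupport huc (μ := volume)
  have hc := fourier_continuous_of_integrable hi
  refine ⟨hc, memLp_two_of_lintegral_lt_top hc.aestronglyMeasurable ?_⟩
  have hm : MemLp u 2 := hu.memLp_of_hasCompactSupport huc
  rw [lintegral_enorm_sq_fourier hi hm]
  exact lintegral_lt_top_of_memLp_two hm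

lemma integrable_conv_of_memLp_two {K h : ℝ → ℂ} (hK : MemLp K 2) (hh : MemLp h 2) (ξ : ℝ) :
    Integrable fun η => K (ξ - η) * h η :=
  (hK.comp_measurePreserving (Measure.measurePreserving_sub_left volume ξ)).integrable_mul hh

/-- Bessel's inequality for cutoffs with `∑ |uₙ|² ≤ 1`, applied to an integrable function on the
frequency side: multiplication by `uₙ` becomes convolution with `𝓕 uₙ`. -/
lemma sum_lintegral_conv_sq_le_of_integrable {u : ℕ → ℝ → ℂ} (hu : ∀ n, Continuous (u n))
    (huc : ∀ n, HasCompactSupport (u n)) (hsum : ∀ x, ∑' n, ‖u n x‖ₑ ^ 2 ≤ 1) {h : ℝ → ℂ}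
    (hh : Integrable h) (hh2 : MemLp h 2) (s : Finset ℕ) :
    ∑ n ∈ s, ∫⁻ ξ, ‖∫ η, 𝓕 (u n) (ξ - η) * h η‖ₑ ^ 2 ≤ ∫⁻ η, ‖h η‖ₑ ^ 2 := by
  set H := 𝓕 fun η => h (-η) with hH
  have hHc : Continuous H := fourier_continuous_of_integrable hh.comp_neg
  have hh2' : MemLp (fun η => h (-η)) 2 :=
    hh2.comp_measurePreserving (Measure.measurePreserving_neg volume)
  calc ∑ n ∈ s, ∫⁻ ξ, ‖∫ η, 𝓕 (u n) (ξ - η) * h η‖ₑ ^ 2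
      = ∑ n ∈ s, ∫⁻ x, ‖u n x‖ₑ ^ 2 * ‖H x‖ₑ ^ 2 := by
        refine Finset.sum_congr rfl fun n _ => ?_
        have hc : Continuous fun x => u n x * H x := (hu n).mul hHc
        have hs : HasCompactSupport fun x => u n x * H x := (huc n).mul_right
        simp only [← fourier_mul_fourier_neg_eq_conv
          ((hu n).integrable_of_hasCompactSupport (huc n)) hh]
        rw [lintegral_enorm_sq_fourier (hc.integrable_of_hasCompactSupport hs)
          (hc.memLp_of_hasCompactSupport hs)]
        simp only [enorm_mul, mul_pow]
    _ = ∫⁻ x, (∑ n ∈ s, ‖u n x‖ₑ ^ 2) * ‖H x‖ₑ ^ 2 := by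
        rw [← lintegral_finsetSum]
        · simp only [Finset.sum_mul]
        · intro n _
          have := (hu n).measurable
          have := hHc.measurable
          fun_prop
    _ ≤ ∫⁻ x, ‖H x‖ₑ ^ 2 := by
        refine lintegral_mono fun x => mul_le_of_le_one_left' ?_
        exact (ENNReal.sum_le_tsum s).trans (hsum x)
    _ = ∫⁻ η, ‖h (-η)‖ₑ ^ 2 := lintegral_enorm_sq_fourier hh.comp_neg hh2'
    _ = _ := (Measure.measurePreserving_neg (volume : Measure ℝ)).lintegral_comp_emb
        (MeasurableEquiv.neg ℝ).measurableEmbedding fun η => ‖h η‖ₑ ^ 2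

/-- The same inequality for square-integrable `h`, by truncation and Fatou's lemma. -/
theorem tsum_lintegral_conv_sq_le {u : ℕ → ℝ → ℂ} (hu : ∀ n, Continuous (u n))
    (huc : ∀ n, HasCompactSupport (u n)) (hsum : ∀ x, ∑' n, ‖u n x‖ₑ ^ 2 ≤ 1) {h : ℝ → ℂ}
    (hhc : Continuous h) (hh2 : MemLp h 2) :
    ∑' n, ∫⁻ ξ, ‖∫ η, 𝓕 (u n) (ξ - η) * h η‖ₑ ^ 2 ≤ ∫⁻ η, ‖h η‖ₑ ^ 2 := by
  rw [ENNReal.tsum_eq_iSup_sum]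
  refine iSup_le fun s => ?_
  set k : ℕ → ℝ → ℂ := fun N => (Set.Icc (-N : ℝ) N).indicator h with hk
  have hkm : ∀ N, AEStronglyMeasurable (k N) := fun N =>
    hhc.aestronglyMeasurable.indicator measurableSet_Icc
  have hk1 : ∀ N, Integrable (k N) := fun N =>
    (hhc.integrableOn_Icc).integrable_indicator measurableSet_Icc
  have hk2 : ∀ N, MemLp (k N) 2 := fun N => hh2.indicator measurableSet_Icc
  have hcont : ∀ n N, Continuous fun ξ => ∫ η, 𝓕 (u n) (ξ - η) * k N η := by
    intro n N
    simp only [← fourier_mul_fourier_neg_eq_conv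
      ((hu n).integrable_of_hasCompactSupport (huc n)) (hk1 N)]
    refine fourier_continuous_of_integrable ?_
    exact ((hu n).mul (fourier_continuous_of_integrable
      (hk1 N).comp_neg)).integrable_of_hasCompactSupport (huc n).mul_right
  have hlim : ∀ n ξ, Tendsto (fun N => ∫ η, 𝓕 (u n) (ξ - η) * k N η) atTop
      (𝓝 (∫ η, 𝓕 (u n) (ξ - η) * h η)) := by
    intro n ξ
    obtain ⟨hc, hm⟩ := continuous_fourier_of_hasCompactSupport (hu n) (huc n)
    refine tendsto_integral_of_dominated_convergence (fun η => ‖𝓕 (u n) (ξ - η) * h η‖)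
      (fun N => ?_) (integrable_conv_of_memLp_two hm hh2 ξ).norm (fun N => ?_) ?_
    · exact (by fun_prop : Continuous fun η => 𝓕 (u n) (ξ - η)).aestronglyMeasurable.mul (hkm N)
    · refine Eventually.of_forall fun η => ?_
      rw [norm_mul, norm_mul]
      gcongr
      exact norm_indicator_le_norm_self _ _
    · refine Eventually.of_forall fun η => Tendsto.const_mul _ ?_
      refine tendsto_const_nhds.congr' ?_
      obtain ⟨N₀, hN₀⟩ := exists_nat_ge |η|
      filter_upwards [eventually_ge_atTop N₀] with N hN
      have h1 : |η| ≤ N := hN₀.trans (by exact_mod_cast hN)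
      rw [hk]
      exact (Set.indicator_of_mem (Set.mem_Icc.2 (abs_le.1 h1)) h).symm
  calc ∑ n ∈ s, ∫⁻ ξ, ‖∫ η, 𝓕 (u n) (ξ - η) * h η‖ₑ ^ 2
      = ∑ n ∈ s, ∫⁻ ξ, liminf (fun N => ‖∫ η, 𝓕 (u n) (ξ - η) * k N η‖ₑ ^ 2) atTop := by
        refine Finset.sum_congr rfl fun n _ => lintegral_congr fun ξ => ?_
        exact ((ENNReal.continuous_pow 2).tendsto _ |>.comp (hlim n ξ).enorm).liminf_eq.symm
    _ = ∫⁻ ξ, liminf (fun N => ∑ n ∈ s, ‖∫ η, 𝓕 (u n) (ξ - η) * k N η‖ₑ ^ 2) atTop := by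
        rw [← lintegral_finsetSum]
        · refine lintegral_congr fun ξ => ?_
          have h1 : ∀ n, Tendsto (fun N => ‖∫ η, 𝓕 (u n) (ξ - η) * k N η‖ₑ ^ 2) atTop
              (𝓝 (‖∫ η, 𝓕 (u n) (ξ - η) * h η‖ₑ ^ 2)) := fun n =>
            (ENNReal.continuous_pow 2).tendsto _ |>.comp (hlim n ξ).enorm
          rw [(tendsto_finsetSum s fun n _ => h1 n).liminf_eq]
          exact Finset.sum_congr rfl fun n _ => (h1 n).liminf_eq
        · intro n _
          exact Measurable.liminf fun N => (hcont n N).enorm.measurable.pow_const 2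
    _ ≤ liminf (fun N => ∫⁻ ξ, ∑ n ∈ s, ‖∫ η, 𝓕 (u n) (ξ - η) * k N η‖ₑ ^ 2) atTop :=
        lintegral_liminf_le fun N => Finset.measurable_fun_sum _ fun n _ =>
          (hcont n N).enorm.measurable.pow_const 2
    _ ≤ _ := by
        refine liminf_le_of_le (by isBoundedDefault) fun b hb => ?_
        obtain ⟨N, hN⟩ := hb.exists
        refine hN.trans ?_
        rw [lintegral_finsetSum _ fun n _ => (hcont n N).enorm.measurable.pow_const 2]
        refine (sum_lintegral_conv_sq_le_of_integrable hu huc hsum (hk1 N) (hk2 N) s).trans ?_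
        refine lintegral_mono fun η => ?_
        gcongr
        exact enorm_indicator_le_enorm_self _ _

lemma rpow_sub_rpow_le {r : ℝ} (hr : 1 ≤ r) {x y : ℝ} (hy : 0 ≤ y) (hyx : y ≤ x) :
    x ^ r - y ^ r ≤ r * (x - y) * x ^ (r - 1) := by
  rcases (hy.trans hyx).eq_or_lt with h0 | hx
  · have : y = 0 := le_antisymm (h0 ▸ hyx) hy
    subst this
    simp [← h0]
  have h := one_add_mul_self_le_rpow_one_add (s := y / x - 1)
    (by have := div_nonneg hy hx.le; linarith) hr
  rw [add_sub_cancel, Real.div_rpow hy hx.le] at h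
  have hxr : 0 < x ^ r := Real.rpow_pos_of_pos hx r
  rw [le_div_iff₀ hxr] at h
  rw [Real.rpow_sub_one hx.ne']
  have e : r * (y / x - 1) * x ^ r = - (r * (x - y) * (x ^ r / x)) := by field_simp; ring
  nlinarith

/-- The oscillation of a power weight, in terms of the increment and one of the two values. -/
lemma exists_power_weight_sub_le {r c : ℝ} (hr : 1 ≤ r) (hc : 0 < c) : ∃ (K : ℝ) (k : ℕ), 0 ≤ K ∧
    ∀ ξ η : ℝ, |c * |ξ| ^ r - c * |η| ^ r| ≤
      K * (|ξ - η| + |ξ - η| ^ (k + 1)) * (1 + c * |η| ^ r) := by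
  refine ⟨c * r * (2 ^ ⌈r⌉₊ * 2 ^ r) * (1 + c⁻¹), ⌈r⌉₊, by positivity, fun ξ η => ?_⟩
  set k := ⌈r⌉₊
  set t := |ξ - η| with ht
  have ht0 : 0 ≤ t := abs_nonneg _
  set m := max |ξ| |η| with hm
  have h1 : |(|ξ| ^ r - |η| ^ r)| ≤ r * t * m ^ (r - 1) := by
    have hm0 : |ξ| ≤ m := le_max_left _ _
    have hm1 : |η| ≤ m := le_max_right _ _
    have ha : abs (|ξ| - |η|) ≤ t := abs_abs_sub_abs_le_abs_sub ξ η
    rw [abs_le] at ha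
    have hr0 : 0 ≤ r - 1 := by linarith
    have hb : ∀ z : ℝ, 0 ≤ z → z ≤ m → z ^ (r - 1) ≤ m ^ (r - 1) := fun z hz hzm =>
      Real.rpow_le_rpow hz hzm hr0
    rcases le_total |η| |ξ| with h | h
    · rw [abs_of_nonneg (sub_nonneg.2 (Real.rpow_le_rpow (abs_nonneg _) h (by linarith)))]
      refine (rpow_sub_rpow_le hr (abs_nonneg _) h).trans ?_
      gcongr
      · exact ha.2
    · rw [abs_sub_comm,
        abs_of_nonneg (sub_nonneg.2 (Real.rpow_le_rpow (abs_nonneg _) h (by linarith)))]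
      refine (rpow_sub_rpow_le hr (abs_nonneg _) h).trans ?_
      gcongr
      · linarith [ha.1]
  have h2 : m ^ (r - 1) ≤ (1 + t) ^ k * (1 + |η|) ^ r := by
    have hη := abs_nonneg η
    have hm' : m ≤ (1 + t) * (1 + |η|) := by
      refine max_le ?_ ?_
      · have : |ξ| ≤ t + |η| := by simpa using abs_add_le (ξ - η) η
        nlinarith
      · nlinarith
    have hm0 : 0 ≤ m := (abs_nonneg ξ).trans (le_max_left _ _)
    calc m ^ (r - 1) ≤ ((1 + t) * (1 + |η|)) ^ (r - 1) :=
          Real.rpow_le_rpow hm0 hm' (by linarith)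
      _ ≤ ((1 + t) * (1 + |η|)) ^ r :=
          Real.rpow_le_rpow_of_exponent_le (by nlinarith) (by linarith)
      _ = (1 + t) ^ r * (1 + |η|) ^ r := Real.mul_rpow (by linarith) (by linarith)
      _ ≤ (1 + t) ^ (k : ℝ) * (1 + |η|) ^ r := by
          gcongr
          · linarith
          · exact Nat.le_ceil r
      _ = _ := by rw [Real.rpow_natCast]
  have h3 : (1 + t) ^ k ≤ 2 ^ k * (1 + t ^ k) := by
    have h := add_pow_le zero_le_one ht0 k
    rw [one_pow] at h
    refine h.trans ?_
    gcongr
    · norm_num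
    · omega
  have h4 : (1 + |η|) ^ r ≤ 2 ^ r * (1 + |η| ^ r) := by
    have hη := abs_nonneg η
    rcases le_total |η| 1 with h | h
    · calc (1 + |η|) ^ r ≤ 2 ^ r := by
            refine Real.rpow_le_rpow (by linarith) (by linarith) (by linarith)
        _ ≤ _ := le_mul_of_one_le_right (by positivity) (by
            have : 0 ≤ |η| ^ r := by positivity
            linarith)
    · calc (1 + |η|) ^ r ≤ (2 * |η|) ^ r :=
            Real.rpow_le_rpow (by linarith) (by linarith) (by linarith)
        _ = 2 ^ r * |η| ^ r := Real.mul_rpow (by norm_num) hη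
        _ ≤ _ := by gcongr; linarith
  have h5 : 1 + |η| ^ r ≤ (1 + c⁻¹) * (1 + c * |η| ^ r) := by
    have : 0 ≤ |η| ^ r := by positivity
    have hci : 0 < c⁻¹ := by positivity
    have : c⁻¹ * (c * |η| ^ r) = |η| ^ r := by field_simp
    have : 0 ≤ c * |η| ^ r := by positivity
    nlinarith
  rw [← mul_sub, abs_mul, abs_of_pos hc]
  calc c * |(|ξ| ^ r - |η| ^ r)| ≤ c * (r * t * ((2 ^ k * (1 + t ^ k)) *
        (2 ^ r * ((1 + c⁻¹) * (1 + c * |η| ^ r))))) := by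
        refine mul_le_mul_of_nonneg_left (h1.trans ?_) hc.le
        refine mul_le_mul_of_nonneg_left (h2.trans ?_) (by positivity)
        have : (0:ℝ) ≤ 2 ^ r := by positivity
        gcongr
        exact h4.trans (by gcongr)
    _ = _ := by ring

/-- Multiplication by a cutoff almost commutes with a slowly varying weight on the frequency
side. -/
lemma weighted_fourier_mul_le {u f : ℝ → ℂ} (hu : Continuous u) (huc : HasCompactSupport u)
    (hf : f ∈ fourierSobolev) {β : ℝ → ℝ} (hβ : Continuous β) (hβ0 : ∀ ξ, 0 ≤ β ξ) {K : ℝ}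
    (hK : 0 ≤ K) {k : ℕ} (hβs : ∀ ξ η, |β ξ - β η| ≤ K * (|ξ - η| + |ξ - η| ^ (k + 1)) * (1 + β η))
    (hh : MemLp (fun η => (β η : ℂ) * 𝓕 f η) 2) {δ : ℝ} (hδ : 0 < δ) :
    ∫⁻ ξ, (‖β ξ‖ₑ * ‖𝓕 (fun x => u x * f x) ξ‖ₑ) ^ 2 ≤
      ENNReal.ofReal (1 + δ) * (∫⁻ ξ, ‖∫ η, 𝓕 u (ξ - η) * (β η * 𝓕 f η)‖ₑ ^ 2) +
      ENNReal.ofReal (1 + δ⁻¹) *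
        ((ENNReal.ofReal K * (fourierMoment u 1 + fourierMoment u (k + 1))) ^ 2 *
        (2 * (∫⁻ x, ‖f x‖ₑ ^ 2) + 2 * ∫⁻ η, (‖β η‖ₑ * ‖𝓕 f η‖ₑ) ^ 2)) := by
  obtain ⟨huF, huF2⟩ := continuous_fourier_of_hasCompactSupport hu huc
  have hui := hu.integrable_of_hasCompactSupport huc (μ := volume)
  have hfF := sobolev_continuous_fourier hf
  have hfF2 : MemLp (𝓕 f) 2 := memLp_two_of_lintegral_lt_top hfF.aestronglyMeasurable (by
    rw [sobolev_plancherel hf]; exact sobolev_norm_lt_top hf)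
  set κ : ℝ → ℝ≥0∞ := fun t => ENNReal.ofReal K * ((‖t‖ₑ + ‖t‖ₑ ^ (k + 1)) * ‖𝓕 u t‖ₑ) with hκ
  set F : ℝ → ℝ≥0∞ := fun η => (1 + ‖β η‖ₑ) * ‖𝓕 f η‖ₑ with hF
  have mu : Measurable (𝓕 u) := huF.measurable
  have mf : Measurable (𝓕 f) := hfF.measurable
  have mβ : Measurable β := hβ.measurable
  have hκm : Measurable κ := by fun_prop
  have hFm : Measurable F := by fun_prop
  have hpt : ∀ ξ, ‖β ξ‖ₑ * ‖𝓕 (fun x => u x * f x) ξ‖ₑ ≤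
      ‖∫ η, 𝓕 u (ξ - η) * (β η * 𝓕 f η)‖ₑ + ∫⁻ η, κ (ξ - η) * F η := by
    intro ξ
    have i1 : Integrable fun η => (β ξ : ℂ) * (𝓕 u (ξ - η) * 𝓕 f η) :=
      (integrable_conv_of_memLp_two huF2 hfF2 ξ).const_mul _
    have i2 : Integrable fun η => 𝓕 u (ξ - η) * (β η * 𝓕 f η) :=
      integrable_conv_of_memLp_two huF2 hh ξ
    have e : (β ξ : ℂ) * 𝓕 (fun x => u x * f x) ξ = (∫ η, 𝓕 u (ξ - η) * (β η * 𝓕 f η)) +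
        ∫ η, ((β ξ : ℂ) - β η) * (𝓕 u (ξ - η) * 𝓕 f η) := by
      rw [fourier_mul_eq_conv hui hf, ← integral_const_mul, ← sub_eq_iff_eq_add',
        ← integral_sub i1 i2]
      congr with η
      ring
    have e' : ‖β ξ‖ₑ = ‖(β ξ : ℂ)‖ₑ := by
      rw [← ofReal_norm, ← ofReal_norm, Complex.norm_real]
    rw [e', ← enorm_mul, e]
    refine (enorm_add_le _ _).trans (add_le_add le_rfl ?_)
    refine (enorm_integral_le_lintegral_enorm _).trans (lintegral_mono fun η => ?_)
    have h1 : ‖(β ξ : ℂ) - β η‖ₑ ≤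
        ENNReal.ofReal K * (‖ξ - η‖ₑ + ‖ξ - η‖ₑ ^ (k + 1)) * (1 + ‖β η‖ₑ) := by
      rw [← Complex.ofReal_sub, ← ofReal_norm, Complex.norm_real, Real.norm_eq_abs,
        Real.enorm_eq_ofReal_abs, Real.enorm_of_nonneg (hβ0 η), ← ENNReal.ofReal_one,
        ← ENNReal.ofReal_pow (abs_nonneg _), ← ENNReal.ofReal_add (by positivity) (by positivity),
        ← ENNReal.ofReal_add zero_le_one (hβ0 η), ← ENNReal.ofReal_mul hK,
        ← ENNReal.ofReal_mul (by positivity)]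
      exact ENNReal.ofReal_le_ofReal (hβs ξ η)
    rw [enorm_mul, enorm_mul]
    calc _ ≤ ENNReal.ofReal K * (‖ξ - η‖ₑ + ‖ξ - η‖ₑ ^ (k + 1)) * (1 + ‖β η‖ₑ) *
          (‖𝓕 u (ξ - η)‖ₑ * ‖𝓕 f η‖ₑ) := by gcongr
      _ = κ (ξ - η) * F η := by simp only [hκ, hF]; ring
  have hmconv : Measurable fun ξ => ∫⁻ η, κ (ξ - η) * F η := measurable_conv hκm hFm
  have hκi : ∫⁻ t, κ t = ENNReal.ofReal K * (fourierMoment u 1 + fourierMoment u (k + 1)) := by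
    simp only [hκ]
    rw [lintegral_const_mul' _ _ ENNReal.ofReal_ne_top, fourierMoment, fourierMoment,
      ← lintegral_add_left (by fun_prop)]
    congr 1
    refine lintegral_congr fun t => ?_
    ring
  have hFi : ∫⁻ η, F η ^ 2 ≤ 2 * (∫⁻ x, ‖f x‖ₑ ^ 2) + 2 * ∫⁻ η, (‖β η‖ₑ * ‖𝓕 f η‖ₑ) ^ 2 := by
    rw [← sobolev_plancherel hf, ← lintegral_const_mul' _ _ (by norm_num),
      ← lintegral_const_mul' _ _ (by norm_num), ← lintegral_add_left (by fun_prop)]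
    refine lintegral_mono fun η => ?_
    simp only [hF, add_mul, one_mul]
    exact ennreal_add_sq_le_two _ _
  calc _ ≤ ∫⁻ ξ, (ENNReal.ofReal (1 + δ) * ‖∫ η, 𝓕 u (ξ - η) * (β η * 𝓕 f η)‖ₑ ^ 2 +
        ENNReal.ofReal (1 + δ⁻¹) * (∫⁻ η, κ (ξ - η) * F η) ^ 2) := by
        refine lintegral_mono fun ξ => (pow_le_pow_left' (hpt ξ) 2).trans ?_
        exact ennreal_add_sq_le _ _ hδ
    _ = ENNReal.ofReal (1 + δ) * (∫⁻ ξ, ‖∫ η, 𝓕 u (ξ - η) * (β η * 𝓕 f η)‖ₑ ^ 2) +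
        ENNReal.ofReal (1 + δ⁻¹) * ∫⁻ ξ, (∫⁻ η, κ (ξ - η) * F η) ^ 2 := by
        rw [lintegral_add_right _ ((hmconv.pow_const 2).const_mul _),
          lintegral_const_mul' _ _ ENNReal.ofReal_ne_top,
          lintegral_const_mul' _ _ ENNReal.ofReal_ne_top]
    _ ≤ _ := by
        gcongr
        refine (lintegral_sq_conv_le hκm hFm).trans ?_
        rw [hκi]
        gcongr

/-- Bernoulli's inequality turns a lower bound for the second moment into one for the moment of
order `2r`. -/
lemma rpow_moment_lower_bound {G : ℝ → ℂ} (hG : Continuous G) {r α : ℝ} (hr : 1 ≤ r) (hα : 0 < α)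
    (hE : ∫⁻ ξ, ‖G ξ‖ₑ ^ 2 < ⊤)
    (h : ENNReal.ofReal (α ^ 2) * ∫⁻ ξ, ‖G ξ‖ₑ ^ 2 ≤ ∫⁻ ξ : ℝ, (‖ξ‖ₑ * ‖G ξ‖ₑ) ^ 2) :
    ENNReal.ofReal ((α ^ r) ^ 2) * ∫⁻ ξ, ‖G ξ‖ₑ ^ 2 ≤
      ∫⁻ ξ : ℝ, (ENNReal.ofReal (|ξ| ^ r) * ‖G ξ‖ₑ) ^ 2 := by
  set E := ∫⁻ ξ, ‖G ξ‖ₑ ^ 2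
  set s := (α ^ r) ^ 2 with hs
  have hs0 : 0 < s := by positivity
  have mG : Measurable G := hG.measurable
  have hpt : ∀ ξ : ℝ, r * s / α ^ 2 * |ξ| ^ 2 ≤ (|ξ| ^ r) ^ 2 + (r - 1) * s := by
    intro ξ
    have h1 := one_add_mul_self_le_rpow_one_add (s := (|ξ| / α) ^ 2 - 1)
      (by have := sq_nonneg (|ξ| / α); linarith) hr
    rw [add_sub_cancel, ← Real.rpow_natCast, ← Real.rpow_mul (by positivity), mul_comm _ r,
      Real.rpow_mul (by positivity), Real.rpow_natCast, Real.rpow_natCast,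
      Real.div_rpow (abs_nonneg _) hα.le, div_pow, div_pow, ← hs, le_div_iff₀ hs0] at h1
    have e : r * s / α ^ 2 * |ξ| ^ 2 = r * (|ξ| ^ 2 / α ^ 2) * s := by ring
    rw [e]
    linarith
  have key : ENNReal.ofReal (r * s / α ^ 2) * ∫⁻ ξ : ℝ, (‖ξ‖ₑ * ‖G ξ‖ₑ) ^ 2 ≤
      (∫⁻ ξ : ℝ, (ENNReal.ofReal (|ξ| ^ r) * ‖G ξ‖ₑ) ^ 2) + ENNReal.ofReal ((r - 1) * s) * E := by
    rw [← lintegral_const_mul' _ _ ENNReal.ofReal_ne_top,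
      ← lintegral_const_mul' _ _ ENNReal.ofReal_ne_top, ← lintegral_add_right _ (by fun_prop)]
    refine lintegral_mono fun ξ => ?_
    rw [mul_pow, mul_pow, ← mul_assoc, ← add_mul]
    gcongr
    rw [Real.enorm_eq_ofReal_abs, ← ENNReal.ofReal_pow (abs_nonneg _),
      ← ENNReal.ofReal_pow (by positivity), ← ENNReal.ofReal_mul (by positivity),
      ← ENNReal.ofReal_add (by positivity) (mul_nonneg (by linarith) hs0.le)]
    exact ENNReal.ofReal_le_ofReal (hpt ξ)
  have h2 : ENNReal.ofReal s * E + ENNReal.ofReal ((r - 1) * s) * E ≤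
      (∫⁻ ξ : ℝ, (ENNReal.ofReal (|ξ| ^ r) * ‖G ξ‖ₑ) ^ 2) + ENNReal.ofReal ((r - 1) * s) * E := by
    refine le_trans ?_ ((mul_le_mul_right h (ENNReal.ofReal (r * s / α ^ 2))).trans key)
    rw [← add_mul, ← ENNReal.ofReal_add hs0.le (mul_nonneg (by linarith) hs0.le), ← mul_assoc,
      ← ENNReal.ofReal_mul (by positivity)]
    refine le_of_eq ?_
    congr 2
    field_simp
    ring
  exact (ENNReal.add_le_add_iff_right (ENNReal.mul_ne_top ENNReal.ofReal_ne_top hE.ne)).1 h2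

/-- The weighted frequency energy of a localized piece dominates its space moment. -/
lemma local_power_weight_bound {g : ℝ → ℂ} (hg : g ∈ fourierSobolev) {r c a l : ℝ} (hr : 1 ≤ r)
    (hc : 0 < c) (ha : 0 < a) (ha1 : a < 1) (hl : 0 < l)
    (h : ENNReal.ofReal (((l / c) ^ r⁻¹) ^ 2) * ∫⁻ x, ‖g x‖ₑ ^ 2 ≤
      ENNReal.ofReal (a ^ 2) * ∫⁻ ξ : ℝ, (‖ξ‖ₑ * ‖𝓕 g ξ‖ₑ) ^ 2) :
    ENNReal.ofReal (l ^ 2) * ∫⁻ x, ‖g x‖ₑ ^ 2 ≤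
      ENNReal.ofReal (a ^ 2) * ∫⁻ ξ : ℝ, (‖c * |ξ| ^ r‖ₑ * ‖𝓕 g ξ‖ₑ) ^ 2 := by
  set α := (l / c) ^ r⁻¹ / a with hα
  have hα0 : 0 < α := by positivity
  have h1 : ENNReal.ofReal (α ^ 2) * ∫⁻ ξ, ‖𝓕 g ξ‖ₑ ^ 2 ≤ ∫⁻ ξ : ℝ, (‖ξ‖ₑ * ‖𝓕 g ξ‖ₑ) ^ 2 := by
    rw [sobolev_plancherel hg]
    calc _ = ENNReal.ofReal ((a ^ 2)⁻¹) *
          (ENNReal.ofReal (((l / c) ^ r⁻¹) ^ 2) * ∫⁻ x, ‖g x‖ₑ ^ 2) := by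
          rw [← mul_assoc, ← ENNReal.ofReal_mul (by positivity)]
          congr 2
          rw [hα]; field_simp
      _ ≤ _ := mul_le_mul_right h _
      _ = _ := by
          rw [← mul_assoc, ← ENNReal.ofReal_mul (by positivity),
            inv_mul_cancel₀ (by positivity), ENNReal.ofReal_one, one_mul]
  have h2 := rpow_moment_lower_bound (sobolev_continuous_fourier hg) hr hα0
    (by rw [sobolev_plancherel hg]; exact sobolev_norm_lt_top hg) h1
  rw [sobolev_plancherel hg] at h2
  have h3 : α ^ r = l / c / a ^ r := by
    rw [hα, Real.div_rpow (by positivity) ha.le, Real.rpow_inv_rpow (by positivity) (by linarith)]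
  rw [h3] at h2
  have har : 0 < a ^ r := by positivity
  calc ENNReal.ofReal (l ^ 2) * ∫⁻ x, ‖g x‖ₑ ^ 2
      = ENNReal.ofReal ((a ^ r) ^ 2 * c ^ 2) *
        (ENNReal.ofReal ((l / c / a ^ r) ^ 2) * ∫⁻ x, ‖g x‖ₑ ^ 2) := by
        rw [← mul_assoc, ← ENNReal.ofReal_mul (by positivity)]
        congr 2
        field_simp
    _ ≤ _ := mul_le_mul_right h2 _
    _ = ENNReal.ofReal ((a ^ r) ^ 2) * ∫⁻ ξ : ℝ, (‖c * |ξ| ^ r‖ₑ * ‖𝓕 g ξ‖ₑ) ^ 2 := by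
        rw [ENNReal.ofReal_mul (by positivity), mul_assoc,
          ← lintegral_const_mul' (ENNReal.ofReal (c ^ 2)) _ ENNReal.ofReal_ne_top]
        congr 1
        refine lintegral_congr fun ξ => ?_
        rw [Real.enorm_of_nonneg (by positivity), ENNReal.ofReal_mul hc.le,
          ENNReal.ofReal_pow hc.le]
        ring
    _ ≤ _ := by
        gcongr
        calc a ^ r ≤ a ^ (1 : ℝ) := Real.rpow_le_rpow_of_exponent_ge ha ha1.le hr
          _ = a := Real.rpow_one a

lemma fourierMoment_annulusCutoff_add_le {γ l : ℝ} (hγ : 1 < γ) (hl : 1 ≤ l) (k : ℕ) :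
    fourierMoment (annulusCutoff γ l) 1 + fourierMoment (annulusCutoff γ l) (k + 1) ≤
      ENNReal.ofReal (l⁻¹ * (fourierMoment (annulusCutoff γ 1) 1 +
        fourierMoment (annulusCutoff γ 1) (k + 1)).toReal) := by
  have hl0 : 0 < l := by linarith
  rw [fourierMoment_annulusCutoff hγ hl0, fourierMoment_annulusCutoff hγ hl0,
    ENNReal.ofReal_mul (by positivity), ENNReal.ofReal_toReal (ENNReal.add_ne_top.2
      ⟨(fourierMoment_annulusCutoff_lt_top hγ one_pos _).ne,
        (fourierMoment_annulusCutoff_lt_top hγ one_pos _).ne⟩), mul_add, pow_one]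
  gcongr
  exact le_self_pow₀ hl (by omega)

/-- The sum of the weighted frequency energies of the localized pieces exceeds that of the function
by an arbitrarily small proportion, once the localization starts far out. -/
lemma tsum_weighted_pieces_le {γ : ℝ} (hγ : 1 < γ) {β : ℝ → ℝ} (hβ : Continuous β)
    (hβ0 : ∀ ξ, 0 ≤ β ξ) {K : ℝ} (hK : 0 ≤ K) {k : ℕ}
    (hβs : ∀ ξ η, |β ξ - β η| ≤ K * (|ξ - η| + |ξ - η| ^ (k + 1)) * (1 + β η))
    {δ : ℝ} (hδ : 0 < δ) : ∃ L₀ : ℝ, 1 ≤ L₀ ∧ ∀ L, L₀ ≤ L → ∀ f ∈ fourierSobolev,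
      MemLp (fun η => (β η : ℂ) * 𝓕 f η) 2 →
      ∑' n : ℕ, ∫⁻ ξ, (‖β ξ‖ₑ * ‖𝓕 (fun x => annulusCutoff γ (L * γ ^ n) x * f x) ξ‖ₑ) ^ 2 ≤
        ENNReal.ofReal (1 + 2 * δ) * (∫⁻ η, (‖β η‖ₑ * ‖𝓕 f η‖ₑ) ^ 2) +
        ENNReal.ofReal δ * ∫⁻ x, ‖f x‖ₑ ^ 2 := by
  set m := (fourierMoment (annulusCutoff γ 1) 1 + fourierMoment (annulusCutoff γ 1) (k + 1)).toReal
    with hm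
  have hm0 : 0 ≤ m := ENNReal.toReal_nonneg
  have hγ0 : 0 < γ := by linarith
  set θ := (γ⁻¹) ^ 2 with hθ
  have hθ0 : 0 ≤ θ := by positivity
  have hθ1 : θ < 1 := pow_lt_one₀ (by positivity) (inv_lt_one_of_one_lt₀ hγ) (by norm_num)
  set Q := (1 + δ⁻¹) * (K * m) ^ 2 * 2 / (1 - θ) with hQ
  have hQ0 : 0 ≤ Q := div_nonneg (by positivity) (by linarith)
  refine ⟨max 1 (Q / δ), le_max_left _ _, fun L hL f hf hh => ?_⟩
  have hL1 : 1 ≤ L := (le_max_left _ _).trans hL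
  have hL0 : 0 < L := by linarith
  have hQL : Q * (L⁻¹) ^ 2 ≤ δ := by
    have h1 : Q ≤ δ * L := by
      have := (le_max_right _ _).trans hL
      rwa [div_le_iff₀ hδ, mul_comm] at this
    calc Q * (L⁻¹) ^ 2 ≤ δ * L * (L⁻¹) ^ 2 := by gcongr
      _ = δ * L⁻¹ := by field_simp
      _ ≤ δ * 1 := by gcongr; exact inv_le_one_of_one_le₀ hL1
      _ = δ := mul_one _
  set E := ∫⁻ x, ‖f x‖ₑ ^ 2 with hE
  set H := ∫⁻ η, (‖β η‖ₑ * ‖𝓕 f η‖ₑ) ^ 2 with hH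
  have hl : ∀ n : ℕ, 1 ≤ L * γ ^ n := fun n => one_le_mul_of_one_le_of_one_le hL1
    (one_le_pow₀ hγ.le)
  have hl0 : ∀ n : ℕ, 0 < L * γ ^ n := fun n => one_pos.trans_le (hl n)
  have hpiece : ∀ n : ℕ,
      ∫⁻ ξ, (‖β ξ‖ₑ * ‖𝓕 (fun x => annulusCutoff γ (L * γ ^ n) x * f x) ξ‖ₑ) ^ 2 ≤
      ENNReal.ofReal (1 + δ) *
        (∫⁻ ξ, ‖∫ η, 𝓕 (annulusCutoff γ (L * γ ^ n)) (ξ - η) * (β η * 𝓕 f η)‖ₑ ^ 2) +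
      ENNReal.ofReal ((1 + δ⁻¹) * (K * m) ^ 2 * (L⁻¹) ^ 2 * θ ^ n) * (2 * E + 2 * H) := by
    intro n
    refine (weighted_fourier_mul_le contDiff_annulusCutoff.continuous
      (hasCompactSupport_annulusCutoff hγ (hl0 n)) hf hβ hβ0 hK hβs hh hδ).trans ?_
    refine add_le_add le_rfl ?_
    rw [← mul_assoc]
    refine mul_le_mul' ?_ le_rfl
    calc _ ≤ ENNReal.ofReal (1 + δ⁻¹) *
          (ENNReal.ofReal K * ENNReal.ofReal ((L * γ ^ n)⁻¹ * m)) ^ 2 := by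
          gcongr
          exact fourierMoment_annulusCutoff_add_le hγ (hl n) k
      _ = _ := by
          rw [← ENNReal.ofReal_mul hK, ← ENNReal.ofReal_pow (by have := hl0 n; positivity),
            ← ENNReal.ofReal_mul (by positivity)]
          congr 1
          rw [hθ, ← pow_mul, mul_comm 2 n, pow_mul, mul_inv, inv_pow]
          ring
  have hbessel : ∑' n : ℕ,
      ∫⁻ ξ, ‖∫ η, 𝓕 (annulusCutoff γ (L * γ ^ n)) (ξ - η) * (β η * 𝓕 f η)‖ₑ ^ 2 ≤ H := by
    refine (tsum_lintegral_conv_sq_le (fun n => contDiff_annulusCutoff.continuous)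
      (fun n => hasCompactSupport_annulusCutoff hγ (hl0 n)) (fun x => ?_)
      ((Complex.continuous_ofReal.comp hβ).mul (sobolev_continuous_fourier hf)) hh).trans
      (le_of_eq ?_)
    · simp only [enorm_annulusCutoff_sq]
      rw [tsum_annulusBump_sq hγ hL0, ← ENNReal.ofReal_one]
      exact ENNReal.ofReal_le_ofReal (Real.sin_sq_le_one _)
    · refine lintegral_congr fun η => ?_
      rw [Pi.mul_apply, enorm_mul, Function.comp_apply, ← ofReal_norm (β η : ℂ), Complex.norm_real, ofReal_norm]
  have hgeo : ∑' n : ℕ, ENNReal.ofReal ((1 + δ⁻¹) * (K * m) ^ 2 * (L⁻¹) ^ 2 * θ ^ n) *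
      (2 * E + 2 * H) ≤ ENNReal.ofReal δ * (E + H) := by
    rw [ENNReal.tsum_mul_right, ← ENNReal.ofReal_tsum_of_nonneg (fun n => by positivity)
      ((summable_geometric_of_lt_one hθ0 hθ1).mul_left _), tsum_mul_left,
      tsum_geometric_of_lt_one hθ0 hθ1, ← mul_add, ← mul_assoc]
    refine mul_le_mul' ?_ le_rfl
    rw [show (2 : ℝ≥0∞) = ENNReal.ofReal 2 by simp, ← ENNReal.ofReal_mul' (by norm_num)]
    refine ENNReal.ofReal_le_ofReal (le_trans (le_of_eq ?_) hQL)
    rw [hQ]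
    ring
  calc _ ≤ _ := ENNReal.tsum_le_tsum hpiece
    _ = ENNReal.ofReal (1 + δ) * (∑' n : ℕ,
        ∫⁻ ξ, ‖∫ η, 𝓕 (annulusCutoff γ (L * γ ^ n)) (ξ - η) * (β η * 𝓕 f η)‖ₑ ^ 2) +
        ∑' n : ℕ, ENNReal.ofReal ((1 + δ⁻¹) * (K * m) ^ 2 * (L⁻¹) ^ 2 * θ ^ n) *
          (2 * E + 2 * H) := by
        rw [ENNReal.tsum_add, ENNReal.tsum_mul_left]
    _ ≤ ENNReal.ofReal (1 + δ) * H + ENNReal.ofReal δ * (E + H) := by gcongr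
    _ = _ := by
        have e : ENNReal.ofReal (1 + 2 * δ) = ENNReal.ofReal (1 + δ) + ENNReal.ofReal δ := by
          rw [← ENNReal.ofReal_add (by positivity) hδ.le]
          congr 1
          ring
        rw [e]
        ring

/-- Finite-dimensionality for a pair of inverse power weights with exponent at least one on the
frequency side. -/
theorem finiteDimensional_of_power {r c : ℝ} (hr : 1 ≤ r) (hc : 0 < c)
    {lam mu : ℤ → ℝ} (hlam : IsOrderedSeq lam) (hmu : IsOrderedSeq mu) {b : ℝ} (hb : b < 1 / 2)
    (hlg : ∀ᶠ j : ℤ in cofinite,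
      (((max ‖lam j‖₊ ‖lam (j + 1)‖₊ : ℝ≥0) : ℝ) / c) ^ r⁻¹ * (lam (j + 1) - lam j) ≤ b)
    (hmg : ∀ᶠ j : ℤ in cofinite,
      c * ((max ‖mu j‖₊ ‖mu (j + 1)‖₊ : ℝ≥0) : ℝ) ^ r * (mu (j + 1) - mu j) ≤ b) :
    FiniteDimensional ℂ (vanishingSpace (Set.range lam) (Set.range mu)) := by
  obtain ⟨ρ, hρ0, hρ1, hbρ⟩ := exists_two_mul_lt_pow_four hb
  have hr0 : 0 ≤ r := by linarith
  set A : ℝ≥0 → ℝ := fun x => ((x : ℝ) / c) ^ r⁻¹ with hA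
  set B : ℝ≥0 → ℝ := fun ξ => c * (ξ : ℝ) ^ r with hB
  set β : ℝ → ℝ := fun ξ => c * |ξ| ^ r with hβ
  have hA0 : ∀ x, 0 ≤ A x := fun x => by simp only [hA]; positivity
  have hB0 : ∀ x, 0 ≤ B x := fun x => by simp only [hB]; positivity
  have hβ0 : ∀ x, 0 ≤ β x := fun x => by simp only [hβ]; positivity
  have hAm : Monotone A := fun x y hxy => by
    simp only [hA]
    have : (x : ℝ) ≤ y := hxy
    gcongr
  have hBm : Monotone B := fun x y hxy => by
    simp only [hB]
    have : (x : ℝ) ≤ y := hxy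
    gcongr
  have hβc : Continuous β := by
    simp only [hβ]
    exact continuous_const.mul (continuous_abs.rpow_const fun _ => Or.inr hr0)
  have hBβ : ∀ ξ : ℝ, B ‖ξ‖₊ = β ξ := fun ξ => by simp [hB, hβ]
  set a := ρ ^ 4 with ha
  have ha0 : 0 < a := by positivity
  have ha1 : a < 1 := pow_lt_one₀ hρ0.le hρ1 (by norm_num)
  obtain ⟨R₁, hR₁, hW₁⟩ := weighted_wirtinger hlam hAm hA0 ha0 hbρ hlg
  obtain ⟨R₂, hR₂, hW₂⟩ := weighted_wirtinger hmu hBm hB0 ha0 hbρ hmg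
  simp only [hBβ] at hW₂
  obtain ⟨K, k, hK, hβs⟩ := exists_power_weight_sub_le hr hc
  -- With ratio `γ = 1 / ρ` and relative loss `γ - 1` of the pieces, the total constant is
  -- `γ ^ 4 * a ^ 2 * γ = ρ ^ 3 < 1`.
  set γ := ρ⁻¹ with hγ
  have hγ1 : 1 < γ := (one_lt_inv₀ hρ0).2 hρ1
  have hγ0 : 0 < γ := by linarith
  obtain ⟨L₀, hL₀, hsum⟩ := tsum_weighted_pieces_le hγ1 hβc hβ0 hK hβs
    (δ := (γ - 1) / 2) (by linarith)
  rw [show 1 + 2 * ((γ - 1) / 2) = γ by ring] at hsum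
  set L := max L₀ R₁ with hL
  have hL0 : 0 < L := by linarith [le_max_left L₀ R₁]
  set s := β R₂ with hs
  set C₁ := ρ ^ 3 * s ^ 2 + γ ^ 4 * a ^ 2 * ((γ - 1) / 2) with hC₁
  have hC₁0 : 0 ≤ C₁ := by
    have : 0 ≤ (γ - 1) / 2 := by linarith
    positivity
  have hρ3 : ρ ^ 3 < 1 := pow_lt_one₀ hρ0.le hρ1 (by norm_num)
  set C₂ := ((γ * L) ^ 2 + C₁) / (1 - ρ ^ 3) with hC₂
  have hC₂0 : 0 < C₂ := div_pos (by positivity) (by linarith)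
  set C₃ := (max 1 R₂) ^ 2 + (c⁻¹) ^ 2 * C₂ with hC₃
  have key : ∀ f ∈ vanishingSpace (Set.range lam) (Set.range mu),
      (∫⁻ x : ℝ, (‖x‖ₑ * ‖f x‖ₑ) ^ 2 ≤ ENNReal.ofReal C₂ * ∫⁻ x, ‖f x‖ₑ ^ 2) ∧
      (∫⁻ ξ : ℝ, (‖ξ‖ₑ * ‖𝓕 f ξ‖ₑ) ^ 2 ≤ ENNReal.ofReal C₃ * ∫⁻ x, ‖f x‖ₑ ^ 2) := by
    rintro f ⟨hf, hfl, hfm⟩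
    have hzl : ∀ j, f (lam j) = 0 := fun j => hfl _ ⟨j, rfl⟩
    have hzm : ∀ j, 𝓕 f (mu j) = 0 := fun j => hfm _ ⟨j, rfl⟩
    set E := ∫⁻ x, ‖f x‖ₑ ^ 2 with hE
    set X := ∫⁻ x : ℝ, (‖x‖ₑ * ‖f x‖ₑ) ^ 2 with hX
    have hXt : X < ⊤ := (lintegral_weighted_lt_top hf.2.1).2
    have hEt : E < ⊤ := sobolev_norm_lt_top hf
    have hHout : ∫⁻ η in {η : ℝ | R₂ ≤ |η|}, (‖β η‖ₑ * ‖𝓕 f η‖ₑ) ^ 2 ≤ X := by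
      refine (hW₂ f (sobolev_integrable hf) hzm).trans (mul_le_of_le_one_left' ?_)
      rw [← ENNReal.ofReal_one]
      exact ENNReal.ofReal_le_ofReal (pow_le_one₀ ha0.le ha1.le)
    set H := ∫⁻ η, (‖β η‖ₑ * ‖𝓕 f η‖ₑ) ^ 2 with hH
    have hHX : H ≤ X + ENNReal.ofReal (s ^ 2) * E := by
      have hms : MeasurableSet {ξ : ℝ | R₂ ≤ |ξ|} :=
        measurableSet_le measurable_const continuous_abs.measurable
      rw [hH, ← lintegral_add_compl _ hms]
      refine add_le_add hHout ?_
      rw [hE, ← sobolev_plancherel hf]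
      refine le_trans ?_ (mul_le_mul_right (setLIntegral_le_lintegral {ξ : ℝ | R₂ ≤ |ξ|}ᶜ _) _)
      rw [← lintegral_const_mul' _ _ ENNReal.ofReal_ne_top]
      refine setLIntegral_mono' hms.compl fun ξ hξ => ?_
      have hξ' : |ξ| < R₂ := not_le.1 hξ
      rw [mul_pow, ENNReal.ofReal_pow (hβ0 _), Real.enorm_of_nonneg (hβ0 _)]
      gcongr
      exact mul_le_mul_of_nonneg_left (Real.rpow_le_rpow (abs_nonneg _)
        (hξ'.le.trans (le_abs_self _)) hr0) hc.le
    have hHt : H < ⊤ := hHX.trans_lt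
      (ENNReal.add_lt_top.2 ⟨hXt, ENNReal.mul_lt_top ENNReal.ofReal_lt_top hEt⟩)
    have hh : MemLp (fun η => (β η : ℂ) * 𝓕 f η) 2 := by
      refine memLp_two_of_lintegral_lt_top ((Complex.continuous_ofReal.comp hβc).mul
        (sobolev_continuous_fourier hf)).aestronglyMeasurable (lt_of_eq_of_lt ?_ hHt)
      refine lintegral_congr fun η => ?_
      rw [enorm_mul, ← ofReal_norm (β η : ℂ), Complex.norm_real, ofReal_norm]
    have hloc : ∀ n : ℕ, ENNReal.ofReal ((L * γ ^ n) ^ 2) *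
        ∫⁻ x, ‖annulusCutoff γ (L * γ ^ n) x * f x‖ₑ ^ 2 ≤ ENNReal.ofReal (a ^ 2) *
        ∫⁻ ξ, (‖β ξ‖ₑ * ‖𝓕 (fun x => annulusCutoff γ (L * γ ^ n) x * f x) ξ‖ₑ) ^ 2 := by
      intro n
      have hl : 0 < L * γ ^ n := by positivity
      refine local_power_weight_bound (annulusCutoff_mul_mem hγ1 hl hf) hr hc ha0 ha1 hl ?_
      refine local_frequency_bound hAm hA0 hW₁ hγ1 (L := ⟨L * γ ^ n, hl.le⟩) hl ?_ hf hzl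
      exact (le_max_right L₀ R₁).trans (le_mul_of_one_le_right hL0.le (one_le_pow₀ hγ1.le))
    have houter : ∫⁻ x in {x : ℝ | γ * L ≤ |x|}, (‖x‖ₑ * ‖f x‖ₑ) ^ 2 ≤
        ENNReal.ofReal (ρ ^ 3) * X + ENNReal.ofReal C₁ * E := by
      have hδ : 0 ≤ (γ - 1) / 2 := by linarith
      calc _ ≤ _ := lintegral_outer_le_tsum hγ1 hL0 (sobolev_continuous hf)
        _ ≤ ENNReal.ofReal (γ ^ 4) * (ENNReal.ofReal (a ^ 2) * ∑' n : ℕ,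
            ∫⁻ ξ, (‖β ξ‖ₑ * ‖𝓕 (fun x => annulusCutoff γ (L * γ ^ n) x * f x) ξ‖ₑ) ^ 2) := by
            rw [← ENNReal.tsum_mul_left (a := ENNReal.ofReal (a ^ 2))]
            exact mul_le_mul_right (ENNReal.tsum_le_tsum hloc) _
        _ ≤ ENNReal.ofReal (γ ^ 4) * (ENNReal.ofReal (a ^ 2) *
            (ENNReal.ofReal γ * (X + ENNReal.ofReal (s ^ 2) * E) +
              ENNReal.ofReal ((γ - 1) / 2) * E)) := by
            refine mul_le_mul_right (mul_le_mul_right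
              ((hsum L (le_max_left _ _) f hf hh).trans ?_) _) _
            gcongr
        _ = ENNReal.ofReal (γ ^ 4 * a ^ 2 * γ) * (X + ENNReal.ofReal (s ^ 2) * E) +
            ENNReal.ofReal (γ ^ 4 * a ^ 2 * ((γ - 1) / 2)) * E := by
            rw [ENNReal.ofReal_mul (by positivity), ENNReal.ofReal_mul (by positivity),
              ENNReal.ofReal_mul (p := γ ^ 4 * a ^ 2) (by positivity)]
            rw [ENNReal.ofReal_mul (by positivity)]
            ring
        _ = _ := by
            have e : γ ^ 4 * a ^ 2 * γ = ρ ^ 3 := by rw [ha, hγ]; field_simp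
            rw [e, hC₁, ENNReal.ofReal_add (by positivity) (by positivity),
              ENNReal.ofReal_mul (p := ρ ^ 3) (by positivity)]
            ring
    have hXE := moment_le_of_outer_le (by positivity) hρ3 hC₁0 hXt hEt houter
    refine ⟨hXE, ?_⟩
    refine (frequency_moment_le (B := B) (R := max 1 R₂) (c := c⁻¹) (by positivity) (by positivity)
      fun ξ hξ => ?_).trans ?_
    · have h1 : 1 ≤ |ξ| := (le_max_left _ _).trans hξ
      rw [hBβ]
      simp only [hβ]
      rw [← mul_assoc, inv_mul_cancel₀ hc.ne', one_mul]
      exact Real.self_le_rpow_of_one_le h1 hr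
    · rw [sobolev_plancherel hf, hC₃, ENNReal.ofReal_add (by positivity) (by positivity), add_mul]
      refine add_le_add le_rfl ?_
      rw [ENNReal.ofReal_mul (by positivity), mul_assoc]
      simp only [hBβ]
      refine mul_le_mul_right (le_trans (lintegral_mono_set fun η hη => ?_) (hHout.trans hXE)) _
      exact (le_max_right 1 R₂).trans hη
  refine finiteDimensional_of_moments (C := max C₂ C₃) (fun f hf => hf.1) (lt_max_of_lt_left hC₂0)
    (fun f hf => (key f hf).1.trans ?_) (fun f hf => (key f hf).2.trans ?_)
  · gcongr; exact le_max_left _ _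
  · gcongr; exact le_max_right _ _

/-! ### Exchanging the two sides -/

lemma fourier_neg_mem_fourierSobolev {f : ℝ → ℂ} (hf : f ∈ fourierSobolev) :
    (fun ξ => 𝓕 f (-ξ)) ∈ fourierSobolev := by
  refine ⟨(sobolev_continuous_fourier hf).comp continuous_neg, ?_, ?_⟩
  · simpa using hf.2.2.comp_neg
  · rw [sobolev_inversion hf]
    exact hf.2.1

/-- The inverse Fourier transform exchanges the roles of the two sides. -/
lemma finiteDimensional_vanishingSpace_swap {L M M' : Set ℝ} (hM : ∀ ξ ∈ M', -ξ ∈ M)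
    (h : FiniteDimensional ℂ (vanishingSpace M' L)) :
    FiniteDimensional ℂ (vanishingSpace L M) := by
  let Φ : vanishingSpace L M →ₗ[ℂ] vanishingSpace M' L :=
    { toFun := fun f => ⟨fun ξ => 𝓕 (f : ℝ → ℂ) (-ξ), fourier_neg_mem_fourierSobolev f.2.1,
        fun ξ hξ => f.2.2.2 _ (hM ξ hξ), fun x hx => by
          rw [sobolev_inversion f.2.1]
          exact f.2.2.1 x hx⟩
      map_add' := fun f g => by
        ext ξ
        have hadd : 𝓕 ((f : ℝ → ℂ) + g) = 𝓕 (f : ℝ → ℂ) + 𝓕 (g : ℝ → ℂ) :=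
          VectorFourier.fourierIntegral_add Real.continuous_fourierChar
            (by exact continuous_inner) (sobolev_integrable f.2.1) (sobolev_integrable g.2.1)
        change 𝓕 ((f : ℝ → ℂ) + g) (-ξ) = 𝓕 (f : ℝ → ℂ) (-ξ) + 𝓕 (g : ℝ → ℂ) (-ξ)
        rw [hadd]
        rfl
      map_smul' := fun c f => by
        ext ξ
        have hs : 𝓕 (c • (f : ℝ → ℂ)) = c • 𝓕 (f : ℝ → ℂ) :=
          VectorFourier.fourierIntegral_const_smul _ _ _ (f : ℝ → ℂ) c
        change 𝓕 (c • (f : ℝ → ℂ)) (-ξ) = c • 𝓕 (f : ℝ → ℂ) (-ξ)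
        rw [hs]
        rfl }
  refine Module.Finite.of_injective Φ fun f g hfg => ?_
  have h1 : (fun ξ => 𝓕 (f : ℝ → ℂ) (-ξ)) = fun ξ => 𝓕 (g : ℝ → ℂ) (-ξ) :=
    congrArg (fun k : vanishingSpace M' L => (k : ℝ → ℂ)) hfg
  ext1
  rw [← sobolev_inversion f.2.1, h1, sobolev_inversion g.2.1]

lemma IsOrderedSeq.neg_rev {a : ℤ → ℝ} (h : IsOrderedSeq a) : IsOrderedSeq fun j => -a (-j) where
  strictMono := fun _ _ hij => neg_lt_neg (h.strictMono (neg_lt_neg hij))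
  tendsto_atTop := tendsto_neg_atBot_atTop.comp (h.tendsto_atBot.comp tendsto_neg_atTop_atBot)
  tendsto_atBot := tendsto_neg_atTop_atBot.comp (h.tendsto_atTop.comp tendsto_neg_atBot_atTop)

/-- It suffices to treat the pair with the two sides exchanged; the gap condition is insensitive to
the reflection of the sequence. -/
lemma finiteDimensional_of_swap {lam mu : ℤ → ℝ} (hmu : IsOrderedSeq mu) {W : ℝ≥0 → ℝ} {b : ℝ}
    (hmg : ∀ᶠ j : ℤ in cofinite, W (max ‖mu j‖₊ ‖mu (j + 1)‖₊) * (mu (j + 1) - mu j) ≤ b)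
    (h : ∀ nu : ℤ → ℝ, IsOrderedSeq nu →
      (∀ᶠ j : ℤ in cofinite, W (max ‖nu j‖₊ ‖nu (j + 1)‖₊) * (nu (j + 1) - nu j) ≤ b) →
      FiniteDimensional ℂ (vanishingSpace (Set.range nu) (Set.range lam))) :
    FiniteDimensional ℂ (vanishingSpace (Set.range lam) (Set.range mu)) := by
  refine finiteDimensional_vanishingSpace_swap (M' := Set.range fun j => -mu (-j)) ?_
    (h _ hmu.neg_rev ?_)
  · rintro _ ⟨j, rfl⟩
    exact ⟨-j, (neg_neg _).symm⟩
  · have hinj : Function.Injective fun j : ℤ => -j - 1 := fun i j hij => by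
      simp only at hij; omega
    filter_upwards [hinj.tendsto_cofinite.eventually hmg] with j hj
    rw [sub_add_cancel] at hj
    rw [nnnorm_neg, nnnorm_neg, max_comm, show -(j + 1) = -j - 1 by ring]
    refine le_of_eq_of_le ?_ hj
    ring

/-- Finite-dimensionality for a pair of inverse power weights. -/
theorem finiteDimensional_of_inverse_powers {r c : ℝ} (hr : 0 < r) (hc : 0 < c)
    {lam mu : ℤ → ℝ} (hlam : IsOrderedSeq lam) (hmu : IsOrderedSeq mu) {b : ℝ} (hb : b < 1 / 2)
    (hlg : ∀ᶠ j : ℤ in cofinite,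
      (((max ‖lam j‖₊ ‖lam (j + 1)‖₊ : ℝ≥0) : ℝ) / c) ^ r⁻¹ * (lam (j + 1) - lam j) ≤ b)
    (hmg : ∀ᶠ j : ℤ in cofinite,
      c * ((max ‖mu j‖₊ ‖mu (j + 1)‖₊ : ℝ≥0) : ℝ) ^ r * (mu (j + 1) - mu j) ≤ b) :
    FiniteDimensional ℂ (vanishingSpace (Set.range lam) (Set.range mu)) := by
  rcases le_total 1 r with h1 | h1
  · exact finiteDimensional_of_power h1 hc hlam hmu hb hlg hmg
  refine finiteDimensional_of_swap hmu (W := fun x => c * (x : ℝ) ^ r) hmg fun nu hnu hng => ?_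
  refine finiteDimensional_of_power (r := r⁻¹) (c := (c⁻¹) ^ r⁻¹) ((one_le_inv₀ hr).2 h1)
    (by positivity) hnu hlam hb ?_ ?_
  · filter_upwards [hng] with j hj
    rwa [inv_inv, Real.div_rpow (by positivity) (by positivity),
      Real.rpow_inv_rpow (by positivity) hr.ne', div_inv_eq_mul, mul_comm _ c]
  · filter_upwards [hlg] with j hj
    rwa [← Real.mul_rpow (by positivity) (by positivity), mul_comm c⁻¹, ← div_eq_mul_inv]

/-! ### Power series with non-negative coefficients and generalized inverses -/

section PowerSeries

variable {T : ℝ≥0 → ℝ≥0}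

/-- A widely admissible function is a power series with non-negative coefficients. -/
lemma WidelyAdmissible.exists_hasSum (hT : WidelyAdmissible T) :
    ∃ c : ℕ → ℝ, (∀ n, 0 ≤ c n) ∧ ∀ x : ℝ≥0, HasSum (fun n => c n * (x : ℝ) ^ n) (T x) := by
  obtain ⟨F, hF, hFT, hd⟩ := hT.extension
  refine ⟨fun n => (n.factorial : ℝ)⁻¹ * (iteratedDeriv n F 0).re,
    fun n => mul_nonneg (by positivity) (hd n).1, fun x => ?_⟩
  have h := Complex.hasSum_taylorSeries_of_entire hF 0 ((x : ℝ) : ℂ)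
  rw [hFT] at h
  rw [← Complex.hasSum_ofReal]
  refine h.congr_fun fun n => ?_
  have e : iteratedDeriv n F 0 = ((iteratedDeriv n F 0).re : ℂ) :=
    Complex.ext rfl (by simp [(hd n).2])
  simp only [sub_zero, smul_eq_mul]
  rw [e]
  push_cast
  rw [Complex.ofReal_re]
  ring

lemma WidelyAdmissible.continuous (hT : WidelyAdmissible T) : Continuous T := by
  obtain ⟨F, hF, hFT, -⟩ := hT.extension
  rw [NNReal.isEmbedding_coe.continuous_iff]
  have h : (fun x : ℝ≥0 => (T x : ℝ)) = fun x : ℝ≥0 => (F ((x : ℝ) : ℂ)).re := by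
    ext x; rw [hFT, Complex.ofReal_re]
  change Continuous fun x : ℝ≥0 => (T x : ℝ)
  rw [h]
  exact Complex.continuous_re.comp (hF.continuous.comp
    (Complex.continuous_ofReal.comp NNReal.continuous_coe))

variable {c : ℕ → ℝ} (hc : ∀ n, 0 ≤ c n)
  (hsum : ∀ x : ℝ≥0, HasSum (fun n => c n * (x : ℝ) ^ n) (T x))

include hc hsum

lemma coeff_mul_pow_le (n : ℕ) (x : ℝ≥0) : c n * (x : ℝ) ^ n ≤ T x := by
  have := sum_le_hasSum {n} (fun i _ => mul_nonneg (hc i) (by positivity)) (hsum x)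
  simpa using this

omit hc in
lemma exists_pos_coeff (hmono : StrictMono T) : ∃ n, 1 ≤ n ∧ c n ≠ 0 := by
  by_contra! h
  have : ∀ x : ℝ≥0, (T x : ℝ) = c 0 := fun x => by
    have h1 := hasSum_single (f := fun n => c n * (x : ℝ) ^ n) 0 fun n hn => by
      rw [h n (Nat.one_le_iff_ne_zero.2 hn), zero_mul]
    simpa using (hsum x).unique h1
  have h2 := hmono (zero_lt_one (α := ℝ≥0))
  have h3 : (T 0 : ℝ) < T 1 := h2
  rw [this, this] at h3
  exact lt_irrefl _ h3

lemma tendsto_powerSeries_atTop (hmono : StrictMono T) : Tendsto T atTop atTop := by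
  obtain ⟨n, hn, hcn⟩ := exists_pos_coeff hsum hmono
  have hcn' : 0 < c n := lt_of_le_of_ne (hc n) hcn.symm
  rw [← NNReal.tendsto_coe_atTop]
  refine tendsto_atTop_mono (fun x => coeff_mul_pow_le hc hsum n x) ?_
  exact ((tendsto_pow_atTop (by omega)).comp (NNReal.tendsto_coe_atTop.2 tendsto_id)).const_mul_atTop
    hcn'

/-- Apart from a fixed proportion, a transcendental power series with non-negative coefficients
grows at least like any prescribed power. -/
lemma exists_superpolynomial_growth (hinf : ∀ N, ∃ n, N ≤ n ∧ c n ≠ 0) {θ : ℝ} (hθ : θ < 1)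
    (N : ℕ) : ∃ y₀ : ℝ≥0, 0 < y₀ ∧ ∀ y₁ y : ℝ≥0, y₀ ≤ y₁ → y₁ ≤ y →
      θ * T y₁ * ((y : ℝ) / y₁) ^ N ≤ T y := by
  obtain ⟨m, hm, hcm⟩ := hinf (N + 1)
  have hcm' : 0 < c m := lt_of_le_of_ne (hc m) hcm.symm
  set C := ∑ n ∈ Finset.range N, c n with hC
  have hC0 : 0 ≤ C := Finset.sum_nonneg fun n _ => hc n
  have h1θ : 0 < 1 - θ := by linarith
  refine ⟨max 1 (C / ((1 - θ) * c m)).toNNReal, lt_max_of_lt_left one_pos,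
    fun y₁ y hy₁ hy => ?_⟩
  have h1 : (1 : ℝ) ≤ y₁ := (le_max_left _ _).trans hy₁
  have h10 : (0 : ℝ) < y₁ := by linarith
  have hyy : (y₁ : ℝ) ≤ y := hy
  have h2 : C ≤ (1 - θ) * c m * y₁ := by
    have h3 : C / ((1 - θ) * c m) ≤ y₁ := (Real.le_coe_toNNReal _).trans
      (NNReal.coe_le_coe.2 ((le_max_right _ _).trans hy₁))
    rwa [div_le_iff₀ (by positivity), mul_comm] at h3
  -- the terms of degree below `N` are negligible from `y₀` on
  set P := ∑ n ∈ Finset.range N, c n * (y₁ : ℝ) ^ n with hP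
  have hPle : P ≤ (1 - θ) * T y₁ := by
    calc P ≤ ∑ n ∈ Finset.range N, c n * (y₁ : ℝ) ^ N := by
          refine Finset.sum_le_sum fun n hn => mul_le_mul_of_nonneg_left ?_ (hc n)
          exact pow_le_pow_right₀ h1 (Finset.mem_range.1 hn).le
      _ = C * (y₁ : ℝ) ^ N := by rw [← Finset.sum_mul]
      _ ≤ (1 - θ) * c m * y₁ * (y₁ : ℝ) ^ N := by gcongr
      _ = (1 - θ) * (c m * (y₁ : ℝ) ^ (N + 1)) := by ring
      _ ≤ (1 - θ) * (c m * (y₁ : ℝ) ^ m) := by gcongr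
      _ ≤ _ := by gcongr; exact coeff_mul_pow_le hc hsum m y₁
  have htail : HasSum (fun n => if n ∈ Finset.range N then 0 else c n * (y₁ : ℝ) ^ n)
      (T y₁ - P) := by
    have h3 : HasSum (fun n => if n ∈ Finset.range N then c n * (y₁ : ℝ) ^ n else 0) P := by
      have h5 : HasSum (fun n => if n ∈ Finset.range N then c n * (y₁ : ℝ) ^ n else 0)
          (∑ n ∈ Finset.range N, if n ∈ Finset.range N then c n * (y₁ : ℝ) ^ n else 0) :=
        hasSum_sum_of_ne_finset_zero fun n hn => if_neg hn
      rwa [Finset.sum_congr rfl fun n hn => if_pos hn] at h5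
    refine ((hsum y₁).sub h3).congr_fun fun n => ?_
    split_ifs <;> simp
  have hratio : 1 ≤ (y : ℝ) / y₁ := (one_le_div h10).2 hyy
  have h4 := hasSum_le (fun n => ?_) (htail.mul_left (((y : ℝ) / y₁) ^ N)) (hsum y)
  · refine le_trans ?_ h4
    rw [mul_comm]
    gcongr
    linarith
  · split_ifs with hn
    · rw [mul_zero]
      exact mul_nonneg (hc n) (by positivity)
    · have hn' : N ≤ n := not_lt.1 fun h => hn (Finset.mem_range.2 h)
      calc ((y : ℝ) / y₁) ^ N * (c n * (y₁ : ℝ) ^ n)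
          ≤ ((y : ℝ) / y₁) ^ n * (c n * (y₁ : ℝ) ^ n) := by
            have := hc n
            gcongr
        _ = _ := by rw [div_pow]; field_simp

/-- A polynomial with non-negative coefficients is asymptotic to its leading term. -/
lemma exists_leading_term (hmono : StrictMono T) (hfin : ∃ N, ∀ n, N ≤ n → c n = 0) :
    ∃ (d : ℕ), 1 ≤ d ∧ 0 < c d ∧ ∀ κ : ℝ, 1 < κ → ∃ y₀ : ℝ≥0, ∀ y, y₀ ≤ y →
      (T y : ℝ) ≤ κ * (c d * (y : ℝ) ^ d) := by
  obtain ⟨N, hN⟩ := hfin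
  obtain ⟨n₀, hn₀, hcn₀⟩ := exists_pos_coeff hsum hmono
  have hn₀N : n₀ ≤ N := by
    by_contra! h
    exact hcn₀ (hN _ h.le)
  obtain ⟨d, ⟨hd1, hd⟩, hdmax⟩ : ∃ d, (1 ≤ d ∧ c d ≠ 0) ∧ ∀ n, d < n → c n = 0 := by
    classical
    refine ⟨Nat.findGreatest (fun n => 1 ≤ n ∧ c n ≠ 0) N,
      Nat.findGreatest_spec (P := fun n => 1 ≤ n ∧ c n ≠ 0) hn₀N ⟨hn₀, hcn₀⟩, fun n hn => ?_⟩
    by_contra h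
    have hnN : n ≤ N := by
      by_contra! h'
      exact h (hN _ h'.le)
    exact absurd ⟨by omega, h⟩ (Nat.findGreatest_is_greatest hn hnN)
  have hcd : 0 < c d := lt_of_le_of_ne (hc d) hd.symm
  refine ⟨d, hd1, hcd, fun κ hκ => ?_⟩
  set C := ∑ n ∈ Finset.range d, c n with hC
  have hC0 : 0 ≤ C := Finset.sum_nonneg fun n _ => hc n
  have hκ' : 0 < κ - 1 := by linarith
  refine ⟨max 1 (C / ((κ - 1) * c d)).toNNReal, fun y hy => ?_⟩
  have h1 : (1 : ℝ) ≤ y := (le_max_left _ _).trans hy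
  have h2 : C ≤ (κ - 1) * c d * y := by
    have h3 : C / ((κ - 1) * c d) ≤ y := (Real.le_coe_toNNReal _).trans
      (NNReal.coe_le_coe.2 ((le_max_right _ _).trans hy))
    rwa [div_le_iff₀ (by positivity), mul_comm] at h3
  have hT : (T y : ℝ) = ∑ n ∈ Finset.range (d + 1), c n * (y : ℝ) ^ n := by
    refine (hsum y).unique (hasSum_sum_of_ne_finset_zero fun n hn => ?_)
    rw [hdmax n (by rw [Finset.mem_range] at hn; omega), zero_mul]
  obtain ⟨e, rfl⟩ : ∃ e, d = e + 1 := ⟨d - 1, by omega⟩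
  rw [hT, Finset.sum_range_succ]
  have h3 : ∑ n ∈ Finset.range (e + 1), c n * (y : ℝ) ^ n ≤ C * (y : ℝ) ^ e := by
    rw [hC, Finset.sum_mul]
    refine Finset.sum_le_sum fun n hn => mul_le_mul_of_nonneg_left ?_ (hc n)
    exact pow_le_pow_right₀ h1 (by rw [Finset.mem_range] at hn; omega)
  have h4 : C * (y : ℝ) ^ e ≤ (κ - 1) * c (e + 1) * y * (y : ℝ) ^ e := by gcongr
  calc _ ≤ (κ - 1) * c (e + 1) * y * (y : ℝ) ^ e + c (e + 1) * (y : ℝ) ^ (e + 1) := by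
        linarith
    _ = _ := by ring

end PowerSeries

/-- For a continuous, strictly increasing and unbounded function, the generalized inverse is its
lower adjoint. -/
lemma gc_genInv {T : ℝ≥0 → ℝ≥0} (hT : Continuous T) (hmono : StrictMono T)
    (htop : Tendsto T atTop atTop) : GaloisConnection (genInv T) T := by
  intro y x
  have hne : {x : ℝ≥0 | y ≤ T x}.Nonempty := (htop.eventually_ge_atTop y).exists
  have hmem : genInv T y ∈ {x : ℝ≥0 | y ≤ T x} :=
    (isClosed_le continuous_const hT).csInf_mem hne (OrderBot.bddBelow _)
  exact ⟨fun h => hmem.trans (hmono.monotone h), fun h => csInf_le (OrderBot.bddBelow _) h⟩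

lemma tendsto_genInv_atTop {T : ℝ≥0 → ℝ≥0} (hmono : StrictMono T)
    (hgc : GaloisConnection (genInv T) T) : Tendsto (genInv T) atTop atTop := by
  refine tendsto_atTop.2 fun x => ?_
  filter_upwards [eventually_ge_atTop (T x)] with y hy
  exact hmono.le_iff_le.1 (hy.trans (hgc.le_u_l y))

lemma IsOrderedSeq.tendsto_max_nnnorm {a : ℤ → ℝ} (h : IsOrderedSeq a) :
    Tendsto (fun j => max ‖a j‖₊ ‖a (j + 1)‖₊) cofinite atTop := by
  refine tendsto_atTop_mono (fun j => le_max_left _ _) ?_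
  rw [← NNReal.tendsto_coe_atTop, Int.cofinite_eq]
  exact (tendsto_abs_atBot_atTop.comp h.tendsto_atBot).sup
    (tendsto_abs_atTop_atTop.comp h.tendsto_atTop)

/-! ### The finiteness theorem -/

/-- Finite-dimensionality for the weights built from a widely admissible function `T` and its
generalized inverse, with arbitrary powers inside and outside. -/
theorem finiteDimensional_of_widelyAdmissible {T : ℝ≥0 → ℝ≥0} (hT : WidelyAdmissible T) {u v : ℝ}
    (hu : 0 < u) (hv : 0 < v) {lam mu : ℤ → ℝ} (hlam : IsOrderedSeq lam) (hmu : IsOrderedSeq mu)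
    {b : ℝ} (hb : b < 1 / 2)
    (hlg : ∀ᶠ j : ℤ in cofinite, (genInv T ((max ‖lam j‖₊ ‖lam (j + 1)‖₊) ^ v⁻¹) : ℝ) ^ u⁻¹ *
      (lam (j + 1) - lam j) ≤ b)
    (hmg : ∀ᶠ j : ℤ in cofinite, (T ((max ‖mu j‖₊ ‖mu (j + 1)‖₊) ^ u) : ℝ) ^ v *
      (mu (j + 1) - mu j) ≤ b) :
    FiniteDimensional ℂ (vanishingSpace (Set.range lam) (Set.range mu)) := by
  obtain ⟨c, hc, hsum⟩ := hT.exists_hasSum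
  have hmono := hT.strictMono
  have hgc := gc_genInv hT.continuous hmono (tendsto_powerSeries_atTop hc hsum hmono)
  have hit := tendsto_genInv_atTop hmono hgc
  by_cases hinf : ∀ N, ∃ n, N ≤ n ∧ c n ≠ 0
  · refine finiteDimensional_of_superpolynomial
      (A := fun x => (genInv T (x ^ v⁻¹) : ℝ) ^ u⁻¹) (B := fun ξ => (T (ξ ^ u) : ℝ) ^ v)
      (fun x y hxy => ?_) (fun x y hxy => ?_) (fun x => by positivity) (fun x => by positivity)
      ?_ (fun N => ?_) hlam hmu hb hlg hmg
    · have h1 : (genInv T (x ^ v⁻¹) : ℝ) ≤ genInv T (y ^ v⁻¹) :=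
        NNReal.coe_le_coe.2 (hgc.monotone_l (NNReal.rpow_le_rpow hxy (by positivity)))
      exact Real.rpow_le_rpow (by positivity) h1 (by positivity)
    · have h1 : (T (x ^ u) : ℝ) ≤ T (y ^ u) :=
        NNReal.coe_le_coe.2 (hmono.monotone (NNReal.rpow_le_rpow hxy hu.le))
      exact Real.rpow_le_rpow (by positivity) h1 hv.le
    · exact (tendsto_rpow_atTop (inv_pos.2 hu)).comp (NNReal.tendsto_coe_atTop.2
        (hit.comp (NNReal.tendsto_rpow_atTop (inv_pos.2 hv))))
    · -- a proportion `2^(-1/v)` becomes one half after taking the power `v`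
      set θ : ℝ := (1 / 2 : ℝ) ^ v⁻¹ with hθ
      have hθ0 : 0 ≤ θ := by positivity
      obtain ⟨N', hN'⟩ := exists_nat_ge (N / (u * v))
      obtain ⟨y₀, hy₀, hgrow⟩ := exists_superpolynomial_growth hc hsum hinf
        (θ := θ) (Real.rpow_lt_one (by norm_num) (by norm_num) (by positivity)) N'
      obtain ⟨X₀, hX₀⟩ := (eventually_atTop.1 ((hit.comp
        (NNReal.tendsto_rpow_atTop (inv_pos.2 hv))).eventually_ge_atTop y₀))
      refine ⟨X₀, fun x hx ξ hξ => ?_⟩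
      set y₁ := genInv T (x ^ v⁻¹) with hy₁
      have hy₀₁ : y₀ ≤ y₁ := hX₀ x hx
      have hy₁0 : (0 : ℝ) < y₁ := NNReal.coe_pos.2 (hy₀.trans_le hy₀₁)
      set A : ℝ := (y₁ : ℝ) ^ u⁻¹ with hA
      have hA0 : 0 < A := by positivity
      have hAu : A ^ u = y₁ := Real.rpow_inv_rpow hy₁0.le hu.ne'
      have hy : y₁ ≤ ξ ^ u := by
        rw [← NNReal.coe_le_coe, NNReal.coe_rpow, ← hAu]
        exact Real.rpow_le_rpow hA0.le hξ hu.le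
      have h1 := hgrow y₁ (ξ ^ u) hy₀₁ hy
      have h2 : (x : ℝ) ^ v⁻¹ ≤ T y₁ := by
        rw [← NNReal.coe_rpow]
        exact hgc.le_u_l _
      have h3 : (((ξ ^ u : ℝ≥0) : ℝ) / y₁) = ((ξ : ℝ) / A) ^ u := by
        rw [Real.div_rpow (by positivity) hA0.le, hAu, NNReal.coe_rpow]
      have hw1 : 1 ≤ (ξ : ℝ) / A := (one_le_div hA0).2 hξ
      set w := (ξ : ℝ) / A with hw
      have hw0 : 0 ≤ w := by linarith
      rw [h3] at h1
      have h4 : θ * (x : ℝ) ^ v⁻¹ * (w ^ u) ^ N' ≤ T (ξ ^ u) := le_trans (by gcongr) h1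
      have h5 := Real.rpow_le_rpow (by positivity) h4 hv.le
      rw [Real.mul_rpow (by positivity) (by positivity), Real.mul_rpow hθ0 (by positivity),
        hθ, Real.rpow_inv_rpow (by norm_num) hv.ne', Real.rpow_inv_rpow (by positivity) hv.ne',
        ← Real.rpow_natCast, ← Real.rpow_mul hw0, ← Real.rpow_mul hw0] at h5
      have h6 : w ^ N ≤ w ^ (u * N' * v) := by
        rw [← Real.rpow_natCast]
        refine Real.rpow_le_rpow_of_exponent_le hw1 ?_
        rw [div_le_iff₀ (by positivity)] at hN'
        linarith
      have h7 : 1 / 2 * (x : ℝ) * w ^ N ≤ 1 / 2 * x * w ^ (u * N' * v) := by gcongr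
      linarith
  · push Not at hinf
    obtain ⟨d, hd, hcd, hlead⟩ := exists_leading_term hc hsum hmono hinf
    have hd0 : (0 : ℝ) < d := by exact_mod_cast hd
    -- there is room to enlarge the weights by a constant factor `κ > 1`
    set κ : ℝ := 1 + (1 / 2 - b) with hκ
    have hκ1 : 1 < κ := by linarith
    have hκb : κ * b < 1 / 2 := by
      rw [hκ]
      nlinarith
    have hκ0 : 0 < κ := by linarith
    obtain ⟨y₀, hy₀⟩ := hlead (κ ^ (u * d)) (Real.one_lt_rpow hκ1 (by positivity))
    set r := u * d * v with hr
    have hr0 : 0 < r := by positivity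
    refine finiteDimensional_of_inverse_powers (r := r) (c := c d ^ v) hr0
      (by positivity) hlam hmu hκb ?_ ?_
    · have hev := hlam.tendsto_max_nnnorm.eventually
        ((hit.comp (NNReal.tendsto_rpow_atTop (inv_pos.2 hv))).eventually_ge_atTop y₀)
      filter_upwards [hlg, hev] with j hj hj'
      set x := max ‖lam j‖₊ ‖lam (j + 1)‖₊ with hx
      set y := genInv T (x ^ v⁻¹) with hy
      have hgap : 0 ≤ lam (j + 1) - lam j := sub_nonneg.2 (hlam.strictMono (by omega)).le
      have h1 : (x : ℝ) ^ v⁻¹ ≤ κ ^ (u * d) * (c d * (y : ℝ) ^ d) := by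
        refine le_trans ?_ (hy₀ y hj')
        rw [← NNReal.coe_rpow]
        exact hgc.le_u_l _
      have h2 := Real.rpow_le_rpow (by positivity) h1 hv.le
      rw [Real.rpow_inv_rpow (by positivity) hv.ne', Real.mul_rpow (by positivity) (by positivity),
        Real.mul_rpow hcd.le (by positivity), ← Real.rpow_mul hκ0.le, ← hr] at h2
      have h3 : (x : ℝ) / c d ^ v ≤ (κ * (y : ℝ) ^ u⁻¹) ^ r := by
        rw [div_le_iff₀ (by positivity), Real.mul_rpow hκ0.le (by positivity),
          ← Real.rpow_mul (by positivity)]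
        refine h2.trans (le_of_eq ?_)
        rw [← Real.rpow_natCast, ← Real.rpow_mul (by positivity),
          show u⁻¹ * r = d * v by rw [hr]; field_simp]
        ring
      have h4 : ((x : ℝ) / c d ^ v) ^ r⁻¹ ≤ κ * (y : ℝ) ^ u⁻¹ := by
        refine (Real.rpow_le_rpow (by positivity) h3 (by positivity)).trans (le_of_eq ?_)
        exact Real.rpow_rpow_inv (by positivity) hr0.ne'
      calc _ ≤ κ * (y : ℝ) ^ u⁻¹ * (lam (j + 1) - lam j) := by gcongr
        _ = κ * ((y : ℝ) ^ u⁻¹ * (lam (j + 1) - lam j)) := by ring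
        _ ≤ _ := by gcongr
    · filter_upwards [hmg] with j hj
      set x := max ‖mu j‖₊ ‖mu (j + 1)‖₊ with hx
      have hgap : 0 ≤ mu (j + 1) - mu j := sub_nonneg.2 (hmu.strictMono (by omega)).le
      have h1 : c d ^ v * (x : ℝ) ^ r ≤ (T (x ^ u) : ℝ) ^ v := by
        have h2 := Real.rpow_le_rpow (by positivity) (coeff_mul_pow_le hc hsum d (x ^ u)) hv.le
        rwa [Real.mul_rpow hcd.le (by positivity), NNReal.coe_rpow, ← Real.rpow_natCast,
          ← Real.rpow_mul (by positivity), ← Real.rpow_mul (by positivity), ← mul_assoc, ← hr] at h2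
      have h3 : (T (x ^ u) : ℝ) ^ v * (mu (j + 1) - mu j) ≤
          κ * ((T (x ^ u) : ℝ) ^ v * (mu (j + 1) - mu j)) :=
        le_mul_of_one_le_left (by positivity) hκ1.le
      calc _ ≤ (T (x ^ u) : ℝ) ^ v * (mu (j + 1) - mu j) := by gcongr
        _ ≤ _ := h3.trans (by gcongr)

lemma exists_eventually_le_of_limsup_lt {ι : Type*} {F : Filter ι} {g : ι → ℝ} {m : ℝ}
    (h : limsup (fun j => (g j : EReal)) F < (m : EReal)) : ∃ b < m, ∀ᶠ j in F, g j ≤ b := by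
  obtain ⟨b, hb, hbm⟩ := EReal.lt_iff_exists_real_btwn.1 h
  refine ⟨b, EReal.coe_lt_coe_iff.1 hbm, ?_⟩
  filter_upwards [eventually_lt_of_limsup_lt hb] with j hj
  exact (EReal.coe_lt_coe_iff.1 hj).le

theorem mainTheorem7 (S Sinv : ℝ≥0 → ℝ≥0)
    (hS : (WidelyAdmissible S ∧ Sinv = genInv S) ∨ (WidelyAdmissible Sinv ∧ S = genInv Sinv))
    (s : ℝ) (hs : 0 < s) (lam mu : ℤ → ℝ)
    (hlam : IsOrderedSeq lam) (hmu : IsOrderedSeq mu)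
    (hlam_gap : limsup (fun j : ℤ =>
      (((Sinv (max ‖lam j‖₊ ‖lam (j + 1)‖₊) : ℝ) ^ (1 / s) * (lam (j + 1) - lam j) : ℝ) : EReal))
      cofinite < ((1 / 2 : ℝ) : EReal))
    (hmu_gap : limsup (fun j : ℤ =>
      (((S ((max ‖mu j‖₊ ‖mu (j + 1)‖₊) ^ s) : ℝ) * (mu (j + 1) - mu j) : ℝ) : EReal))
      cofinite < ((1 / 2 : ℝ) : EReal)) :
    FiniteDimensional ℂ (vanishingSpace (Set.range lam) (Set.range mu)) := by
  obtain ⟨b₁, hb₁, hl⟩ := exists_eventually_le_of_limsup_lt hlam_gap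
  obtain ⟨b₂, hb₂, hm⟩ := exists_eventually_le_of_limsup_lt hmu_gap
  have hl' := hl.mono fun j hj => hj.trans (le_max_left b₁ b₂)
  have hm' := hm.mono fun j hj => hj.trans (le_max_right b₁ b₂)
  rw [one_div] at hl'
  rcases hS with ⟨hT, rfl⟩ | ⟨hT, rfl⟩
  · refine finiteDimensional_of_widelyAdmissible hT hs one_pos hlam hmu (max_lt hb₁ hb₂) ?_ ?_
    · simpa only [inv_one, NNReal.rpow_one] using hl'
    · simpa only [Real.rpow_one] using hm'
  · -- the admissible function acts on the space side, so the two sides are exchanged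
    refine finiteDimensional_of_swap hmu (W := fun x => (genInv Sinv (x ^ s) : ℝ)) hm'
      fun nu hnu hng => ?_
    refine finiteDimensional_of_widelyAdmissible hT one_pos (inv_pos.2 hs) hnu hlam
      (max_lt hb₁ hb₂) ?_ ?_
    · simpa only [inv_one, inv_inv, Real.rpow_one] using hng
    · simpa only [NNReal.rpow_one] using hl'
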